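/- Let $\mathbb K$ be a field of characteristic $0$ and let $k,l\ge 0$. All polynomial rings are $\mathbb Z$-graded with variables in degree $2$. Let $R_k=\mathbb K[x_1,\dots,x_k]^{S_k}$, $R_{k,l}=\mathbb K[x_1,\dots,x_k,y_1,\dots,y_l]^{S_k\times S_l}$ and $R_{k+l}=\mathbb K[x_1,\dots,x_k,y_1,\dots,y_l]^{S_{k+l}}\subseteq R_{k,l}$. For a graded bimodule $M$ let $\mathbf q^sM$ be the shift with $(\mathbf q^sM)_d=M_{d-s}$, and let $\mathbf a^n$ denote placement in cohomological degree $n$. The merge–split web on the colors $k,l$ is the graded $R_{k,l}$-bimodule $$B_{k,l}=\mathbf q^{-kl}\,R_{k,l}\otimes_{R_{k+l}}R_{k,l},$$ and the $k$-colored identity strand is the graded $R_k$-bimodule $R_k$. For a graded $R_{k,l}$-bimodule $M$, the partial trace $T_{k,l}(M)$ (closure of the $l$-colored strand) is the complex of graded $R_k$-bimodules $$T_{k,l}(M)=\bigotimes_{j=1}^{l}\Big(M\xrightarrow{\;e_j\otimes 1-1\otimes e_j\;}\mathbf a\,\mathbf q^{-2j}M\Big),$$ where $e_j$ is the $j$-th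 elementary symmetric polynomial in $y_1,\dots,y_l$; that is, its term in cohomological degree $n$ is $\bigoplus_{S\subseteq\{1,\dots,l\},\,|S|=n}\mathbf q^{-2\sum_{j\in S}j}M$, with the Koszul differential. (It represents $\mathrm{RHom}_{R_{k,l}\otimes R_{k,l}}(Q,M)$ for $Q=R_{k,l}\otimes_{\mathbb K} R_{k,l}/(e_j\otimes1-1\otimes e_j)_{1\le j\le l}$.) **Lemma.** For all $k,l\ge0$ there is an isomorphism, preserving the cohomological degree $\mathbf a$ and the internal degree $\mathbf q$, in the derived category of $\mathbb Z$-graded $R_k$-bimodules $$T_{k,l}(B_{k,l})\;\cong\;\bigoplus_{i\in I}\mathbf a^{a_i}\mathbf q^{s_i}R_k ,$$ where the right-hand side has zero differential and the multiplicity has $\mathbf a\mathbf q$-graded dimension $$\sum_{i\in I}a^{a_i}q^{s_i}=\prod_{i=1}^{l}\frac{q^{k}+a\,q^{-k-2i}}{1-q^{2i}},$$ the right-hand side being expanded as a polynomial in $a$ over the Laurent series in $q$ (in particular there are only finitely many $i\in I$ of each bidegree). -/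

import Mathlib

open CategoryTheory
open scoped TensorProduct

universe u

namespace PartialTrace

/-! ### Graded bimodules -/

/-- A `ℤ`-graded `R`-bimodule over a commutative `K`-algebra `R` with degree pieces `𝒜 d`
(the two actions of `K` agree).  The left and the right action are two commuting algebra maps to
the endomorphisms of the underlying vector space (`R` is commutative, so no opposite ring is
needed for the right action), the space is the internal direct sum of its degree pieces, and both
actions add degrees. -/
structure GrBimod (K : Type u) {R : Type u} [Field K] [CommRing R] [Algebra K R]
    (𝒜 : ℤ → Submodule K R) where
  carrier : Type u
  [addCommGroup : AddCommGroup carrier]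
  [module : Module K carrier]
  lact : R →ₐ[K] Module.End K carrier
  ract : R →ₐ[K] Module.End K carrier
  comm : ∀ (a b : R) (m : carrier), lact a (ract b m) = ract b (lact a m)
  deg : ℤ → Submodule K carrier
  isInternal : DirectSum.IsInternal deg
  lact_mem : ∀ {i j : ℤ} {a : R} {m : carrier}, a ∈ 𝒜 i → m ∈ deg j → lact a m ∈ deg (i + j)
  ract_mem : ∀ {i j : ℤ} {a : R} {m : carrier}, a ∈ 𝒜 i → m ∈ deg j → ract a m ∈ deg (i + j)

attribute [instance] GrBimod.addCommGroup GrBimod.module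

/-- A family of subspaces that spans and is separated by additive projections is an internal
direct sum decomposition. -/
theorem isInternal_of_proj {K M : Type*} [Field K] [AddCommGroup M] [Module K M]
    (deg : ℤ → Submodule K M) (π : ℤ → M →+ M)
    (h₁ : ∀ d, ∀ m ∈ deg d, π d m = m) (h₂ : ∀ d e, e ≠ d → ∀ m ∈ deg d, π e m = 0)
    (h₃ : ⨆ d, deg d = ⊤) : DirectSum.IsInternal deg := by
  refine DirectSum.isInternal_submodule_of_iSupIndep_of_iSup_eq_top ?_ h₃
  intro d
  rw [Submodule.disjoint_def]
  intro m hm hm'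
  rw [← h₁ d m hm]
  clear hm
  induction hm' using Submodule.iSup_induction' with
  | mem e x hx =>
    by_cases h : e = d
    · subst h
      simp at hx
      simp [hx]
    · simp only [ne_eq, h, not_false_eq_true, iSup_pos] at hx
      exact h₂ e d (Ne.symm h) x hx
  | zero => simp
  | add x y _ _ hx hy => rw [map_add, hx, hy, add_zero]

section Category

variable {K R : Type u} [Field K] [CommRing R] [Algebra K R] {𝒜 : ℤ → Submodule K R}

namespace GrBimod

/-- The bimodule maps of degree zero. -/
def homs (M N : GrBimod K 𝒜) : Submodule K (M.carrier →ₗ[K] N.carrier) where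
  carrier := {f | (∀ a m, f (M.lact a m) = N.lact a (f m)) ∧
    (∀ a m, f (M.ract a m) = N.ract a (f m)) ∧ ∀ d, ∀ m ∈ M.deg d, f m ∈ N.deg d}
  zero_mem' := by simp
  add_mem' := by
    rintro f g ⟨hf, hf', hf''⟩ ⟨hg, hg', hg''⟩
    refine ⟨fun a m => by simp [hf, hg], fun a m => by simp [hf', hg'], fun d m hm => ?_⟩
    exact add_mem (hf'' d m hm) (hg'' d m hm)
  smul_mem' := by
    rintro c f ⟨hf, hf', hf''⟩
    refine ⟨fun a m => by simp [hf], fun a m => by simp [hf'], fun d m hm => ?_⟩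
    exact Submodule.smul_mem _ c (hf'' d m hm)

/-- The category of graded bimodules and bimodule maps of degree zero. -/
instance : Category (GrBimod K 𝒜) where
  Hom M N := homs M N
  id M := ⟨LinearMap.id, by simp [homs]⟩
  comp f g := ⟨g.1 ∘ₗ f.1, fun a m => by simp [f.2.1, g.2.1], fun a m => by simp [f.2.2.1, g.2.2.1],
    fun d m hm => g.2.2.2 d _ (f.2.2.2 d m hm)⟩

instance : Preadditive (GrBimod K 𝒜) where
  homGroup M N := inferInstanceAs (AddCommGroup (homs M N))
  add_comp _ _ _ f f' g := Subtype.ext (LinearMap.comp_add f.1 f'.1 g.1)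
  comp_add _ _ _ f g g' := Subtype.ext (LinearMap.add_comp f.1 g'.1 g.1)

/-- The underlying vector space. -/
def forget (K : Type u) {R : Type u} [Field K] [CommRing R] [Algebra K R]
    (𝒜 : ℤ → Submodule K R) : GrBimod K 𝒜 ⥤ ModuleCat.{u} K where
  obj M := ModuleCat.of K M.carrier
  map f := ModuleCat.ofHom f.1

instance : (forget K 𝒜).Additive where
  map_add := rfl

/-- Quasi-isomorphisms of cochain complexes of graded bimodules: the chain maps that induce
isomorphisms on cohomology (which is computed on the underlying vector spaces). -/
def quasiIso (K : Type u) {R : Type u} [Field K] [CommRing R] [Algebra K R]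
    (𝒜 : ℤ → Submodule K R) : MorphismProperty (CochainComplex (GrBimod K 𝒜) ℤ) :=
  (HomologicalComplex.quasiIso (ModuleCat.{u} K) (ComplexShape.up ℤ)).inverseImage
    ((forget K 𝒜).mapHomologicalComplex (ComplexShape.up ℤ))

/-- The derived category of graded bimodules: cochain complexes, with the quasi-isomorphisms
formally inverted. -/
abbrev Derived (K : Type u) {R : Type u} [Field K] [CommRing R] [Algebra K R]
    (𝒜 : ℤ → Submodule K R) : Type _ := (quasiIso K 𝒜).Localization

/-- A cochain complex of graded bimodules as an object of the derived category. -/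
abbrev toDerived (X : CochainComplex (GrBimod K 𝒜) ℤ) : Derived K 𝒜 := (quasiIso K 𝒜).Q.obj X

/-- The degree shift `𝐪ˢ M`, with `(𝐪ˢ M)_d = M_{d - s}`. -/
def shift (s : ℤ) (M : GrBimod K 𝒜) : GrBimod K 𝒜 where
  carrier := M.carrier
  lact := M.lact
  ract := M.ract
  comm := M.comm
  deg d := M.deg (d - s)
  isInternal := by
    refine DirectSum.isInternal_submodule_of_iSupIndep_of_iSup_eq_top ?_ ?_
    · exact M.isInternal.submodule_iSupIndep.comp (sub_left_injective (b := s))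
    · rw [← M.isInternal.submodule_iSup_eq_top]
      exact (Equiv.subRight s).iSup_comp (g := M.deg)
  lact_mem {i j a m} ha hm := by rw [add_sub_assoc]; exact M.lact_mem ha hm
  ract_mem {i j a m} ha hm := by rw [add_sub_assoc]; exact M.ract_mem ha hm

/-- The direct sum `⨁ᵢ 𝐪^{s i} M` of shifted copies of `M`. -/
noncomputable def copies {ι : Type} (s : ι → ℤ) (M : GrBimod K 𝒜) : GrBimod K 𝒜 where
  carrier := ι →₀ M.carrier
  lact :=
    { toFun a := Finsupp.mapRange.linearMap (M.lact a)
      map_one' := by ext; simp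
      map_mul' a b := by ext; simp
      map_zero' := by ext; simp
      map_add' a b := by ext; simp
      commutes' c := by ext; simp }
  ract :=
    { toFun a := Finsupp.mapRange.linearMap (M.ract a)
      map_one' := by ext; simp
      map_mul' a b := by ext; simp
      map_zero' := by ext; simp
      map_add' a b := by ext; simp
      commutes' c := by ext; simp }
  comm a b f := by ext i; simp [M.comm]
  deg d :=
    { carrier := {f | ∀ i, f i ∈ M.deg (d - s i)}
      zero_mem' i := by simp
      add_mem' hf hg i := add_mem (hf i) (hg i)
      smul_mem' c f hf i := Submodule.smul_mem _ c (hf i) }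
  isInternal := by
    classical
    let D : DirectSum.Decomposition M.deg := M.isInternal.chooseDecomposition
    let p : ℤ → M.carrier →+ M.carrier := fun d =>
      { toFun m := (DirectSum.decompose M.deg m d : M.carrier)
        map_zero' := by simp
        map_add' x y := by simp }
    have p₁ : ∀ d, ∀ m ∈ M.deg d, p d m = m := fun d m hm => DirectSum.decompose_of_mem_same _ hm
    have p₂ : ∀ d e, e ≠ d → ∀ m ∈ M.deg d, p e m = 0 := fun d e h m hm =>
      DirectSum.decompose_of_mem_ne _ hm h.symm
    refine isInternal_of_proj _ (fun d =>
      { toFun f := Finsupp.onFinset f.support (fun i => p (d - s i) (f i)) (fun i hi => by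
          rw [Finsupp.mem_support_iff]; rintro h; simp [h] at hi)
        map_zero' := by ext; simp
        map_add' f g := by ext; simp }) ?_ ?_ ?_
    · intro d f hf
      ext i
      exact p₁ _ _ (hf i)
    · intro d e h f hf
      ext i
      exact p₂ _ _ (fun h' => h (by simpa using h')) _ (hf i)
    · rw [eq_top_iff]
      intro f _
      induction f using Finsupp.induction_linear with
      | zero => exact zero_mem _
      | add f g hf hg => exact add_mem (hf trivial) (hg trivial)
      | single i m =>
        rename_i hf
        clear hf
        have hm : m ∈ ⨆ d, M.deg d := by rw [M.isInternal.submodule_iSup_eq_top]; trivial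
        induction hm using Submodule.iSup_induction' with
        | mem d x hx =>
          refine Submodule.mem_iSup_of_mem (d + s i) ?_
          intro j
          by_cases h : i = j
          · subst h; simpa using hx
          · simp [h]
        | zero => simp
        | add x y _ _ hx hy => rw [Finsupp.single_add]; exact add_mem hx hy
  lact_mem {i j a f} ha hf x := by
    rw [add_sub_assoc]; exact M.lact_mem ha (hf x)
  ract_mem {i j a f} ha hf x := by
    rw [add_sub_assoc]; exact M.ract_mem ha (hf x)

/-- Restriction of both actions along a graded algebra map. -/
def restrict {R' : Type u} [CommRing R'] [Algebra K R'] {ℬ : ℤ → Submodule K R'}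
    (φ : R' →ₐ[K] R) (hφ : ∀ d, ∀ a ∈ ℬ d, φ a ∈ 𝒜 d) (M : GrBimod K 𝒜) : GrBimod K ℬ where
  carrier := M.carrier
  lact := M.lact.comp φ
  ract := M.ract.comp φ
  comm a b := M.comm (φ a) (φ b)
  deg := M.deg
  isInternal := M.isInternal
  lact_mem ha hm := M.lact_mem (hφ _ _ ha) hm
  ract_mem ha hm := M.ract_mem (hφ _ _ ha) hm

end GrBimod

/-- The complex `⨁ᵢ 𝐚^{a i} 𝐪^{s i} M` with zero differential: the `i`-th copy of `M` is shifted
by `s i` and sits in cohomological degree `a i`. -/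
noncomputable def copiesComplex {ι : Type} (a : ι → ℕ) (s : ι → ℤ) (M : GrBimod K 𝒜) :
    CochainComplex (GrBimod K 𝒜) ℤ where
  X n := GrBimod.copies (fun i : {i : ι // (a i : ℤ) = n} => s i) M
  d _ _ := 0

end Category

/-! ### The bimodule `A ⊗_S A` -/

section TensorSquare

variable {K : Type u} [Field K] {S A : Type u} [CommRing S] [CommRing A] [Algebra K S]
  [Algebra K A] [Algebra S A] [IsScalarTower K S A]

/-- The degree `d` part of `A ⊗_S A`: it is spanned by the `a ⊗ b` with `a`, `b` homogeneous and
`deg a + deg b = d`. -/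
def tensorDeg (S : Type u) [CommRing S] [Algebra K S] [Algebra S A] [IsScalarTower K S A]
    (𝒜 : ℤ → Submodule K A) (d : ℤ) : Submodule K (A ⊗[S] A) :=
  Submodule.span K {t | ∃ i j : ℤ, i + j = d ∧ ∃ a ∈ 𝒜 i, ∃ b ∈ 𝒜 j, t = a ⊗ₜ b}

theorem isInternal_tensorDeg (𝒮 : ℤ → Submodule K S) (𝒜 : ℤ → Submodule K A)
    (h𝒮 : ⨆ d, 𝒮 d = ⊤) (h𝒜 : DirectSum.IsInternal 𝒜)
    (hsmul : ∀ {i j : ℤ} {s : S} {b : A}, s ∈ 𝒮 i → b ∈ 𝒜 j → s • b ∈ 𝒜 (i + j)) :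
    DirectSum.IsInternal (tensorDeg S 𝒜) := by
  classical
  let D : DirectSum.Decomposition 𝒜 := h𝒜.chooseDecomposition
  let p : ℤ → A →+ A := fun d =>
    { toFun m := (DirectSum.decompose 𝒜 m d : A)
      map_zero' := by simp
      map_add' x y := by simp }
  have p₁ : ∀ d, ∀ m ∈ 𝒜 d, p d m = m := fun d m hm => DirectSum.decompose_of_mem_same _ hm
  have p₂ : ∀ d e, e ≠ d → ∀ m ∈ 𝒜 d, p e m = 0 := fun d e h m hm =>
    DirectSum.decompose_of_mem_ne _ hm h.symm
  have ind : ∀ {P : A → Prop}, (∀ i, ∀ x ∈ 𝒜 i, P x) → (∀ x y, P x → P y → P (x + y)) →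
      ∀ x, P x := by
    intro P hmem hadd x
    have hx : x ∈ ⨆ d, 𝒜 d := by rw [h𝒜.submodule_iSup_eq_top]; trivial
    induction hx using Submodule.iSup_induction' with
    | mem i x hx => exact hmem i x hx
    | zero => exact hmem 0 0 (zero_mem _)
    | add x y _ _ hx hy => exact hadd x y hx hy
  have psmul : ∀ {i : ℤ} {s : S}, s ∈ 𝒮 i → ∀ (d : ℤ) (b : A),
      p d (s • b) = s • p (d - i) b := by
    intro i s hs d b
    refine ind (P := fun b => p d (s • b) = s • p (d - i) b) ?_ ?_ b
    · intro j b hb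
      by_cases h : d = i + j
      · subst h
        rw [p₁ _ _ (hsmul hs hb), add_sub_cancel_left, p₁ _ _ hb]
      · rw [p₂ _ _ h _ (hsmul hs hb), p₂ _ _ (fun h' => h (by omega)) _ hb, smul_zero]
    · intro x y hx hy
      simp only [smul_add, map_add, hx, hy]
  let mk : A →+ A →+ A ⊗[S] A :=
    { toFun a := (TensorProduct.mk S A A a).toAddMonoidHom
      map_zero' := by ext; simp
      map_add' a b := by ext; simp }
  let g : ℤ → ∀ i, 𝒜 i →+ A →+ A ⊗[S] A := fun d i =>
    { toFun x := (mk x).comp (p (d - i))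
      map_zero' := by simp
      map_add' a b := by ext; simp }
  let f : ℤ → A →+ A →+ A ⊗[S] A := fun d =>
    (DirectSum.toAddMonoid (g d)).comp (DirectSum.decomposeAddEquiv 𝒜).toAddMonoidHom
  have hf : ∀ (d : ℤ) {i : ℤ} {a : A}, a ∈ 𝒜 i → ∀ b, f d a b = a ⊗ₜ p (d - i) b := by
    intro d i a ha b
    have : (DirectSum.decomposeAddEquiv 𝒜) a = DirectSum.of (fun i => 𝒜 i) i ⟨a, ha⟩ :=
      DirectSum.decompose_of_mem _ ha
    simp only [f, AddMonoidHom.comp_apply, AddEquiv.coe_toAddMonoidHom, this,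
      DirectSum.toAddMonoid_of]
    rfl
  have hbal : ∀ (d : ℤ) (s : S) (a b : A), f d (s • a) b = f d a (s • b) := by
    intro d s a b
    have hs : s ∈ ⨆ d, 𝒮 d := by rw [h𝒮]; trivial
    refine ind (P := fun a => f d (s • a) b = f d a (s • b)) ?_ ?_ a
    · intro i a ha
      induction hs using Submodule.iSup_induction' with
      | mem j s hs =>
        rw [hf d (hsmul hs ha), hf d ha, psmul hs, TensorProduct.smul_tmul, sub_sub, add_comm]
      | zero => simp
      | add x y _ _ hx hy => simp only [add_smul, map_add, AddMonoidHom.add_apply, hx, hy]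
    · intro x y hx hy
      simp only [smul_add, map_add, AddMonoidHom.add_apply, hx, hy]
  let π : ℤ → A ⊗[S] A →+ A ⊗[S] A := fun d => TensorProduct.liftAddHom (f d) (hbal d)
  have hπ : ∀ (d : ℤ) (a b : A), π d (a ⊗ₜ b) = f d a b := fun _ _ _ => rfl
  have hgen : ∀ (d e : ℤ) (t : A ⊗[S] A), t ∈ tensorDeg S 𝒜 d →
      π e t = if e = d then t else 0 := by
    intro d e t ht
    refine Submodule.closure_induction (p := fun t _ => π e t = if e = d then t else 0)
      ?_ ?_ ?_ ht
    · simp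
    · intro x y _ _ hx hy
      rw [map_add, hx, hy]
      split_ifs <;> simp
    · rintro r x ⟨i, j, rfl, a, ha, b, hb, rfl⟩
      rw [TensorProduct.smul_tmul', hπ, hf e (Submodule.smul_mem _ r ha)]
      split_ifs with h
      · rw [h, add_sub_cancel_left, p₁ _ _ hb]
      · rw [p₂ _ _ (fun h' => h (by omega)) _ hb, TensorProduct.tmul_zero]
  refine isInternal_of_proj _ π (fun d t ht => by rw [hgen d d t ht, if_pos rfl])
    (fun d e h t ht => by rw [hgen d e t ht, if_neg h]) ?_
  rw [eq_top_iff]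
  intro t _
  induction t using TensorProduct.induction_on with
  | zero => exact zero_mem _
  | add x y hx hy => exact add_mem (hx trivial) (hy trivial)
  | tmul a b =>
    refine ind (P := fun a => a ⊗ₜ b ∈ ⨆ d, tensorDeg S 𝒜 d) ?_ ?_ a
    · intro i a ha
      refine ind (P := fun b => a ⊗ₜ b ∈ ⨆ d, tensorDeg S 𝒜 d) ?_ ?_ b
      · intro j b hb
        exact Submodule.mem_iSup_of_mem (i + j)
          (Submodule.subset_span ⟨i, j, rfl, a, ha, b, hb, rfl⟩)
      · intro x y hx hy
        rw [TensorProduct.tmul_add]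
        exact add_mem hx hy
    · intro x y hx hy
      rw [TensorProduct.add_tmul]
      exact add_mem hx hy

/-- The graded `A`-bimodule `A ⊗_S A`, for a graded algebra `A` over a graded ring `S`: the left
action multiplies the first and the right action multiplies the second tensor factor. -/
def GrBimod.tensorSquare (𝒮 : ℤ → Submodule K S) (𝒜 : ℤ → Submodule K A)
    (h𝒮 : ⨆ d, 𝒮 d = ⊤) (h𝒜 : DirectSum.IsInternal 𝒜)
    (hmul : ∀ {i j : ℤ} {a b : A}, a ∈ 𝒜 i → b ∈ 𝒜 j → a * b ∈ 𝒜 (i + j))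
    (hsmul : ∀ {i j : ℤ} {s : S} {b : A}, s ∈ 𝒮 i → b ∈ 𝒜 j → s • b ∈ 𝒜 (i + j)) :
    GrBimod K 𝒜 where
  carrier := A ⊗[S] A
  lact := (Algebra.lmul K (A ⊗[S] A)).comp Algebra.TensorProduct.includeLeft
  ract := (Algebra.lmul K (A ⊗[S] A)).comp
    (Algebra.TensorProduct.includeRight.restrictScalars K)
  comm a b m := mul_left_comm _ _ m
  deg := tensorDeg S 𝒜
  isInternal := isInternal_tensorDeg 𝒮 𝒜 h𝒮 h𝒜 hsmul
  lact_mem {i j a m} ha hm := by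
    induction hm using Submodule.span_induction with
    | mem t ht =>
      obtain ⟨p, q, rfl, x, hx, y, hy, rfl⟩ := ht
      refine Submodule.subset_span ⟨i + p, q, add_assoc _ _ _, a * x, hmul ha hx, y, hy, ?_⟩
      simp
    | zero => rw [map_zero]; exact zero_mem _
    | add x y _ _ hx hy => rw [map_add]; exact add_mem hx hy
    | smul c x _ hx => rw [map_smul]; exact Submodule.smul_mem _ _ hx
  ract_mem {i j a m} ha hm := by
    induction hm using Submodule.span_induction with
    | mem t ht =>
      obtain ⟨p, q, rfl, x, hx, y, hy, rfl⟩ := ht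
      refine Submodule.subset_span ⟨p, i + q, add_left_comm _ _ _, x, hx, a * y, hmul ha hy, ?_⟩
      simp
    | zero => rw [map_zero]; exact zero_mem _
    | add x y _ _ hx hy => rw [map_add]; exact add_mem hx hy
    | smul c x _ hx => rw [map_smul]; exact Submodule.smul_mem _ _ hx

end TensorSquare

/-! ### Rings of invariants -/

section Rings

variable (K : Type u) [Field K]

/-- The polynomials of degree `d`, where every variable has degree `2`. -/
noncomputable def polyDeg (σ : Type) (d : ℤ) : Submodule K (MvPolynomial σ K) where
  carrier := {p | ∀ m, p.coeff m ≠ 0 → 2 * (m.degree : ℤ) = d}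
  zero_mem' m hm := by simp at hm
  add_mem' {p q} hp hq m hm := by
    by_cases h : p.coeff m = 0
    · exact hq m (by simpa [h] using hm)
    · exact hp m h
  smul_mem' c p hp m hm := hp m (by rintro h; simp [h] at hm)

/-- The ring of polynomials invariant under a group `H` of permutations of the variables. -/
noncomputable def invariants {σ : Type} (H : Subgroup (Equiv.Perm σ)) : Subalgebra K (MvPolynomial σ K) where
  carrier := {p | ∀ g ∈ H, MvPolynomial.rename g p = p}
  mul_mem' hp hq g hg := by rw [map_mul, hp g hg, hq g hg]
  add_mem' hp hq g hg := by rw [map_add, hp g hg, hq g hg]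
  algebraMap_mem' c g _ := by simp

/-- The grading of a ring of invariants. -/
noncomputable def invDeg {σ : Type} (H : Subgroup (Equiv.Perm σ)) (d : ℤ) : Submodule K (invariants K H) :=
  (polyDeg K σ d).comap (invariants K H).val.toLinearMap


variable {K}

theorem mem_polyDeg_of_isHomogeneous {σ : Type} {p : MvPolynomial σ K} {n : ℕ}
    (hp : p.IsHomogeneous n) : p ∈ polyDeg K σ (2 * n) := by
  intro m hm
  have := hp hm
  replace this : m.degree = n := by
    rw [Finsupp.degree_eq_weight_one]; exact this
  simpa using congrArg (fun x : ℕ => 2 * (x : ℤ)) this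

theorem polyDeg_mul {σ : Type} {p q : MvPolynomial σ K} {i j : ℤ} (hp : p ∈ polyDeg K σ i)
    (hq : q ∈ polyDeg K σ j) : p * q ∈ polyDeg K σ (i + j) := by
  classical
  intro m hm
  rw [MvPolynomial.coeff_mul] at hm
  obtain ⟨⟨a, b⟩, hab, h⟩ := Finset.exists_ne_zero_of_sum_ne_zero hm
  rw [Finset.HasAntidiagonal.mem_antidiagonal] at hab
  have h₁ := hp a (left_ne_zero_of_mul h)
  have h₂ := hq b (right_ne_zero_of_mul h)
  rw [← hab, map_add]
  push_cast
  linarith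

theorem invDeg_mul {σ : Type} {H : Subgroup (Equiv.Perm σ)} {p q : invariants K H} {i j : ℤ}
    (hp : p ∈ invDeg K H i) (hq : q ∈ invDeg K H j) : p * q ∈ invDeg K H (i + j) :=
  polyDeg_mul hp hq

/-- The projection of a ring of invariants to its part of degree `d`. -/
noncomputable def invProj {σ : Type} (H : Subgroup (Equiv.Perm σ)) (d : ℤ) :
    invariants K H →ₗ[K] invariants K H where
  toFun p := ⟨if 0 ≤ d ∧ 2 ∣ d then MvPolynomial.homogeneousComponent (d / 2).toNat p.1 else 0, by
    intro g hg
    split_ifs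
    · have : MvPolynomial.rename g p.1 = p.1 := p.2 g hg
      rw [MvPolynomial.rename_homogeneousComponent, this]
    · simp⟩
  map_add' p q := by ext1; simp only [Subalgebra.coe_add, map_add]; split_ifs <;> simp
  map_smul' c p := by
    ext1; simp only [Subalgebra.coe_smul, map_smul, RingHom.id_apply]; split_ifs <;> simp

theorem coeff_invProj {σ : Type} (H : Subgroup (Equiv.Perm σ)) (d : ℤ) (p : invariants K H)
    (m : σ →₀ ℕ) : (invProj H d p).1.coeff m = if 2 * (m.degree : ℤ) = d then p.1.coeff m else 0 := by
  classical
  simp only [invProj, LinearMap.coe_mk, AddHom.coe_mk]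
  split_ifs with h₁ h₂ h₂
  · rw [MvPolynomial.coeff_homogeneousComponent, if_pos (by omega)]
  · rw [MvPolynomial.coeff_homogeneousComponent, if_neg (by omega)]
  · omega
  · simp

theorem invProj_mem {σ : Type} (H : Subgroup (Equiv.Perm σ)) (d : ℤ) (p : invariants K H) :
    invProj H d p ∈ invDeg K H d := by
  intro m hm
  by_contra h
  exact hm ((coeff_invProj H d p m).trans (if_neg h))

theorem invProj_same {σ : Type} (H : Subgroup (Equiv.Perm σ)) (d : ℤ) {p : invariants K H}
    (hp : p ∈ invDeg K H d) : invProj H d p = p := by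
  refine Subtype.ext (MvPolynomial.ext _ _ fun m => ?_)
  rw [coeff_invProj]
  split_ifs with h
  · rfl
  · by_contra h'
    exact h (hp m (Ne.symm h'))

theorem invProj_ne {σ : Type} (H : Subgroup (Equiv.Perm σ)) {d e : ℤ} (h : e ≠ d)
    {p : invariants K H} (hp : p ∈ invDeg K H d) : invProj H e p = 0 := by
  refine Subtype.ext (MvPolynomial.ext _ _ fun m => ?_)
  rw [coeff_invProj]
  split_ifs with h₁
  · by_contra h'
    exact h (h₁.symm.trans (hp m h'))
  · rfl

theorem iSup_invDeg {σ : Type} (H : Subgroup (Equiv.Perm σ)) : ⨆ d, invDeg K H d = ⊤ := by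
  rw [eq_top_iff]
  intro p _
  have : p = ∑ n ∈ Finset.range (p.1.totalDegree + 1), invProj H (2 * n) p := by
    refine Subtype.ext ?_
    conv_lhs => rw [← MvPolynomial.sum_homogeneousComponent p.1]
    rw [AddSubmonoidClass.coe_finsetSum]
    refine Finset.sum_congr rfl fun n _ => ?_
    simp [invProj]
  rw [this]
  exact Submodule.sum_mem _ fun n _ => Submodule.mem_iSup_of_mem _ (invProj_mem H _ p)

theorem isInternal_invDeg {σ : Type} (H : Subgroup (Equiv.Perm σ)) :
    DirectSum.IsInternal (invDeg K H) :=
  isInternal_of_proj _ (fun d => (invProj H d).toAddMonoidHom) (fun d _ hm => invProj_same H d hm)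
    (fun _ _ h _ hm => invProj_ne H h hm) (iSup_invDeg H)

variable (K)

/-- `R_k`: the symmetric polynomials in `k` variables. -/
noncomputable abbrev sym (k : ℕ) : Subalgebra K (MvPolynomial (Fin k) K) :=
  invariants K (⊤ : Subgroup (Equiv.Perm (Fin k)))

/-- `R_{k,l}`: the polynomials in the alphabets `x₁,…,x_k` and `y₁,…,y_l` that are symmetric in
each of the two alphabets. -/
noncomputable def symPair (k l : ℕ) : Subalgebra K (MvPolynomial (Fin k ⊕ Fin l) K) :=
  invariants K (Equiv.Perm.sumCongrHom (Fin k) (Fin l)).range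

/-- `R_{k+l}`: the symmetric polynomials in the union of the two alphabets. -/
noncomputable def symTot (k l : ℕ) : Subalgebra K (MvPolynomial (Fin k ⊕ Fin l) K) :=
  invariants K (⊤ : Subgroup (Equiv.Perm (Fin k ⊕ Fin l)))

/-- The grading of `R_k`. -/
noncomputable abbrev symDeg (k : ℕ) (d : ℤ) : Submodule K (sym K k) := invDeg K ⊤ d

/-- The grading of `R_{k,l}`. -/
noncomputable def pairDeg (k l : ℕ) (d : ℤ) : Submodule K (symPair K k l) :=
  invDeg K (Equiv.Perm.sumCongrHom (Fin k) (Fin l)).range d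

theorem symTot_le (k l : ℕ) : symTot K k l ≤ symPair K k l := fun _ hp g _ => hp g trivial

/-- `R_{k,l}` is an algebra over its subring `R_{k+l}`. -/
noncomputable instance (k l : ℕ) : Algebra (symTot K k l) (symPair K k l) :=
  (Subalgebra.inclusion (symTot_le K k l)).toAlgebra

instance (k l : ℕ) : IsScalarTower K (symTot K k l) (symPair K k l) :=
  IsScalarTower.of_algebraMap_eq' (Subalgebra.inclusion (symTot_le K k l)).comp_algebraMap.symm

/-- The inclusion of `R_k` into `R_{k,l}` as the symmetric polynomials in the first alphabet. -/
noncomputable def symInl (k l : ℕ) : sym K k →ₐ[K] symPair K k l :=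
  ((MvPolynomial.rename Sum.inl).comp (sym K k).val).codRestrict _ (by
    rintro ⟨p, hp⟩ g ⟨⟨a, b⟩, rfl⟩
    simp only [AlgHom.coe_comp, Function.comp_apply, Subalgebra.coe_val, MvPolynomial.rename_rename]
    conv_rhs => rw [← hp a trivial, MvPolynomial.rename_rename]
    rfl)

theorem symInl_mem (k l : ℕ) (d : ℤ) (a : sym K k) (ha : a ∈ symDeg K k d) :
    symInl K k l a ∈ pairDeg K k l d := by
  intro m hm
  have hm' : (MvPolynomial.rename Sum.inl a.1 : MvPolynomial (Fin k ⊕ Fin l) K).coeff m ≠ 0 := hm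
  obtain ⟨u, rfl, hu⟩ := MvPolynomial.coeff_rename_ne_zero _ _ _ hm'
  rw [Finsupp.degree_mapDomain]
  exact ha u hu

/-- The elementary symmetric polynomial `e_r` in the second alphabet, as an element of
`R_{k,l}`. -/
noncomputable def esymmSnd (k l r : ℕ) : symPair K k l :=
  ⟨MvPolynomial.rename Sum.inr (MvPolynomial.esymm (Fin l) K r), by
    rintro g ⟨⟨a, b⟩, rfl⟩
    conv_rhs => rw [← MvPolynomial.rename_esymm _ _ _ b, MvPolynomial.rename_rename]
    rw [MvPolynomial.rename_rename]
    rfl⟩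

theorem esymmSnd_mem (k l r : ℕ) : esymmSnd K k l r ∈ pairDeg K k l (2 * r) :=
  mem_polyDeg_of_isHomogeneous (MvPolynomial.IsHomogeneous.rename_isHomogeneous (by
    refine MvPolynomial.IsHomogeneous.sum _ _ _ fun t ht => ?_
    have h := MvPolynomial.IsHomogeneous.prod t (fun i => (MvPolynomial.X i : MvPolynomial (Fin l) K))
      (fun _ => 1) fun i _ => MvPolynomial.isHomogeneous_X K i
    rwa [Finset.sum_const, smul_eq_mul, mul_one, (Finset.mem_powersetCard.1 ht).2] at h))

/-! ### The bimodules -/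

/-- The identity bimodule `R_k`, i.e. the `k`-coloured strand. -/
noncomputable def strand (k : ℕ) : GrBimod K (symDeg K k) where
  carrier := sym K k
  lact := Algebra.lmul K (sym K k)
  ract := Algebra.lmul K (sym K k)
  comm a b m := mul_left_comm a b m
  deg := symDeg K k
  isInternal := isInternal_invDeg _
  lact_mem ha hm := invDeg_mul ha hm
  ract_mem ha hm := invDeg_mul ha hm

theorem isInternal_pairDeg (k l : ℕ) : DirectSum.IsInternal (pairDeg K k l) :=
  isInternal_invDeg _

/-- The grading of `R_{k+l}`. -/
noncomputable def totDeg (k l : ℕ) (d : ℤ) : Submodule K (symTot K k l) :=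
  invDeg K (⊤ : Subgroup (Equiv.Perm (Fin k ⊕ Fin l))) d

theorem iSup_totDeg (k l : ℕ) : ⨆ d, totDeg K k l d = ⊤ := iSup_invDeg _

theorem pairDeg_mul (k l : ℕ) {i j : ℤ} {a b : symPair K k l} (ha : a ∈ pairDeg K k l i)
    (hb : b ∈ pairDeg K k l j) : a * b ∈ pairDeg K k l (i + j) := invDeg_mul ha hb

theorem totDeg_smul (k l : ℕ) {i j : ℤ} {s : symTot K k l} {b : symPair K k l}
    (hs : s ∈ totDeg K k l i) (hb : b ∈ pairDeg K k l j) : s • b ∈ pairDeg K k l (i + j) :=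
  pairDeg_mul K k l (a := Subalgebra.inclusion (symTot_le K k l) s) hs hb

/-- The merge-split bimodule on the colours `k` and `l`, i.e.
`𝐪^{-kl} R_{k,l} ⊗_{R_{k+l}} R_{k,l}`. -/
noncomputable def mergeSplit (k l : ℕ) : GrBimod K (pairDeg K k l) :=
  GrBimod.shift (-(k * l : ℤ)) (GrBimod.tensorSquare (totDeg K k l) (pairDeg K k l)
    (iSup_totDeg K k l) (isInternal_pairDeg K k l) (pairDeg_mul K k l) (totDeg_smul K k l))

/-! ### The partial trace -/

section Koszul

variable {M : Type*} [AddCommGroup M] {l : ℕ}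

/-- The Koszul differential for commuting operators `δ₁,…,δ_l` on families indexed by the subsets
of `{1,…,l}`: the component at `S` is `∑_{j ∈ S} ± δ_j` applied to the component at `S ∖ {j}`, the
sign being the parity of the number of elements of `S` that are smaller than `j`. -/
def koszul (δ : Fin l → M →+ M) (F : Finset (Fin l) → M) (S : Finset (Fin l)) : M :=
  ∑ j ∈ S, (-1 : ℤ) ^ (S.filter (· < j)).card • δ j (F (S.erase j))

theorem koszul_sign (S : Finset (Fin l)) {i j : Fin l} (hi : i ∈ S) (h : i < j) :
    (-1 : ℤ) ^ (S.filter (· < i)).card * (-1) ^ ((S.erase i).filter (· < j)).card +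
      (-1 : ℤ) ^ (S.filter (· < j)).card * (-1) ^ ((S.erase j).filter (· < i)).card = 0 := by
  have h₁ : (S.filter (· < j)).card = ((S.erase i).filter (· < j)).card + 1 := by
    rw [Finset.filter_erase, Finset.card_erase_add_one]
    simp [hi, h]
  have h₂ : (S.erase j).filter (· < i) = S.filter (· < i) := by
    rw [Finset.filter_erase, Finset.erase_eq_of_notMem]
    simp [h.le]
  rw [h₁, h₂, pow_succ]
  ring

theorem koszul_koszul (δ : Fin l → M →+ M) (hδ : ∀ i j m, δ i (δ j m) = δ j (δ i m))
    (F : Finset (Fin l) → M) : koszul δ (koszul δ F) = 0 := by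
  funext S
  simp only [koszul, Pi.zero_apply, map_sum, map_zsmul, Finset.smul_sum]
  rw [Finset.sum_sigma']
  refine Finset.sum_involution (fun x _ => ⟨x.2, x.1⟩) ?_ ?_ ?_ ?_
  · rintro ⟨i, j⟩ h
    simp only [Finset.mem_sigma, Finset.mem_erase] at h
    simp only [smul_smul, hδ j i, Finset.erase_right_comm (a := j) (b := i), ← add_smul]
    rcases lt_or_gt_of_ne h.2.1 with h' | h'
    · rw [add_comm, koszul_sign S h.2.2 h', zero_smul]
    · rw [koszul_sign S h.1 h', zero_smul]
  · rintro ⟨i, j⟩ h _ h'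
    simp only [Finset.mem_sigma, Finset.mem_erase] at h
    simp only [Sigma.mk.injEq] at h'
    exact h.2.1 h'.1
  · rintro ⟨i, j⟩ h
    simp only [Finset.mem_sigma, Finset.mem_erase] at h ⊢
    exact ⟨h.2.2, h.2.1.symm, h.1⟩
  · rintro ⟨i, j⟩ h
    rfl

end Koszul

/-- The operator `e_j ⊗ 1 - 1 ⊗ e_j` on an `R_{k,l}`-bimodule, where `e_j` (`1 ≤ j ≤ l`) is the
elementary symmetric polynomial in the second alphabet (the index `j : Fin l` starts at `0`). -/
noncomputable def esymmDiff {k l : ℕ} (M : GrBimod K (pairDeg K k l)) (j : Fin l) :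
    M.carrier →ₗ[K] M.carrier :=
  M.lact (esymmSnd K k l (j + 1)) - M.ract (esymmSnd K k l (j + 1))

/-- The `n`-th term `⨁_{|S| = n} 𝐪^{-2 ∑_{j ∈ S} j} M` of the partial trace. -/
noncomputable def traceX {k l : ℕ} (M : GrBimod K (pairDeg K k l)) (n : ℤ) :
    GrBimod K (symDeg K k) :=
  GrBimod.copies (fun S : {S : Finset (Fin l) // (S.card : ℤ) = n} => -∑ j ∈ S.1, 2 * ((j : ℤ) + 1))
    (GrBimod.restrict (symInl K k l) (symInl_mem K k l) M)

/-- The Koszul differential of the operators `e_j ⊗ 1 - 1 ⊗ e_j` as a linear map. -/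
noncomputable def traceKoszul {k l : ℕ} (M : GrBimod K (pairDeg K k l)) :
    (Finset (Fin l) → M.carrier) →ₗ[K] (Finset (Fin l) → M.carrier) where
  toFun := koszul fun j => (esymmDiff K M j).toAddMonoidHom
  map_add' F G := by
    funext S
    simp [koszul, Finset.sum_add_distrib]
  map_smul' c F := by
    funext S
    simp only [koszul, Pi.smul_apply, LinearMap.toAddMonoidHom_coe, map_smul, RingHom.id_apply,
      Finset.smul_sum]
    exact Finset.sum_congr rfl fun j _ => smul_comm _ _ _

/-- An element of the `n`-th term as a family indexed by all subsets, extended by zero. -/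
noncomputable def traceExt {k l : ℕ} (M : GrBimod K (pairDeg K k l)) (n : ℤ) :
    ({S : Finset (Fin l) // (S.card : ℤ) = n} →₀ M.carrier) →ₗ[K]
      (Finset (Fin l) → M.carrier) where
  toFun f S := if h : (S.card : ℤ) = n then f ⟨S, h⟩ else 0
  map_add' f g := by funext S; dsimp only [Pi.add_apply]; split_ifs <;> simp
  map_smul' c f := by funext S; dsimp only [Pi.smul_apply]; split_ifs <;> simp

theorem traceExt_of_ne {k l : ℕ} (M : GrBimod K (pairDeg K k l)) (n : ℤ)
    (f : {S : Finset (Fin l) // (S.card : ℤ) = n} →₀ M.carrier) {S : Finset (Fin l)}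
    (h : (S.card : ℤ) ≠ n) : traceExt K M n f S = 0 := dif_neg h

/-- The restriction of a family indexed by all subsets to the subsets with `m` elements. -/
noncomputable def traceRes {k l : ℕ} (M : GrBimod K (pairDeg K k l)) (m : ℤ) :
    (Finset (Fin l) → M.carrier) →ₗ[K]
      ({S : Finset (Fin l) // (S.card : ℤ) = m} →₀ M.carrier) :=
  (Finsupp.linearEquivFunOnFinite K M.carrier _).symm.toLinearMap ∘ₗ
    LinearMap.funLeft K M.carrier Subtype.val

theorem traceRes_apply {k l : ℕ} (M : GrBimod K (pairDeg K k l)) (m : ℤ)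
    (F : Finset (Fin l) → M.carrier) (S : {S : Finset (Fin l) // (S.card : ℤ) = m}) :
    traceRes K M m F S = F S.1 := rfl

theorem traceExt_deg {k l : ℕ} (M : GrBimod K (pairDeg K k l)) {n d : ℤ}
    {f : {S : Finset (Fin l) // (S.card : ℤ) = n} →₀ M.carrier} (hf : f ∈ (traceX K M n).deg d)
    (S : Finset (Fin l)) :
    traceExt K M n f S ∈ M.deg (d + ∑ j ∈ S, 2 * ((j : ℤ) + 1)) := by
  simp only [traceExt, LinearMap.coe_mk, AddHom.coe_mk]
  split_ifs with h
  · have := hf ⟨S, h⟩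
    rwa [sub_neg_eq_add] at this
  · exact zero_mem _

theorem esymmDiff_deg {k l : ℕ} (M : GrBimod K (pairDeg K k l)) (j : Fin l) {d : ℤ}
    {m : M.carrier} (hm : m ∈ M.deg d) : esymmDiff K M j m ∈ M.deg (d + 2 * ((j : ℤ) + 1)) := by
  have h := esymmSnd_mem K k l (j + 1)
  rw [add_comm]
  exact_mod_cast sub_mem (M.lact_mem h hm) (M.ract_mem h hm)

theorem esymmDiff_lact {k l : ℕ} (M : GrBimod K (pairDeg K k l)) (j : Fin l) (a : symPair K k l)
    (m : M.carrier) : esymmDiff K M j (M.lact a m) = M.lact a (esymmDiff K M j m) := by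
  simp only [esymmDiff, LinearMap.sub_apply, map_sub, M.comm]
  congr 1
  rw [← Module.End.mul_apply, ← Module.End.mul_apply, ← map_mul, ← map_mul, mul_comm]

theorem esymmDiff_ract {k l : ℕ} (M : GrBimod K (pairDeg K k l)) (j : Fin l) (a : symPair K k l)
    (m : M.carrier) : esymmDiff K M j (M.ract a m) = M.ract a (esymmDiff K M j m) := by
  simp only [esymmDiff, LinearMap.sub_apply, map_sub, M.comm]
  congr 1
  rw [← Module.End.mul_apply, ← Module.End.mul_apply, ← map_mul, ← map_mul, mul_comm]

theorem esymmDiff_comm {k l : ℕ} (M : GrBimod K (pairDeg K k l)) (i j : Fin l) (m : M.carrier) :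
    esymmDiff K M i (esymmDiff K M j m) = esymmDiff K M j (esymmDiff K M i m) := by
  conv_lhs => rw [esymmDiff.eq_1 K M j]
  conv_rhs => rw [esymmDiff.eq_1 K M j]
  simp only [LinearMap.sub_apply, map_sub, esymmDiff_lact, esymmDiff_ract]

theorem koszul_natural {k l : ℕ} (M : GrBimod K (pairDeg K k l)) (φ : M.carrier →ₗ[K] M.carrier)
    (hφ : ∀ j m, esymmDiff K M j (φ m) = φ (esymmDiff K M j m)) (n m : ℤ)
    (f : {S : Finset (Fin l) // (S.card : ℤ) = n} →₀ M.carrier) :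
    traceRes K M m (traceKoszul K M (traceExt K M n (Finsupp.mapRange.linearMap φ f))) =
      Finsupp.mapRange.linearMap φ (traceRes K M m (traceKoszul K M (traceExt K M n f))) := by
  have h : traceExt K M n (Finsupp.mapRange.linearMap φ f) = fun S => φ (traceExt K M n f S) := by
    funext S
    simp only [traceExt, LinearMap.coe_mk, AddHom.coe_mk]
    split_ifs <;> simp
  ext S
  rw [h, Finsupp.mapRange.linearMap_apply, Finsupp.mapRange_apply, traceRes_apply, traceRes_apply]
  simp [traceKoszul, koszul, hφ]

/-- The component of the Koszul differential from the `n`-th to the `m`-th term (it vanishes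
unless `m = n + 1`). -/
noncomputable def traceD {k l : ℕ} (M : GrBimod K (pairDeg K k l)) (n m : ℤ) :
    traceX K M n ⟶ traceX K M m :=
  ⟨traceRes K M m ∘ₗ traceKoszul K M ∘ₗ traceExt K M n,
    fun a f => koszul_natural K M (M.lact (symInl K k l a))
      (fun j m => esymmDiff_lact K M j _ m) n m f,
    fun a f => koszul_natural K M (M.ract (symInl K k l a))
      (fun j m => esymmDiff_ract K M j _ m) n m f, by
    intro d f hf S
    change traceRes K M m (traceKoszul K M (traceExt K M n f)) S ∈
      M.deg (d - -∑ j ∈ S.1, 2 * ((j : ℤ) + 1))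
    rw [sub_neg_eq_add, traceRes_apply]
    refine sum_mem fun j hj => zsmul_mem ?_ _
    have := esymmDiff_deg K M j (traceExt_deg K M hf (S.1.erase j))
    rwa [add_assoc, Finset.sum_erase_add _ _ hj] at this⟩

theorem traceExt_traceRes {k l : ℕ} (M : GrBimod K (pairDeg K k l)) (n : ℤ)
    (f : {S : Finset (Fin l) // (S.card : ℤ) = n} →₀ M.carrier) :
    traceExt K M (n + 1) (traceRes K M (n + 1) (traceKoszul K M (traceExt K M n f))) =
      traceKoszul K M (traceExt K M n f) := by
  funext S
  by_cases h : (S.card : ℤ) = n + 1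
  · rw [traceExt, LinearMap.coe_mk, AddHom.coe_mk, dif_pos h, traceRes_apply]
  · rw [traceExt, LinearMap.coe_mk, AddHom.coe_mk, dif_neg h]
    refine (Finset.sum_eq_zero fun j hj => ?_).symm
    have : ((S.erase j).card : ℤ) ≠ n := by
      have := Finset.card_erase_add_one hj
      omega
    rw [traceExt_of_ne K M n f this, map_zero, smul_zero]

/-- The partial trace of a graded `R_{k,l}`-bimodule `M`, i.e. the closure of its `l`-coloured
strand.  It is the right adjoint of derived induction from `R_k`-bimodules, that is, `RHom` over the enveloping algebra of `R_{k,l}` from the quotient of this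
enveloping algebra by the elements `e_j ⊗ 1 - 1 ⊗ e_j` (`1 ≤ j ≤ l`, `e_j` the elementary symmetric
polynomials in the second alphabet), computed by the Koszul resolution: the complex
`⨂_{j=1}^{l} (M → 𝐚 𝐪^{-2j} M)` of graded `R_k`-bimodules, the `j`-th map being
`e_j ⊗ 1 - 1 ⊗ e_j`. -/
noncomputable def partialTrace {k l : ℕ} (M : GrBimod K (pairDeg K k l)) :
    CochainComplex (GrBimod K (symDeg K k)) ℤ where
  X := traceX K M
  d := traceD K M
  shape n m h := by
    refine Subtype.ext (LinearMap.ext fun f => Finsupp.ext fun S => ?_)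
    refine Finset.sum_eq_zero fun j hj => ?_
    have : ((S.1.erase j).card : ℤ) ≠ n := by
      have h₁ := Finset.card_erase_add_one hj
      have h₂ := S.2
      simp only [ComplexShape.up_Rel] at h
      omega
    have h₃ := traceExt_of_ne K M n f this
    change _ • esymmDiff K M j (traceExt K M n f (S.1.erase j)) = 0
    rw [h₃, map_zero, smul_zero]
  d_comp_d' n m p h h' := by
    simp only [ComplexShape.up_Rel] at h h'
    subst h h'
    refine Subtype.ext (LinearMap.ext fun f => ?_)
    change traceRes K M _ (traceKoszul K M (traceExt K M _
      (traceRes K M _ (traceKoszul K M (traceExt K M n f))))) = 0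
    have h₁ := traceExt_traceRes K M n f
    have h₂ : traceKoszul K M (traceKoszul K M (traceExt K M n f)) = 0 :=
      koszul_koszul _ (esymmDiff_comm K M) _
    have h₃ := congrArg (traceRes K M (n + 1 + 1)) ((congrArg (traceKoszul K M) h₁).trans h₂)
    exact h₃.trans (map_zero _)

end Rings

/-! ### The multiplicity -/

open Polynomial in
/-- The series `∏_{i=1}^{l} (q^k + a q^{-k-2i}) / (1 - q^{2i})`, as a polynomial in `a` over the
Laurent series in `q`. -/
noncomputable def multSeries (k l : ℕ) : Polynomial (LaurentSeries ℚ) :=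
  ∏ i ∈ Finset.Icc 1 l,
    (C (HahnSeries.single (k : ℤ) 1) + X * C (HahnSeries.single (-(k : ℤ) - 2 * i) 1)) *
      C ((1 - HahnSeries.single (2 * i : ℤ) 1)⁻¹)

/-- The `𝐚𝐪`-graded dimension of a bigraded vector space with a homogeneous basis indexed by `ι`,
the `i`-th basis vector being of bidegree `(a i, s i)`, is the series `P`: there are only finitely
many basis vectors of each bidegree, and the coefficients of `P` count them. -/
def HasGradedDim {ι : Type} (a : ι → ℕ) (s : ι → ℤ) (P : Polynomial (LaurentSeries ℚ)) : Prop :=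
  ∀ (n : ℕ) (d : ℤ), {i | a i = n ∧ s i = d}.Finite ∧
    (P.coeff n).coeff d = ({i | a i = n ∧ s i = d}.ncard : ℚ)

end PartialTrace

set_option autoImplicit false

/-! Write `A` for `R_{k,l}`, `S` for `R_{k+l}`, `Δ(a) = a ⊗ 1 - 1 ⊗ a` in `A ⊗_K A`, `u_j` and `v_j`
for the elementary symmetric polynomials in the second and the first alphabet, and `E_j` for those
in both. Both sides of the lemma are computed from one complex, `resolution`: the Koszul complex
over `A ⊗_K A` of the `2l + k` elements `Δ(u_1), …, Δ(u_l), Δ(E_1), …, Δ(E_{l+k})`. Dividing a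
Koszul complex by a regular element replaces it by the Koszul complex of the remaining elements over
the quotient ring (`modQuasiIso_cone`), and this can be done from either end of the sequence.

From the right end: `S` is a polynomial ring on the `E_j`, so the `Δ(E_j)` form a regular sequence
in `S ⊗_K S`. In characteristic zero `A` is flat over `S` (`flat_symPair`), hence the sequence stays
regular in `A ⊗_K A`, where its quotient is `A ⊗_S A`. What remains is the Koszul complex of the
`Δ(u_j)` on `A ⊗_S A`, that is, the partial trace (`traceComparison`).

From the left end: the first `l + k` elements are `Δ(u_1), …, Δ(u_l), Δ(E_1), …, Δ(E_k)`. As `E_n =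
∑ v_i u_{n-i}`, they differ by a triangular substitution (`tensorDiff_triangular`) from the
differences of the polynomial generators `u_j`, `v_j` of `A`. They are therefore regular, with
quotient `A`. The other elements `Δ(E_{k+1}), …, Δ(E_{k+l})` vanish in this quotient, so the
differential becomes zero and `2^l` shifted copies of `A` remain. Since `A` is free over `R_k` on
the monomials in the `u_j`, these are copies of the strand (`copiesComparison`).

A copy is thus indexed by a subset of `{1, …, l}` and a monomial in the `u_j`. The degree of
`Δ(E_{k+i})` gives the factor `q^k + a q^{-k-2i}`, and the powers of `u_i` give `1 / (1 - q^{2i})`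
(`hasGradedDim_strandShift`). -/

namespace PartialTrace

/-! ### Koszul complexes over a commutative ring -/

section KoszulRing

variable {P : Type*} [CommRing P]

/-- Restriction along `e : Y → X` induces an isomorphism from the cohomology of `d` on `(P ⧸ I)^X`
to that of `d'` on `(P ⧸ J)^Y`. -/
structure ModQuasiIso {X Y : Type*} (d : (X → P) →ₗ[P] (X → P)) (I : Ideal P)
    (d' : (Y → P) →ₗ[P] (Y → P)) (J : Ideal P) (e : Y → X) : Prop where
  cycle : ∀ F : X → P, (∀ x, d F x ∈ I) → ∀ y, d' (F ∘ e) y ∈ J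
  boundary : ∀ F : X → P, (∃ G : X → P, ∀ x, F x - d G x ∈ I) → ∃ G : Y → P, ∀ y, F (e y) - d' G y ∈ J
  inj : ∀ F : X → P, (∀ x, d F x ∈ I) → (∃ G : Y → P, ∀ y, F (e y) - d' G y ∈ J) → ∃ G : X → P, ∀ x, F x - d G x ∈ I
  surj : ∀ G : Y → P, (∀ y, d' G y ∈ J) →
    ∃ F : X → P, (∀ x, d F x ∈ I) ∧ ∃ H : Y → P, ∀ y, F (e y) - G y - d' H y ∈ J

theorem ModQuasiIso.refl {X : Type*} (d : (X → P) →ₗ[P] (X → P)) (I : Ideal P) :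
    ModQuasiIso d I d I id where
  cycle _ h := h
  boundary _ h := h
  inj _ _ h := h
  surj G h := ⟨G, h, 0, by simp⟩

theorem ModQuasiIso.trans {X Y Z : Type*} {d : (X → P) →ₗ[P] (X → P)} {I : Ideal P}
    {d' : (Y → P) →ₗ[P] (Y → P)} {I' : Ideal P} {d'' : (Z → P) →ₗ[P] (Z → P)} {I'' : Ideal P}
    {e : Y → X} {e' : Z → Y} (h : ModQuasiIso d I d' I' e) (h' : ModQuasiIso d' I' d'' I'' e') :
    ModQuasiIso d I d'' I'' (e ∘ e') where
  cycle F hF := h'.cycle _ (h.cycle F hF)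
  boundary F hF := h'.boundary _ (h.boundary F hF)
  inj F hF hG := h.inj F hF (h'.inj _ (h.cycle F hF) hG)
  surj G hG := by
    obtain ⟨F', hF', H', hH'⟩ := h'.surj G hG
    obtain ⟨F, hF, H, hH⟩ := h.surj F' hF'
    obtain ⟨H'', hH''⟩ := h'.boundary (fun y => F (e y) - F' y) ⟨H, hH⟩
    refine ⟨F, hF, H' + H'', fun z => ?_⟩
    have := add_mem (hH' z) (hH'' z)
    rw [map_add]
    convert this using 1
    simp only [Function.comp_apply, Pi.add_apply]
    ring

/-- Dividing the cone of a regular element `r` by this element. -/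
theorem modQuasiIso_cone {X Y : Type*} {d : (X → P) →ₗ[P] (X → P)} {d' : (Y → P) →ₗ[P] (Y → P)}
    {i₀ i₁ : Y → X} {ε r : P} {σ : Y → P} {I : Ideal P}
    (hcov : ∀ x, ∃ y, x = i₀ y ∨ x = i₁ y)
    (glue : ∀ F₀ F₁ : Y → P, ∃ F : X → P, (∀ y, F (i₀ y) = F₀ y) ∧ ∀ y, F (i₁ y) = F₁ y)
    (h₀ : ∀ F y, d F (i₀ y) = d' (F ∘ i₀) y)
    (h₁ : ∀ F y, d F (i₁ y) = ε * d' (F ∘ i₁) y + σ y * (r * F (i₀ y)))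
    (hdd : ∀ F, d' (d' F) = 0) (hI : ∀ F : Y → P, (∀ y, F y ∈ I) → ∀ y, d' F y ∈ I)
    (hε : ε * ε = 1) (hσσ : ∀ y, σ y * σ y = 1)
    (hσ : ∀ F y, d' (σ * F) y = -ε * (σ y * d' F y)) (hr : ∀ x, r * x ∈ I → x ∈ I) :
    ModQuasiIso d I d' (I ⊔ Ideal.span {r}) i₁ := by
  have hle : I ≤ I ⊔ Ideal.span {r} := le_sup_left
  have hmem : ∀ x, r * x ∈ I ⊔ Ideal.span {r} := fun x =>
    (le_sup_right : Ideal.span {r} ≤ _) (Ideal.mul_mem_right _ _ (Ideal.mem_span_singleton_self r))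
  -- Membership in `I + (r)` is split pointwise into a part in `I` and a multiple of `r`. The
  -- quotient `h` by `r` supplies the missing `i₀`-components below.
  have hsplit : ∀ F : Y → P, (∀ y, F y ∈ I ⊔ Ideal.span {r}) →
      ∃ a h : Y → P, (∀ y, a y ∈ I) ∧ F = a + r • h := by
    intro F hF
    have : ∀ y, ∃ a b, a ∈ I ∧ F y = a + r * b := by
      intro y
      obtain ⟨a, ha, b, hb, hab⟩ := Submodule.mem_sup.1 (hF y)
      obtain ⟨c, rfl⟩ := Ideal.mem_span_singleton'.1 hb
      exact ⟨a, c, ha, by rw [← hab, mul_comm r]⟩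
    choose a b ha hb using this
    exact ⟨a, b, ha, funext hb⟩
  refine ⟨?_, ?_, ?_, ?_⟩
  · intro F hF y
    have h := hle (hF (i₁ y))
    rw [h₁] at h
    have h' := sub_mem h (Ideal.mul_mem_left _ (σ y) (hmem (F (i₀ y))))
    rw [add_sub_cancel_right] at h'
    have h'' := Ideal.mul_mem_left _ ε h'
    rwa [← mul_assoc, hε, one_mul] at h''
  · rintro F ⟨G, hG⟩
    refine ⟨ε • (G ∘ i₁), fun y => ?_⟩
    have h := hle (hG (i₁ y))
    rw [h₁] at h
    have h' := add_mem h (Ideal.mul_mem_left _ (σ y) (hmem (G (i₀ y))))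
    rw [map_smul, Pi.smul_apply, smul_eq_mul]
    convert h' using 1
    ring
  · rintro F hF ⟨G, hG⟩
    obtain ⟨a, h, ha, hah⟩ := hsplit _ hG
    -- The signs square to `1`, so on `i₁` the differential of `H` is `d' G + r h`, which is `F`
    -- modulo `I`. On `i₀` the required relation is first obtained after multiplication by `r`, from
    -- the cycle condition on `F`; then `r` is cancelled by `hr`.
    obtain ⟨H, hH₀, hH₁⟩ := glue (σ * h) (ε • G)
    have e₁ : F ∘ i₁ = d' G + a + r • h := by
      funext y
      have := congrFun hah y
      simp only [Pi.add_apply, Pi.smul_apply, smul_eq_mul, Function.comp_apply] at this ⊢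
      linear_combination this
    have eH₀ : H ∘ i₀ = σ * h := funext hH₀
    have eH₁ : H ∘ i₁ = ε • G := funext hH₁
    refine ⟨H, fun x => ?_⟩
    obtain ⟨y, rfl | rfl⟩ := hcov x
    · rw [h₀, eH₀, hσ]
      refine hr _ ?_
      have hy := hF (i₁ y)
      rw [h₁, e₁, map_add, map_add, hdd, zero_add, map_smul] at hy
      have h' := Ideal.mul_mem_left _ (σ y) (sub_mem hy (Ideal.mul_mem_left _ ε (hI a ha y)))
      convert h' using 1
      simp only [Pi.add_apply, Pi.smul_apply, smul_eq_mul]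
      linear_combination (-r * F (i₀ y)) * hσσ y
    · rw [h₁, eH₁, hH₀, map_smul, ← Function.comp_apply (f := F), e₁]
      convert ha y using 1
      simp only [Pi.add_apply, Pi.smul_apply, smul_eq_mul, Pi.mul_apply]
      linear_combination (-d' G y) * hε - r * h y * hσσ y
  · intro G hG
    obtain ⟨a, h, ha, hah⟩ := hsplit _ hG
    -- The `i₀`-component is chosen to cancel the multiple `r h` of `r` in `d' G`. That it is itself
    -- a cycle modulo `I` follows from `d' (d' G) = 0`, which puts `r * d' h` in `I`. The
    -- restriction of `F` is `G` on the nose, so the correcting boundary is `0`.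
    obtain ⟨F, hF₀, hF₁⟩ := glue (-ε • (σ * h)) G
    have eF₀ : F ∘ i₀ = -ε • (σ * h) := funext hF₀
    have eF₁ : F ∘ i₁ = G := funext hF₁
    refine ⟨F, fun x => ?_, 0, fun y => ?_⟩
    · obtain ⟨y, rfl | rfl⟩ := hcov x
      · rw [h₀, eF₀, map_smul, Pi.smul_apply, hσ]
        have hy : d' (d' G) y = 0 := by rw [hdd]; rfl
        rw [hah, map_add, map_smul] at hy
        simp only [Pi.add_apply, Pi.smul_apply, smul_eq_mul] at hy ⊢
        have h' : d' h y ∈ I := by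
          refine hr _ ?_
          rw [eq_neg_of_add_eq_zero_right hy]
          exact neg_mem (hI a ha y)
        convert Ideal.mul_mem_left _ (σ y) h' using 1
        linear_combination (σ y * d' h y) * hε
      · rw [h₁, eF₁, hah, hF₀]
        convert Ideal.mul_mem_left _ ε (ha y) using 1
        simp only [Pi.add_apply, Pi.smul_apply, smul_eq_mul, Pi.mul_apply]
        linear_combination (-ε * r * h y) * hσσ y
    · rw [hF₁]; simp

/-- The Koszul differential of the first `n` elements of a sequence. -/
noncomputable def koszulRing (f : ℕ → P) (n : ℕ) :
    (Finset (Fin n) → P) →ₗ[P] (Finset (Fin n) → P) where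
  toFun := koszul fun j => AddMonoidHom.mulLeft (f j)
  map_add' F G := by
    funext S
    simp [koszul, mul_add, Finset.sum_add_distrib]
  map_smul' c F := by
    funext S
    simp only [koszul, Pi.smul_apply, smul_eq_mul, AddMonoidHom.coe_mulLeft, RingHom.id_apply,
      Finset.mul_sum]
    refine Finset.sum_congr rfl fun j _ => ?_
    rw [mul_left_comm, mul_smul_comm]

theorem koszulRing_apply (f : ℕ → P) (n : ℕ) (F : Finset (Fin n) → P) (S : Finset (Fin n)) :
    koszulRing f n F S = ∑ j ∈ S, (-1 : ℤ) ^ (S.filter (· < j)).card • (f j * F (S.erase j)) := rfl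

theorem koszulRing_koszulRing (f : ℕ → P) (n : ℕ) (F : Finset (Fin n) → P) :
    koszulRing f n (koszulRing f n F) = 0 :=
  koszul_koszul _ (fun i j m => by simp [mul_left_comm]) F

theorem koszulRing_mem (f : ℕ → P) (n : ℕ) {I : Ideal P} (F : Finset (Fin n) → P)
    (hF : ∀ S, F S ∈ I) (S : Finset (Fin n)) : koszulRing f n F S ∈ I :=
  sum_mem fun _ _ => zsmul_mem (Ideal.mul_mem_left _ _ (hF _)) _

/-- Adding the last index to a set of indices. -/
def addLast {n : ℕ} (S : Finset (Fin n)) : Finset (Fin (n + 1)) :=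
  insert (Fin.last n) (S.map Fin.castSuccEmb)

/-- Adding the index `0` to a set of indices, after a shift. -/
def addFirst {n : ℕ} (S : Finset (Fin n)) : Finset (Fin (n + 1)) :=
  insert 0 (S.map (Fin.succEmb n))

theorem last_notMem {n : ℕ} (S : Finset (Fin n)) : Fin.last n ∉ S.map Fin.castSuccEmb := by
  simp [Fin.castSucc_ne_last]

theorem zero_notMem {n : ℕ} (S : Finset (Fin n)) : (0 : Fin (n + 1)) ∉ S.map (Fin.succEmb n) := by
  simp [Fin.succ_ne_zero]

theorem exists_last {n : ℕ} (S : Finset (Fin (n + 1))) :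
    ∃ T, S = T.map Fin.castSuccEmb ∨ S = addLast T := by
  classical
  refine ⟨Finset.univ.filter fun j => j.castSucc ∈ S, ?_⟩
  by_cases h : Fin.last n ∈ S
  · right
    ext x
    refine Fin.lastCases ?_ (fun j => ?_) x
    · simp [addLast, h]
    · simp [addLast, Fin.castSucc_ne_last]
  · left
    ext x
    refine Fin.lastCases ?_ (fun j => ?_) x
    · simp [h, Fin.castSucc_ne_last]
    · simp

theorem exists_first {n : ℕ} (S : Finset (Fin (n + 1))) :
    ∃ T, S = T.map (Fin.succEmb n) ∨ S = addFirst T := by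
  classical
  refine ⟨Finset.univ.filter fun j => j.succ ∈ S, ?_⟩
  by_cases h : (0 : Fin (n + 1)) ∈ S
  · right
    ext x
    refine Fin.cases ?_ (fun j => ?_) x
    · simp [addFirst, h]
    · simp [addFirst, Fin.succ_ne_zero]
  · left
    ext x
    refine Fin.cases ?_ (fun j => ?_) x
    · simp [h, Fin.succ_ne_zero]
    · simp

theorem exists_glue {X Y : Type*} {i₀ i₁ : Y → X} (h₀ : Function.Injective i₀)
    (h₁ : Function.Injective i₁) (h : ∀ y z, i₀ y ≠ i₁ z) (F₀ F₁ : Y → P) :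
    ∃ F : X → P, (∀ y, F (i₀ y) = F₀ y) ∧ ∀ y, F (i₁ y) = F₁ y := by
  refine ⟨Function.extend i₀ F₀ (Function.extend i₁ F₁ 0), h₀.extend_apply _ _, fun y => ?_⟩
  rw [Function.extend_apply', h₁.extend_apply]
  rintro ⟨z, hz⟩
  exact h z y hz

theorem card_mul_self (n : ℕ) : ((-1 : P) ^ n) * (-1) ^ n = 1 := by
  rw [← mul_pow]; simp

/-- Removing one element changes the parity of the cardinality, so the parity sign anticommutes with
the differential. This is the compatibility of `σ` and `d'` needed for the cone over the last index.
-/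
theorem koszulRing_sign (f : ℕ → P) (n : ℕ) (F : Finset (Fin n) → P) (S : Finset (Fin n)) :
    koszulRing f n ((fun T => (-1 : P) ^ T.card) * F) S =
      -((-1) ^ S.card * koszulRing f n F S) := by
  rw [koszulRing_apply, koszulRing_apply, Finset.mul_sum, ← Finset.sum_neg_distrib]
  refine Finset.sum_congr rfl fun j hj => ?_
  rw [← Finset.card_erase_add_one hj]
  simp only [Pi.mul_apply, zsmul_eq_mul]
  ring

/-- The last index exceeds all elements of `S`: it leaves their signs unchanged, and its own sign
counts all of `S`. -/
theorem koszulRing_addLast (f : ℕ → P) (n : ℕ) (F : Finset (Fin (n + 1)) → P)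
    (S : Finset (Fin n)) : koszulRing f (n + 1) F (addLast S) =
      koszulRing f n (F ∘ addLast) S + (-1) ^ S.card * (f n * F (S.map Fin.castSuccEmb)) := by
  rw [koszulRing_apply, addLast, Finset.sum_insert (last_notMem _), Finset.sum_map, add_comm]
  congr 1
  · rw [koszulRing_apply]
    refine Finset.sum_congr rfl fun j _ => ?_
    rw [Finset.filter_insert, if_neg, Finset.filter_map, Finset.card_map,
      Finset.erase_insert_of_ne, ← Finset.map_erase]
    · rfl
    · exact (Fin.castSucc_ne_last j).symm
    · exact (Fin.le_last _).not_gt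
  · rw [Finset.erase_insert (last_notMem _), Finset.filter_insert, if_neg (lt_irrefl _),
      Finset.filter_true_of_mem, Finset.card_map]
    · simp
    · intro x hx
      obtain ⟨y, _, rfl⟩ := Finset.mem_map.1 hx
      exact Fin.castSucc_lt_last y

/-- The Koszul complex is the cone of multiplication by its last element; the two halves are the
subsets without and with the last index. -/
theorem modQuasiIso_addLast (f : ℕ → P) (n : ℕ) {I : Ideal P} (hr : ∀ x, f n * x ∈ I → x ∈ I) :
    ModQuasiIso (koszulRing f (n + 1)) I (koszulRing f n) (I ⊔ Ideal.span {f n}) addLast := by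
  have hins : Function.Injective (addLast : Finset (Fin n) → _) := fun S T h => by
    have := congrArg (fun U => U.erase (Fin.last n)) h
    simpa only [addLast, Finset.erase_insert (last_notMem _), Finset.map_inj] using this
  refine modQuasiIso_cone (i₀ := fun T => T.map Fin.castSuccEmb) (ε := 1)
    (σ := fun T => (-1) ^ T.card) exists_last
    (exists_glue (i₀ := fun T => T.map Fin.castSuccEmb) (Finset.map_injective _) hins
      fun S T h => ?_) ?_ ?_ (koszulRing_koszulRing f n) (koszulRing_mem f n) (one_mul 1) (fun S => card_mul_self _) ?_ hr
  · exact last_notMem S (h ▸ Finset.mem_insert_self _ _)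
  · intro F S
    simp only [koszulRing_apply, Finset.sum_map]
    refine Finset.sum_congr rfl fun j _ => ?_
    rw [Finset.filter_map, Finset.card_map, ← Finset.map_erase]
    rfl
  · intro F S
    rw [koszulRing_addLast, one_mul]
  · intro F S
    rw [koszulRing_sign]
    ring

/-- The same cone for the index `0`. It precedes every other index, so it flips all their signs (`ε
= -1`), while its own sign is `1`. -/
theorem modQuasiIso_addFirst (f : ℕ → P) (n : ℕ) {I : Ideal P} (hr : ∀ x, f 0 * x ∈ I → x ∈ I) :
    ModQuasiIso (koszulRing f (n + 1)) I (koszulRing (fun i => f (i + 1)) n)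
      (I ⊔ Ideal.span {f 0}) addFirst := by
  have hins : Function.Injective (addFirst : Finset (Fin n) → _) := fun S T h => by
    have := congrArg (fun U => U.erase 0) h
    simpa only [addFirst, Finset.erase_insert (zero_notMem _), Finset.map_inj] using this
  refine modQuasiIso_cone (i₀ := fun T => T.map (Fin.succEmb n)) (ε := -1)
    (σ := fun T => 1) exists_first
    (exists_glue (i₀ := fun T => T.map (Fin.succEmb n)) (Finset.map_injective _) hins
      fun S T h => ?_) ?_ ?_ (koszulRing_koszulRing _ n) (koszulRing_mem _ n) (by ring) (fun S => one_mul _) ?_ hr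
  · exact zero_notMem S (h ▸ Finset.mem_insert_self _ _)
  · intro F S
    simp only [koszulRing_apply, Finset.sum_map]
    refine Finset.sum_congr rfl fun j _ => ?_
    rw [Finset.filter_map, Finset.card_map, ← Finset.map_erase]
    simp [Function.comp_def]
  · intro F S
    rw [koszulRing_apply, addFirst, Finset.sum_insert (zero_notMem _), Finset.sum_map, add_comm]
    congr 1
    · rw [koszulRing_apply, Finset.mul_sum]
      refine Finset.sum_congr rfl fun j _ => ?_
      rw [Finset.filter_insert, if_pos, Finset.card_insert_of_notMem, Finset.filter_map,
        Finset.card_map, Finset.erase_insert_of_ne, ← Finset.map_erase, pow_succ]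
      · simp [Function.comp_def, addFirst]
      · exact (Fin.succ_ne_zero j).symm
      · exact fun h => zero_notMem S (Finset.mem_filter.1 h).1
      · exact Fin.succ_pos j
    · rw [Finset.erase_insert (zero_notMem _), Finset.filter_false_of_mem]
      · simp
      · intro x _
        exact Fin.not_lt_zero x
  · intro F S
    have : (fun _ => 1 : Finset (Fin n) → P) * F = F := one_mul F
    rw [this]
    ring

/-- Adding the last `p` indices. -/
def addLasts {n : ℕ} : ∀ p : ℕ, Finset (Fin n) → Finset (Fin (n + p))
  | 0 => id
  | p + 1 => addLast ∘ addLasts p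

/-- Adding the first `p` indices. -/
def addFirsts {n : ℕ} : ∀ p : ℕ, Finset (Fin n) → Finset (Fin (n + p))
  | 0 => id
  | p + 1 => addFirst ∘ addFirsts p

theorem sup_span_insert (f : ℕ → P) (I : Ideal P) (a : ℕ) {s t : Set ℕ} (h : insert a s = t) :
    I ⊔ Ideal.span {f a} ⊔ Ideal.span (f '' s) = I ⊔ Ideal.span (f '' t) := by
  rw [← h, Set.image_insert_eq, Ideal.span_insert, sup_assoc]

/-- The elements are divided out from the last one downwards, enlarging `I` each time. Hence each is
required to be regular modulo those after it. -/
theorem modQuasiIso_addLasts (f : ℕ → P) (n p : ℕ) {I : Ideal P}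
    (hr : ∀ j < p, ∀ x, f (n + j) * x ∈ I ⊔ Ideal.span (f '' {i | n + j < i ∧ i < n + p}) →
      x ∈ I ⊔ Ideal.span (f '' {i | n + j < i ∧ i < n + p})) :
    ModQuasiIso (koszulRing f (n + p)) I (koszulRing f n)
      (I ⊔ Ideal.span (f '' {i | n ≤ i ∧ i < n + p})) (addLasts p) := by
  induction p generalizing I with
  | zero =>
    have : {i | n ≤ i ∧ i < n + 0} = ∅ := by ext i; simp
    rw [this, Set.image_empty, Ideal.span_empty, sup_bot_eq]
    exact ModQuasiIso.refl _ _
  | succ p ih =>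
    have h₁ : {i | n + p < i ∧ i < n + (p + 1)} = ∅ := by ext i; simp; omega
    have h₂ := modQuasiIso_addLast f (n + p) (I := I) (by
      have := hr p p.lt_succ_self
      rw [h₁] at this
      simpa using this)
    have h₃ := ih (I := I ⊔ Ideal.span {f (n + p)}) (fun j hj => by
      have := hr j (hj.trans p.lt_succ_self)
      rwa [sup_span_insert f I (n + p) (t := {i | n + j < i ∧ i < n + (p + 1)})]
      ext i
      simp only [Set.mem_insert_iff, Set.mem_ofPred_eq]
      omega)
    rw [sup_span_insert f I (n + p) (t := {i | n ≤ i ∧ i < n + (p + 1)})] at h₃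
    · exact h₂.trans h₃
    · ext i
      simp only [Set.mem_insert_iff, Set.mem_ofPred_eq]
      omega

/-- The elements are divided out from index `0` upwards, so each is required to be regular modulo
those before it. Every step renumbers the sequence, whence the shift by `p`. -/
theorem modQuasiIso_addFirsts (f : ℕ → P) (n p : ℕ) {I : Ideal P}
    (hr : ∀ j < p, ∀ x, f j * x ∈ I ⊔ Ideal.span (f '' {i | i < j}) →
      x ∈ I ⊔ Ideal.span (f '' {i | i < j})) :
    ModQuasiIso (koszulRing f (n + p)) I (koszulRing (fun i => f (i + p)) n)
      (I ⊔ Ideal.span (f '' {i | i < p})) (addFirsts p) := by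
  induction p generalizing I f with
  | zero =>
    have : {i | i < 0} = (∅ : Set ℕ) := by ext i; simp
    rw [this, Set.image_empty, Ideal.span_empty, sup_bot_eq]
    exact ModQuasiIso.refl _ _
  | succ p ih =>
    have key : ∀ j, I ⊔ Ideal.span {f 0} ⊔ Ideal.span ((fun i => f (i + 1)) '' {i | i < j}) =
        I ⊔ Ideal.span (f '' {i | i < j + 1}) := fun j => by
      rw [← sup_span_insert f I 0 (s := (· + 1) '' {i | i < j}), Set.image_image]
      ext i
      simp only [Set.mem_insert_iff, Set.mem_ofPred_eq, Set.mem_image]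
      refine ⟨by rintro (rfl | ⟨a, h, rfl⟩) <;> omega, fun h => ?_⟩
      rcases i with _ | i
      · exact Or.inl rfl
      · exact Or.inr ⟨i, by omega, rfl⟩
    have h₂ := modQuasiIso_addFirst f (n + p) (I := I) (by simpa using hr 0 p.succ_pos)
    have h₃ := ih (I := I ⊔ Ideal.span {f 0}) (fun i => f (i + 1)) (fun j hj => by
      rw [key]
      exact hr (j + 1) (Nat.succ_lt_succ hj))
    rw [key] at h₃
    exact h₂.trans h₃

/-- The terms that remove one of the added indices carry a factor `f i` with `n ≤ i`. Hence
restriction to these components is a chain map modulo the ideal. -/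
theorem koszulRing_addLasts (f : ℕ → P) (n p : ℕ) (F : Finset (Fin (n + p)) → P)
    (S : Finset (Fin n)) : koszulRing f (n + p) F (addLasts p S) -
      koszulRing f n (F ∘ addLasts p) S ∈ Ideal.span (f '' {i | n ≤ i ∧ i < n + p}) := by
  induction p with
  | zero => simp [addLasts]
  | succ p ih =>
    have hle : Ideal.span (f '' {i | n ≤ i ∧ i < n + p}) ≤
        Ideal.span (f '' {i | n ≤ i ∧ i < n + (p + 1)}) :=
      Ideal.span_mono (Set.image_mono fun i hi => ⟨hi.1, hi.2.trans (by omega)⟩)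
    have h : f (n + p) ∈ Ideal.span (f '' {i | n ≤ i ∧ i < n + (p + 1)}) :=
      Ideal.subset_span ⟨n + p, ⟨by omega, by omega⟩, rfl⟩
    have h' := koszulRing_addLast f (n + p) F (addLasts p S)
    have h'' : koszulRing f (n + (p + 1)) F (addLasts (p + 1) S) = _ := h'
    rw [h'', add_sub_right_comm]
    exact add_mem (hle (ih (F ∘ addLast)))
      (Ideal.mul_mem_left _ _ (Ideal.mul_mem_right _ _ h))

theorem card_addLasts {n : ℕ} (p : ℕ) (S : Finset (Fin n)) :
    (addLasts p S).card = S.card + p := by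
  induction p with
  | zero => rfl
  | succ p ih =>
    refine Eq.trans ?_ (congrArg (· + 1) ih)
    exact (Finset.card_insert_of_notMem (last_notMem _)).trans (by rw [Finset.card_map])

theorem card_addFirsts {n : ℕ} (p : ℕ) (S : Finset (Fin n)) :
    (addFirsts p S).card = S.card + p := by
  induction p with
  | zero => rfl
  | succ p ih =>
    refine Eq.trans ?_ (congrArg (· + 1) ih)
    exact (Finset.card_insert_of_notMem (zero_notMem _)).trans (by rw [Finset.card_map])

theorem sum_addLasts {n : ℕ} {M : Type*} [AddCommMonoid M] (p : ℕ) (w : ℕ → M)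
    (S : Finset (Fin n)) :
    ∑ j ∈ addLasts p S, w j = ∑ j ∈ S, w j + ∑ j ∈ Finset.range p, w (n + j) := by
  induction p with
  | zero => simp [addLasts]
  | succ p ih =>
    rw [Finset.sum_range_succ]
    refine Eq.trans ?_ ((congrArg (· + w (n + p)) ih).trans (add_assoc _ _ _))
    exact (Finset.sum_insert (last_notMem _)).trans (by rw [Finset.sum_map, add_comm]; rfl)

theorem sum_addFirsts {n : ℕ} {M : Type*} [AddCommMonoid M] (p : ℕ) (w : ℕ → M)
    (S : Finset (Fin n)) :
    ∑ j ∈ addFirsts p S, w j = ∑ j ∈ S, w (j + p) + ∑ j ∈ Finset.range p, w j := by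
  induction p generalizing w with
  | zero => simp [addFirsts]
  | succ p ih =>
    rw [Finset.sum_range_succ']
    refine Eq.trans ?_ ((congrArg (· + w 0) (ih fun i => w (i + 1))).trans (add_assoc _ _ _))
    exact (Finset.sum_insert (zero_notMem _)).trans (by rw [Finset.sum_map, add_comm]; rfl)

end KoszulRing

/-! ### Families that are regular in any order -/

section Regular

/-- Each member of the family is a nonzerodivisor modulo any set of other members. -/
def RegularFamily {ι P : Type*} [CommRing P] (f : ι → P) : Prop :=
  ∀ (s : Set ι) (i : ι), i ∉ s → ∀ x, f i * x ∈ Ideal.span (f '' s) → x ∈ Ideal.span (f '' s)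

/-- A polynomial lies in the ideal of the variables from `s` exactly when each of its monomials
involves such a variable. Multiplication by `X i` with `i ∉ s` does not affect this. -/
theorem regularFamily_X {σ R : Type*} [CommRing R] :
    RegularFamily (MvPolynomial.X : σ → MvPolynomial σ R) := by
  intro s i hi x hx
  rw [MvPolynomial.mem_ideal_span_X_image] at hx ⊢
  intro m hm
  have h : Finsupp.single i 1 + m ∈ (MvPolynomial.X i * x).support := by
    rw [MvPolynomial.mem_support_iff, MvPolynomial.coeff_X_mul]
    exact MvPolynomial.mem_support_iff.1 hm
  obtain ⟨j, hj, hj'⟩ := hx _ h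
  refine ⟨j, hj, ?_⟩
  have : i ≠ j := fun h => hi (h ▸ hj)
  simpa [this] using hj'

theorem RegularFamily.map_equiv {ι P Q : Type*} [CommRing P] [CommRing Q] {f : ι → P}
    (hf : RegularFamily f) (e : P ≃+* Q) : RegularFamily fun i => e (f i) := by
  have key : ∀ (s : Set ι) (y : P), e y ∈ Ideal.span ((fun i => e (f i)) '' s) ↔
      y ∈ Ideal.span (f '' s) := fun s y => by
    rw [← Set.image_image e f s, ← Ideal.map_span e, Ideal.mem_map_of_equiv]
    exact ⟨fun ⟨x, hx, h⟩ => e.injective h ▸ hx, fun h => ⟨y, h, rfl⟩⟩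
  intro s i hi x hx
  obtain ⟨y, rfl⟩ := e.surjective x
  dsimp only at hx
  rw [← map_mul, key] at hx
  exact (key s y).2 (hf s i hi y hx)

theorem RegularFamily.comp_injective {ι κ P : Type*} [CommRing P] {f : ι → P}
    (hf : RegularFamily f) {g : κ → ι} (hg : Function.Injective g) : RegularFamily (f ∘ g) := by
  intro s i hi x hx
  rw [Set.image_comp] at hx ⊢
  refine hf _ _ ?_ x hx
  rintro ⟨j, hj, h⟩
  exact hi (hg h ▸ hj)

/-- Multiplication by `r` is injective on `R ⧸ I`. Tensoring with the flat module `W` keeps it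
injective, and `W ⊗ R ⧸ I` is `W ⧸ I W`. -/
theorem mem_map_of_flat {R W : Type*} [CommRing R] [CommRing W] [Algebra R W] [Module.Flat R W]
    {I : Ideal R} {r : R} (hr : ∀ x, r * x ∈ I → x ∈ I) (w : W)
    (hw : algebraMap R W r * w ∈ I.map (algebraMap R W)) : w ∈ I.map (algebraMap R W) := by
  have h₁ : IsSMulRegular (R ⧸ I) r := by
    intro x y hxy
    obtain ⟨x, rfl⟩ := Ideal.Quotient.mk_surjective x
    obtain ⟨y, rfl⟩ := Ideal.Quotient.mk_surjective y
    have h : Ideal.Quotient.mk I (r * x) = Ideal.Quotient.mk I (r * y) := hxy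
    rw [Ideal.Quotient.eq] at h ⊢
    exact hr _ (by rwa [mul_sub])
  have h₂ : IsSMulRegular (W ⊗[R] (R ⧸ I)) r := by
    have := Module.Flat.lTensor_preserves_injective_linearMap (M := W)
      (LinearMap.lsmul R (R ⧸ I) r) h₁
    refine fun x y hxy => this ?_
    have e : (LinearMap.lsmul R (R ⧸ I) r).lTensor W = LinearMap.lsmul R (W ⊗[R] (R ⧸ I)) r := by
      ext x
      simp
    rw [e]
    exact hxy
  have h₃ : IsSMulRegular (W ⧸ (I • ⊤ : Submodule R W)) r := by
    intro x y hxy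
    refine (TensorProduct.tensorQuotEquivQuotSMul W I).symm.injective (h₂ ?_)
    have h := congrArg (TensorProduct.tensorQuotEquivQuotSMul W I).symm hxy
    simpa only [map_smul] using h
  have key : ∀ v : W, v ∈ I.map (algebraMap R W) ↔ v ∈ (I • ⊤ : Submodule R W) := fun v => by
    rw [Ideal.smul_top_eq_map]; rfl
  rw [key] at hw ⊢
  rw [← Submodule.Quotient.mk_eq_zero]
  refine h₃ ?_
  dsimp only
  rw [smul_zero, ← Submodule.Quotient.mk_smul, Submodule.Quotient.mk_eq_zero, Algebra.smul_def r w]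
  exact hw

theorem RegularFamily.map_flat {ι R W : Type*} [CommRing R] [CommRing W] {f : ι → R}
    (hf : RegularFamily f) {φ : R →+* W} (hφ : φ.Flat) : RegularFamily fun i => φ (f i) := by
  let _ := φ.toAlgebra
  have : Module.Flat R W := hφ
  intro s i hi x hx
  rw [← Set.image_image φ f s, ← Ideal.map_span φ] at hx ⊢
  exact mem_map_of_flat (hf s i hi) x hx

/-- Translation by elements of the ground ring, combined with a change of sign. -/
noncomputable def reflectVars {σ R : Type*} [CommRing R] (c : σ → R) :
    MvPolynomial σ R ≃ₐ[R] MvPolynomial σ R :=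
  AlgEquiv.ofAlgHom (MvPolynomial.aeval fun i => MvPolynomial.C (c i) - MvPolynomial.X i)
    (MvPolynomial.aeval fun i => MvPolynomial.C (c i) - MvPolynomial.X i)
    (by ext i; simp [MvPolynomial.algebraMap_eq]) (by ext i; simp [MvPolynomial.algebraMap_eq])

/-- The element `a ⊗ 1 - 1 ⊗ a`. -/
noncomputable def tensorDiff (K : Type*) {A : Type*} [CommRing K] [CommRing A] [Algebra K A]
    (a : A) : A ⊗[K] A :=
  a ⊗ₜ 1 - 1 ⊗ₜ a

/-- View the tensor square as polynomials over its left factor. The difference is then a constant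
minus a variable, which the automorphism `reflectVars` turns into the variable itself. -/
theorem regularFamily_tensorDiff_X (σ K : Type*) [CommRing K] :
    RegularFamily fun i : σ => tensorDiff K (MvPolynomial.X i : MvPolynomial σ K) := by
  let e := (MvPolynomial.algebraTensorAlgEquiv (σ := σ) K (MvPolynomial σ K)).trans
    (reflectVars (MvPolynomial.X : σ → MvPolynomial σ K))
  have h := (regularFamily_X (σ := σ) (R := MvPolynomial σ K)).map_equiv e.symm.toRingEquiv
  convert h using 2 with i
  refine e.injective ?_
  have h₁ : e (e.symm.toRingEquiv (MvPolynomial.X i)) = MvPolynomial.X i := e.apply_symm_apply _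
  rw [h₁]
  simp [e, tensorDiff, reflectVars, MvPolynomial.smul_eq_C_mul, MvPolynomial.algebraMap_eq]

theorem regularFamily_tensorDiff {σ K A : Type*} [CommRing K] [CommRing A] [Algebra K A]
    (e : MvPolynomial σ K ≃ₐ[K] A) : RegularFamily fun i => tensorDiff K (e (MvPolynomial.X i)) := by
  have h := (regularFamily_tensorDiff_X σ K).map_equiv (Algebra.TensorProduct.congr e e).toRingEquiv
  convert h using 2 with i
  change _ = (Algebra.TensorProduct.congr e e) _
  simp [tensorDiff]

/-- If `φ` is flat then so is `φ ⊗ φ`, and this map carries differences to differences. -/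
theorem RegularFamily.tensorDiff_flat {ι K S A : Type*} [CommRing K] [CommRing S] [CommRing A]
    [Algebra K S] [Algebra K A] {g : ι → S} (hg : RegularFamily fun i => tensorDiff K (g i))
    {φ : S →ₐ[K] A} (hφ : φ.toRingHom.Flat) : RegularFamily fun i => tensorDiff K (φ (g i)) := by
  have h := hg.map_flat (φ := (Algebra.TensorProduct.map φ φ).toRingHom)
    (RingHom.Flat.tensorProductMap (f := φ) (g := φ) hφ hφ)
  convert h using 2 with i
  change _ = Algebra.TensorProduct.map φ φ _
  simp [tensorDiff]

/-- The elements whose left and right actions agree modulo an ideal. -/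
def equalizer {K A : Type*} [CommRing K] [CommRing A] [Algebra K A] (I : Ideal (A ⊗[K] A)) :
    Subalgebra K A where
  carrier := {a | tensorDiff K a ∈ I}
  mul_mem' {a b} ha hb := by
    have ha' : tensorDiff K a ∈ I := ha
    have hb' : tensorDiff K b ∈ I := hb
    change tensorDiff K (a * b) ∈ I
    -- Leibniz rule: the difference of `a * b` is the difference of `a` times `b ⊗ 1`, plus `1 ⊗ a`
    -- times the difference of `b`.
    have h := add_mem (I.mul_mem_right (b ⊗ₜ 1) ha') (I.mul_mem_left (1 ⊗ₜ a) hb')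
    simpa [tensorDiff, sub_mul, mul_sub] using h
  add_mem' {a b} ha hb := by
    have ha' : tensorDiff K a ∈ I := ha
    have hb' : tensorDiff K b ∈ I := hb
    change tensorDiff K (a + b) ∈ I
    convert add_mem ha' hb' using 1
    simp only [tensorDiff, TensorProduct.add_tmul, TensorProduct.tmul_add]
    abel
  algebraMap_mem' c := by
    simp [tensorDiff, Algebra.algebraMap_eq_smul_one, TensorProduct.smul_tmul]

theorem mem_equalizer {K A : Type*} [CommRing K] [CommRing A] [Algebra K A]
    {I : Ideal (A ⊗[K] A)} {a : A} : a ∈ equalizer I ↔ tensorDiff K a ∈ I := Iff.rfl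

/-- The canonical map `A ⊗_K A → A ⊗_S A`. -/
noncomputable def tensorProj (K S A : Type*) [CommRing K] [CommRing S] [CommRing A] [Algebra K S]
    [Algebra K A] [Algebra S A] [IsScalarTower K S A] : A ⊗[K] A →ₐ[K] A ⊗[S] A :=
  Algebra.TensorProduct.lift
    ((Algebra.TensorProduct.includeLeft : A →ₐ[S] A ⊗[S] A).restrictScalars K)
    ((Algebra.TensorProduct.includeRight : A →ₐ[S] A ⊗[S] A).restrictScalars K)
    fun _ _ => Commute.all _ _

section

variable {K S A : Type*} [CommRing K] [CommRing S] [CommRing A] [Algebra K S]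
  [Algebra K A] [Algebra S A] [IsScalarTower K S A]

theorem tensorProj_tmul (a b : A) : tensorProj K S A (a ⊗ₜ b) = a ⊗ₜ b := by
  simp [tensorProj]

theorem tensorProj_surjective : Function.Surjective (tensorProj K S A) := by
  intro t
  induction t using TensorProduct.induction_on with
  | zero => exact ⟨0, map_zero _⟩
  | tmul a b => exact ⟨a ⊗ₜ b, tensorProj_tmul a b⟩
  | add x y hx hy =>
    obtain ⟨x, rfl⟩ := hx
    obtain ⟨y, rfl⟩ := hy
    exact ⟨x + y, map_add _ _ _⟩

/-- The elements with equal left and right action modulo `I` form a subalgebra containing the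
generators, hence the whole image of `S`. So `A ⊗_K A ⧸ I` is balanced over `S` and receives a map
`Q` from `A ⊗_S A` that inverts the projection modulo `I`. -/
theorem ker_tensorProj {ι : Type*} (g : ι → S) (hg : Algebra.adjoin K (Set.range g) = ⊤) :
    RingHom.ker (tensorProj K S A) =
      Ideal.span (Set.range fun i => tensorDiff K (algebraMap S A (g i))) := by
  set I := Ideal.span (Set.range fun i => tensorDiff K (algebraMap S A (g i))) with hI
  have hS : ∀ s : S, algebraMap S A s ∈ equalizer I := by
    intro s
    have h : (⊤ : Subalgebra K S) ≤ (equalizer I).comap (IsScalarTower.toAlgHom K S A) := by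
      rw [← hg, Algebra.adjoin_le_iff]
      rintro _ ⟨i, rfl⟩
      exact Ideal.subset_span ⟨i, rfl⟩
    exact h (Algebra.mem_top (x := s))
  refine le_antisymm (fun x hx => ?_) (Ideal.span_le.2 ?_)
  · let q : A →+ A →+ (A ⊗[K] A) ⧸ I :=
      { toFun a := (Ideal.Quotient.mk I).toAddMonoidHom.comp
          (TensorProduct.mk K A A a).toAddMonoidHom
        map_zero' := by ext; simp
        map_add' a b := by ext; simp }
    let Q : A ⊗[S] A →+ (A ⊗[K] A) ⧸ I := TensorProduct.liftAddHom q (by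
      intro s a b
      change Ideal.Quotient.mk I _ = Ideal.Quotient.mk I _
      rw [Ideal.Quotient.eq]
      have h := I.mul_mem_right (a ⊗ₜ b) (hS s)
      simpa [tensorDiff, sub_mul, Algebra.smul_def] using h)
    have hQ : ∀ y, Q (tensorProj K S A y) = Ideal.Quotient.mk I y := by
      intro y
      induction y using TensorProduct.induction_on with
      | zero => simp
      | tmul a b => rw [tensorProj_tmul]; rfl
      | add x y hx hy => rw [map_add, map_add, hx, hy, map_add]
    rw [← Ideal.Quotient.eq_zero_iff_mem, ← hQ, RingHom.mem_ker.1 hx, map_zero]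
  · rintro _ ⟨i, rfl⟩
    change tensorProj K S A (tensorDiff K (algebraMap S A (g i))) = 0
    rw [tensorDiff, map_sub, tensorProj_tmul, tensorProj_tmul, sub_eq_zero,
      Algebra.algebraMap_eq_smul_one, TensorProduct.smul_tmul]

/-- The kernel is generated by the differences of all elements of `A`. By the subalgebra argument,
the differences of algebra generators suffice. -/
theorem ker_lmul' {ι : Type*} (g : ι → A) (hg : Algebra.adjoin K (Set.range g) = ⊤) :
    RingHom.ker (Algebra.TensorProduct.lmul' K (S := A)) =
      Ideal.span (Set.range fun i => tensorDiff K (g i)) := by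
  set I := Ideal.span (Set.range fun i => tensorDiff K (g i)) with hI
  have hS : ⊤ ≤ equalizer I := by
    rw [← hg, Algebra.adjoin_le_iff]
    rintro _ ⟨i, rfl⟩
    exact Ideal.subset_span ⟨i, rfl⟩
  refine le_antisymm ?_ (Ideal.span_le.2 ?_)
  · have h := KaehlerDifferential.span_range_eq_ideal K A
    change KaehlerDifferential.ideal K A ≤ I
    rw [← h, Ideal.span_le]
    rintro _ ⟨a, rfl⟩
    have h' : tensorDiff K a ∈ I := hS (Algebra.mem_top (x := a))
    simpa [tensorDiff] using neg_mem h'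
  · rintro _ ⟨i, rfl⟩
    change Algebra.TensorProduct.lmul' K (tensorDiff K (g i)) = 0
    simp [tensorDiff]

end

end Regular

/-! ### Flatness of polynomials over symmetric polynomials -/

section Flatness

open MvPolynomial

/-- The variables `X 0, …, X (n - 1)`, preceded by `1` and continued by zeros. -/
noncomputable def monicVar (n : ℕ) (R : Type*) [CommRing R] : ℕ → MvPolynomial (Fin n) R
  | 0 => 1
  | j + 1 => if h : j < n then X ⟨j, h⟩ else 0

/-- The coefficients of the product of a linear polynomial and a generic monic polynomial. -/
noncomputable def mulLinear (n : ℕ) (R : Type*) [CommRing R] :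
    MvPolynomial (Fin (n + 1)) R →ₐ[R] MvPolynomial (Fin n) (Polynomial R) :=
  aeval fun i => monicVar n (Polynomial R) (i + 1) + C Polynomial.X * monicVar n _ i

/-- The coefficients of the quotient of a generic monic polynomial by a linear polynomial, in terms
of the root. -/
noncomputable def divLinear (n : ℕ) (R : Type*) [CommRing R] :
    ℕ → Polynomial (MvPolynomial (Fin n) R)
  | 0 => 1
  | j + 1 => Polynomial.C (monicVar n R (j + 1)) - Polynomial.X * divLinear n R j

/-- Each division step multiplies the leading term by `-X`, so `(-1) ^ j` normalises it. -/
theorem monic_divLinear (n : ℕ) (R : Type*) [CommRing R] [Nontrivial R] (j : ℕ) :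
    ((-1) ^ j * divLinear n R j).Monic ∧ ((-1) ^ j * divLinear n R j).natDegree = j := by
  induction j with
  | zero => simp [divLinear]
  | succ j ih =>
    have h : (-1) ^ (j + 1) * divLinear n R (j + 1) =
        Polynomial.X * ((-1) ^ j * divLinear n R j) +
          Polynomial.C ((-1) ^ (j + 1) * monicVar n R (j + 1)) := by
      rw [divLinear]
      simp only [map_mul, map_pow, map_neg, map_one]
      ring
    have h₁ := Polynomial.monic_X.mul ih.1
    have h₂ : (Polynomial.X * ((-1) ^ j * divLinear n R j)).natDegree = j + 1 := by
      rw [Polynomial.monic_X.natDegree_mul ih.1, ih.2, Polynomial.natDegree_X, add_comm]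
    have h₃ : (Polynomial.C ((-1) ^ (j + 1) * monicVar n R (j + 1))).degree <
        (Polynomial.X * ((-1) ^ j * divLinear n R j)).degree := by
      rw [Polynomial.degree_eq_natDegree h₁.ne_zero, h₂]
      exact Polynomial.degree_C_le.trans_lt (by exact_mod_cast j.succ_pos)
    rw [h]
    exact ⟨h₁.add_of_left h₃, by rw [Polynomial.natDegree_add_C, h₂]⟩

/-- Synthetic division undoes multiplication by the linear factor. The range includes `j = n + 1`,
where the value is the remainder. -/
theorem eval₂_divLinear (n : ℕ) (R : Type*) [CommRing R] (j : ℕ) (hj : j ≤ n + 1) :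
    (divLinear (n + 1) R j).eval₂ (mulLinear n R).toRingHom (C Polynomial.X) =
      monicVar n (Polynomial R) j := by
  induction j with
  | zero => simp [divLinear, monicVar]
  | succ j ih =>
    have h : monicVar (n + 1) R (j + 1) = X ⟨j, hj⟩ := dif_pos hj
    rw [divLinear, Polynomial.eval₂_sub, Polynomial.eval₂_mul, Polynomial.eval₂_X,
      Polynomial.eval₂_C, ih (by omega), h]
    change mulLinear n R (X ⟨j, hj⟩) - _ = _
    rw [mulLinear, aeval_X, add_sub_cancel_right]

/-- Splitting a linear factor off a generic polynomial of degree `n + 1` amounts to adjoining a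
root. The target is thus `AdjoinRoot p`, where up to sign `p` is the remainder of the synthetic
division. As `p` is monic, the extension is free. -/
theorem flat_mulLinear (n : ℕ) (R : Type u) [CommRing R] : (mulLinear n R).toRingHom.Flat := by
  rcases subsingleton_or_nontrivial R with hR | hR
  · have h₁ := Module.subsingleton R (MvPolynomial (Fin (n + 1)) R)
    have h₂ := Module.subsingleton R (MvPolynomial (Fin n) (Polynomial R))
    exact RingHom.Flat.of_bijective ⟨fun _ _ _ => Subsingleton.elim _ _,
      fun x => ⟨0, Subsingleton.elim _ _⟩⟩
  set p := (-1) ^ (n + 1) * divLinear (n + 1) R (n + 1) with hp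
  have hmonic : p.Monic := (monic_divLinear _ _ _).1
  have hmk : AdjoinRoot.mk p (divLinear (n + 1) R (n + 1)) = 0 := by
    rw [AdjoinRoot.mk_eq_zero]
    refine ⟨(-1) ^ (n + 1), ?_⟩
    rw [hp, mul_right_comm, ← mul_pow]
    simp
  -- The zero continuation of `monicVar` says that the remainder vanishes; this makes `fwd` well
  -- defined.
  have hlast : monicVar n (Polynomial R) (n + 1) = 0 := dif_neg (lt_irrefl n)
  let fwd : AdjoinRoot p →+* MvPolynomial (Fin n) (Polynomial R) :=
    AdjoinRoot.lift (mulLinear n R).toRingHom (C Polynomial.X) (by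
      rw [hp, Polynomial.eval₂_mul, eval₂_divLinear n R (n + 1) le_rfl, hlast, mul_zero])
  let back : MvPolynomial (Fin n) (Polynomial R) →+* AdjoinRoot p :=
    eval₂Hom (Polynomial.eval₂RingHom (algebraMap R (AdjoinRoot p)) (AdjoinRoot.root p))
      fun i => AdjoinRoot.mk p (divLinear (n + 1) R (i + 1))
  have hbackX : back (C Polynomial.X) = AdjoinRoot.root p := by simp [back]
  have hback : ∀ j ≤ n + 1, back (monicVar n (Polynomial R) j) =
      AdjoinRoot.mk p (divLinear (n + 1) R j) := by
    intro j hj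
    rcases j with _ | j
    · simp [monicVar, divLinear]
    · rcases (Nat.lt_succ_iff.1 hj).lt_or_eq with h | rfl
      · have h' : monicVar n (Polynomial R) (j + 1) = X ⟨j, h⟩ := dif_pos h
        rw [h']
        simp [back]
      · rw [hlast, hmk, map_zero]
  have h₁ : back.comp fwd = RingHom.id _ := by
    have h : (back.comp fwd).comp (AdjoinRoot.mk p) = AdjoinRoot.mk p := by
      refine Polynomial.ringHom_ext' (MvPolynomial.ringHom_ext ?_ ?_) ?_
      · intro r
        simp [fwd, back]
        rfl
      · intro i
        have h₂ : fwd (AdjoinRoot.mk p (Polynomial.C (X i))) =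
            monicVar n (Polynomial R) (i + 1) + C Polynomial.X * monicVar n _ i := by
          simp [fwd, mulLinear]
        have h₃ : monicVar (n + 1) R (i + 1) = X i := dif_pos i.2
        simp only [RingHom.comp_apply, h₂, map_add, map_mul, hbackX]
        rw [hback _ (by omega), hback _ (by omega), divLinear, h₃, map_sub, map_mul,
          AdjoinRoot.mk_X, sub_add_cancel]
      · simp [fwd, hbackX]
    refine RingHom.ext fun x => ?_
    obtain ⟨q, rfl⟩ := AdjoinRoot.mk_surjective x
    exact congrArg (fun g => g q) h
  have h₂ : fwd.comp back = RingHom.id _ := by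
    refine MvPolynomial.ringHom_ext' (Polynomial.ringHom_ext ?_ ?_) ?_
    · intro r
      simp [fwd, back, AdjoinRoot.algebraMap_eq']
    · simp [fwd, hbackX]
    · intro i
      have h := eval₂_divLinear n R (i + 1) (by omega)
      have h' : monicVar n (Polynomial R) (i + 1) = X i := dif_pos i.2
      rw [h'] at h
      simp only [RingHom.comp_apply, back, coe_eval₂Hom, eval₂_X, fwd, AdjoinRoot.lift_mk, h,
        RingHom.id_apply]
  have hfwd : Function.Bijective fwd :=
    ⟨Function.LeftInverse.injective (g := back) fun x => congrArg (fun g => g x) h₁,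
      Function.RightInverse.surjective (g := back) fun x => congrArg (fun g => g x) h₂⟩
  have h₃ : (algebraMap (MvPolynomial (Fin (n + 1)) R) (AdjoinRoot p)).Flat := by
    have := hmonic.free_adjoinRoot
    exact RingHom.flat_algebraMap_iff.2 inferInstance
  have h₄ : (mulLinear n R).toRingHom = fwd.comp (algebraMap _ _) := by
    refine RingHom.ext fun x => ?_
    simp [fwd, AdjoinRoot.algebraMap_eq]
  rw [h₄]
  exact h₃.comp (RingHom.Flat.of_bijective hfwd)

theorem multiset_esymm_cons {R : Type*} [CommRing R] (x : R) (s : Multiset R) (j : ℕ) :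
    (x ::ₘ s).esymm (j + 1) = s.esymm (j + 1) + x * s.esymm j := by
  simp only [Multiset.esymm, Multiset.powersetCard_cons, Multiset.map_add, Multiset.sum_add,
    Multiset.map_map, Function.comp_def, Multiset.prod_cons, Multiset.sum_map_mul_left]

/-- Polynomials in `n + 1` variables as polynomials in `n` variables over a polynomial ring. -/
noncomputable def splitFirst (n : ℕ) (R : Type*) [CommRing R] :
    MvPolynomial (Fin (n + 1)) R ≃ₐ[R] MvPolynomial (Fin n) (Polynomial R) :=
  (renameEquiv R (_root_.finSuccEquiv n)).trans (optionEquivRight R (Fin n))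

theorem splitFirst_zero (n : ℕ) (R : Type*) [CommRing R] :
    splitFirst n R (X 0) = C Polynomial.X := by
  simp [splitFirst]

theorem splitFirst_succ (n : ℕ) (R : Type*) [CommRing R] (i : Fin n) :
    splitFirst n R (X i.succ) = X i := by
  simp [splitFirst]

/-- This is the recursion that `mulLinear` encodes, with the elementary symmetric polynomials of the
remaining variables in place of the generic coefficients. -/
theorem splitFirst_esymm (n : ℕ) (R : Type*) [CommRing R] (j : ℕ) :
    splitFirst n R (esymm (Fin (n + 1)) R (j + 1)) =
      esymm (Fin n) (Polynomial R) (j + 1) + C Polynomial.X * esymm (Fin n) (Polynomial R) j := by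
  have h : ∀ q : MvPolynomial (Fin (n + 1)) R,
      splitFirst n R q = aeval (fun i => splitFirst n R (X i)) q := fun q => by
    conv_lhs => rw [← AlgEquiv.coe_toAlgHom, aeval_unique (splitFirst n R).toAlgHom]
    rfl
  rw [h, aeval_esymm_eq_multiset_esymm, esymm_eq_multiset_esymm, ← multiset_esymm_cons]
  congr 1
  rw [Fin.univ_succ, Finset.cons_val, Multiset.map_cons, splitFirst_zero, Finset.map_val,
    Multiset.map_map]
  congr 1
  refine Multiset.map_congr rfl fun i _ => ?_
  exact splitFirst_succ n R i

/-- A polynomial ring is flat over itself via the elementary symmetric polynomials. -/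
theorem flat_aeval_esymm (n : ℕ) (R : Type u) [CommRing R] :
    (aeval (R := R) fun i : Fin n => esymm (Fin n) R (i + 1)).toRingHom.Flat := by
  induction n generalizing R with
  | zero =>
    have h : (aeval (R := R) fun i : Fin 0 => esymm (Fin 0) R (i + 1)) = AlgHom.id R _ :=
      MvPolynomial.algHom_ext fun i => i.elim0
    rw [h]
    exact RingHom.Flat.id _
  | succ n ih =>
    -- Valid for all `j`: beyond `n` the default value `0` of `monicVar` matches the vanishing
    -- elementary symmetric polynomial.
    have hd : ∀ j, aeval (R := Polynomial R) (fun i : Fin n => esymm (Fin n) (Polynomial R) (i + 1))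
        (monicVar n (Polynomial R) j) = esymm (Fin n) (Polynomial R) j := by
      intro j
      rcases j with _ | j
      · simp [monicVar]
      · by_cases h : j < n
        · rw [show monicVar n (Polynomial R) (j + 1) = X ⟨j, h⟩ from dif_pos h, aeval_X]
        · rw [show monicVar n (Polynomial R) (j + 1) = 0 from dif_neg h, map_zero, esymm,
            Finset.powersetCard_eq_empty.2 (by simpa using Nat.lt_succ_of_le (not_lt.1 h)),
            Finset.sum_empty]
    -- The first variable is peeled off: `mulLinear` adjoins it, and the induction hypothesis, over
    -- the base ring `Polynomial R`, treats the others. For this reason the base ring varies in the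
    -- induction.
    have h : (aeval (R := R) fun i : Fin (n + 1) => esymm (Fin (n + 1)) R (i + 1)).toRingHom =
        (splitFirst n R).symm.toRingEquiv.toRingHom.comp
          ((aeval (R := Polynomial R) fun i : Fin n =>
            esymm (Fin n) (Polynomial R) (i + 1)).toRingHom.comp (mulLinear n R).toRingHom) := by
      refine MvPolynomial.ringHom_ext (fun r => (splitFirst n R).injective ?_)
        (fun i => (splitFirst n R).injective ?_)
      · change splitFirst n R (aeval _ (C r)) = splitFirst n R ((splitFirst n R).symm (aeval _
          (mulLinear n R (C r))))
        rw [AlgEquiv.apply_symm_apply, algHom_C, ← algebraMap_eq, AlgHom.commutes,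
          AlgEquiv.commutes]
        simp [IsScalarTower.algebraMap_apply R (Polynomial R) (MvPolynomial (Fin n) (Polynomial R)),
          MvPolynomial.algebraMap_eq]
      · change splitFirst n R (aeval _ (X i)) = splitFirst n R ((splitFirst n R).symm (aeval _
          (mulLinear n R (X i))))
        rw [AlgEquiv.apply_symm_apply, aeval_X, splitFirst_esymm, mulLinear, aeval_X, map_add,
          map_mul, hd, hd]
        simp [MvPolynomial.algebraMap_eq]
    rw [h]
    exact ((flat_mulLinear n R).comp (ih _)).comp
      (RingHom.Flat.of_bijective (splitFirst n R).symm.bijective)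

end Flatness

/-! ### Rings of invariants as polynomial rings, and flatness of `R_{k,l}` over `R_{k+l}` -/

section Invariants

open MvPolynomial

variable (K : Type u) [Field K]

theorem invariants_top (σ : Type) : invariants K (⊤ : Subgroup (Equiv.Perm σ)) =
    symmetricSubalgebra σ K :=
  Subalgebra.ext fun _ => ⟨fun h g => h g trivial, fun h g _ => h g⟩

/-- The fundamental theorem on symmetric polynomials. -/
noncomputable def symEquiv {σ : Type} [Fintype σ] {n : ℕ} (hn : Fintype.card σ = n) :
    MvPolynomial (Fin n) K ≃ₐ[K] invariants K (⊤ : Subgroup (Equiv.Perm σ)) :=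
  (esymmAlgEquiv σ K hn).trans (Subalgebra.equivOfEq _ _ (invariants_top K σ).symm)

theorem symEquiv_apply {σ : Type} [Fintype σ] {n : ℕ} (hn : Fintype.card σ = n)
    (p : MvPolynomial (Fin n) K) :
    (symEquiv K hn p).1 = aeval (fun i : Fin n => esymm σ K (i + 1)) p :=
  esymmAlgHom_apply p

/-- By the fundamental theorem, the inclusion of the symmetric polynomials is the evaluation of a
polynomial ring at the elementary symmetric polynomials. -/
theorem flat_symmetric {σ : Type} [Fintype σ] :
    (invariants K (⊤ : Subgroup (Equiv.Perm σ))).val.toRingHom.Flat := by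
  set n := Fintype.card σ with hn
  let e : Fin n ≃ σ := (Fintype.equivFin σ).symm
  have h : (invariants K (⊤ : Subgroup (Equiv.Perm σ))).val.toRingHom =
      ((renameEquiv K e).toRingEquiv.toRingHom.comp
        (aeval (R := K) fun i : Fin n => esymm (Fin n) K (i + 1)).toRingHom).comp
          (symEquiv K hn.symm).symm.toRingEquiv.toRingHom := by
    refine RingHom.ext fun x => ?_
    obtain ⟨p, rfl⟩ := (symEquiv K hn.symm).surjective x
    change (symEquiv K hn.symm p).1 = rename e (aeval (fun i : Fin n => esymm (Fin n) K (i + 1))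
      ((symEquiv K hn.symm).symm (symEquiv K hn.symm p)))
    rw [AlgEquiv.symm_apply_apply, symEquiv_apply, ← AlgHom.comp_apply]
    refine congrArg (fun g : _ →ₐ[K] _ => g p) (MvPolynomial.algHom_ext fun i => ?_)
    rw [AlgHom.comp_apply, aeval_X, aeval_X, rename_esymm]
  rw [h]
  exact (RingHom.Flat.of_bijective (symEquiv K hn.symm).symm.bijective).comp
    ((flat_aeval_esymm n K).comp (RingHom.Flat.of_bijective (renameEquiv K e).bijective))

variable (k l : ℕ)

/-- The generators of `R_{k+l}`. -/
noncomputable def symTotEquiv : MvPolynomial (Fin (l + k)) K ≃ₐ[K] symTot K k l :=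
  symEquiv K (by simp [add_comm])

theorem symTotEquiv_X (i : Fin (l + k)) :
    (symTotEquiv K k l (X i)).1 = esymm (Fin k ⊕ Fin l) K (i + 1) := by
  exact (symEquiv_apply K _ _).trans (aeval_X _ _)

/-- The average of a polynomial over the permutations of both alphabets. -/
noncomputable def averageMap : MvPolynomial (Fin k ⊕ Fin l) K →ₗ[symTot K k l] symPair K k l where
  toFun p := ⟨(Fintype.card (Equiv.Perm (Fin k) × Equiv.Perm (Fin l)) : K)⁻¹ •
    ∑ g : Equiv.Perm (Fin k) × Equiv.Perm (Fin l),
      rename (Equiv.Perm.sumCongrHom (Fin k) (Fin l) g) p, by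
    rintro _ ⟨h, rfl⟩
    rw [map_smul, map_sum]
    congr 1
    refine Fintype.sum_equiv (Equiv.mulLeft h) _ _ fun g => ?_
    rw [rename_rename, Equiv.coe_mulLeft, map_mul]
    rfl⟩
  map_add' p q := by
    ext1
    simp only [map_add, Finset.sum_add_distrib, smul_add, Subalgebra.coe_add]
  map_smul' s p := by
    ext1
    have h : ∀ g : Equiv.Perm (Fin k ⊕ Fin l), rename g s.1 = s.1 := fun g => s.2 g trivial
    change _ • ∑ g, rename _ (s.1 * p) = s.1 * _
    simp only [map_mul, h]
    rw [← Finset.mul_sum, mul_smul_comm]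

/-- Averaging over both symmetric groups exhibits `R_{k,l}` as a retract of the full polynomial
ring, which is flat over `R_{k+l}`. This is where characteristic zero enters: the order `k! l!` must
be invertible. -/
theorem flat_symPair [CharZero K] : Module.Flat (symTot K k l) (symPair K k l) := by
  have h : Module.Flat (symTot K k l) (MvPolynomial (Fin k ⊕ Fin l) K) := flat_symmetric K
  let i : symPair K k l →ₗ[symTot K k l] MvPolynomial (Fin k ⊕ Fin l) K :=
    { toFun := Subtype.val
      map_add' _ _ := rfl
      map_smul' _ _ := rfl }
  refine Module.Flat.of_retract (f := h) i (averageMap K k l) (LinearMap.ext fun p => ?_)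
  ext1
  have h' : ∀ g, rename (Equiv.Perm.sumCongrHom (Fin k) (Fin l) g) p.1 = p.1 :=
    fun g => p.2 _ ⟨g, rfl⟩
  change _ • ∑ g, rename (Equiv.Perm.sumCongrHom (Fin k) (Fin l) g) p.1 = p.1
  simp only [h', Finset.sum_const, Finset.card_univ]
  rw [← Nat.cast_smul_eq_nsmul K, smul_smul, inv_mul_cancel₀, one_smul]
  exact Nat.cast_ne_zero.2 Fintype.card_ne_zero

end Invariants

/-! ### The ring `R_{k,l}` -/

section PairRing

open MvPolynomial

variable (K : Type u) [Field K] (k l : ℕ)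

/-- The generating polynomial of a union of alphabets is the product of the two generating
polynomials. -/
theorem multiset_esymm_add {R : Type*} [CommRing R] (s t : Multiset R) (n : ℕ) :
    (s + t).esymm n = ∑ p ∈ Finset.HasAntidiagonal.antidiagonal n, s.esymm p.1 * t.esymm p.2 := by
  induction s using Multiset.induction_on generalizing n with
  | empty =>
    rw [zero_add, Finset.sum_eq_single_of_mem (0, n) (by simp)]
    · simp [Multiset.esymm]
    · rintro ⟨i, j⟩ h h'
      rcases i with _ | i
      · simp at h
        simp [h] at h'
      · simp [Multiset.esymm, Multiset.powersetCard_zero_right]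
  | cons x s ih =>
    rcases n with _ | n
    · simp [Multiset.esymm]
    · rw [Multiset.cons_add, multiset_esymm_cons, ih, ih, Finset.Nat.antidiagonal_succ,
        Finset.sum_cons, Finset.sum_cons, Finset.sum_map, Finset.sum_map, Finset.mul_sum, add_assoc,
        ← Finset.sum_add_distrib]
      congr 1
      · simp [Multiset.esymm]
      · refine Finset.sum_congr rfl fun p _ => ?_
        change s.esymm (p.1 + 1) * t.esymm p.2 + x * (s.esymm p.1 * t.esymm p.2) =
          (x ::ₘ s).esymm (p.1 + 1) * t.esymm p.2
        rw [multiset_esymm_cons]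
        ring

theorem esymm_sum (n : ℕ) : esymm (Fin k ⊕ Fin l) K n =
    ∑ p ∈ Finset.HasAntidiagonal.antidiagonal n,
      rename Sum.inl (esymm (Fin k) K p.1) * rename Sum.inr (esymm (Fin l) K p.2) := by
  have h₁ : ∀ i, rename Sum.inl (esymm (Fin k) K i) =
      (Finset.univ.val.map fun j => (X (Sum.inl j) : MvPolynomial (Fin k ⊕ Fin l) K)).esymm i := by
    intro i
    rw [aeval_unique (rename Sum.inl), aeval_esymm_eq_multiset_esymm]
    simp
  have h₂ : ∀ i, rename Sum.inr (esymm (Fin l) K i) =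
      (Finset.univ.val.map fun j => (X (Sum.inr j) : MvPolynomial (Fin k ⊕ Fin l) K)).esymm i := by
    intro i
    rw [aeval_unique (rename Sum.inr), aeval_esymm_eq_multiset_esymm]
    simp
  simp only [h₁, h₂]
  rw [← multiset_esymm_add, esymm_eq_multiset_esymm, ← Finset.univ_disjSum_univ]
  congr 1
  rw [Finset.val_disjSum, Multiset.disjSum, Multiset.map_add, Multiset.map_map, Multiset.map_map]
  rfl

/-- Polynomials in two alphabets as polynomials in the second one. -/
noncomputable def splitSum :
    MvPolynomial (Fin k ⊕ Fin l) K ≃ₐ[K] MvPolynomial (Fin l) (MvPolynomial (Fin k) K) :=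
  (renameEquiv K (Equiv.sumComm (Fin k) (Fin l))).trans (sumAlgEquiv K (Fin l) (Fin k))

theorem splitSum_inl (i : Fin k) : splitSum K k l (X (Sum.inl i)) = C (X i) := by
  simp [splitSum]

theorem splitSum_inr (i : Fin l) : splitSum K k l (X (Sum.inr i)) = X i := by
  simp [splitSum]

theorem splitSum_rename_inl (p : MvPolynomial (Fin k) K) :
    splitSum K k l (rename Sum.inl p) = C p := by
  have h : (splitSum K k l).toAlgHom.comp (rename Sum.inl) =
      (IsScalarTower.toAlgHom K (MvPolynomial (Fin k) K) _) :=
    MvPolynomial.algHom_ext fun i => by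
      simp [splitSum_inl, MvPolynomial.algebraMap_eq]
  exact congrArg (fun g => g p) h

theorem splitSum_rename_inr (p : MvPolynomial (Fin l) K) :
    splitSum K k l (rename Sum.inr p) = map C p := by
  have h : (splitSum K k l).toAlgHom.comp (rename Sum.inr) =
      mapAlgHom (Algebra.ofId K (MvPolynomial (Fin k) K)) :=
    MvPolynomial.algHom_ext fun i => by
      simp [splitSum_inr]
  exact congrArg (fun g => g p) h

theorem splitSum_perm_right (b : Equiv.Perm (Fin l)) (p : MvPolynomial (Fin k ⊕ Fin l) K) :
    splitSum K k l (rename (Equiv.Perm.sumCongrHom (Fin k) (Fin l) (1, b)) p) =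
      rename b (splitSum K k l p) := by
  have h : (splitSum K k l).toAlgHom.comp
      (rename (Equiv.Perm.sumCongrHom (Fin k) (Fin l) (1, b))) =
        ((rename b).restrictScalars K).comp (splitSum K k l).toAlgHom := by
    refine MvPolynomial.algHom_ext fun i => ?_
    rcases i with i | i <;> simp [splitSum_inl, splitSum_inr]
  exact congrArg (fun g => g p) h

theorem splitSum_perm_left (a : Equiv.Perm (Fin k)) (p : MvPolynomial (Fin k ⊕ Fin l) K) :
    splitSum K k l (rename (Equiv.Perm.sumCongrHom (Fin k) (Fin l) (a, 1)) p) =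
      map (rename a).toRingHom (splitSum K k l p) := by
  have h : (splitSum K k l).toAlgHom.comp
      (rename (Equiv.Perm.sumCongrHom (Fin k) (Fin l) (a, 1))) =
        (mapAlgHom (rename a)).comp (splitSum K k l).toAlgHom := by
    refine MvPolynomial.algHom_ext fun i => ?_
    rcases i with i | i <;> simp [splitSum_inl, splitSum_inr]
  exact congrArg (fun g => g p) h

/-- `R_{k,l}` in terms of `R_k` and the elementary symmetric polynomials in the second alphabet. -/
noncomputable def pairHom : MvPolynomial (Fin l) (sym K k) →ₐ[K] symPair K k l :=
  aevalTower (symInl K k l) fun j => esymmSnd K k l (j + 1)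

theorem splitSum_pairHom (q : MvPolynomial (Fin l) (sym K k)) :
    splitSum K k l (pairHom K k l q).1 =
      aeval (fun j : Fin l => esymm (Fin l) (MvPolynomial (Fin k) K) (j + 1))
        (map (sym K k).val.toRingHom q) := by
  have h : (splitSum K k l).toRingEquiv.toRingHom.comp
      ((symPair K k l).val.toRingHom.comp (pairHom K k l).toRingHom) =
      (aeval (R := MvPolynomial (Fin k) K)
        fun j : Fin l => esymm (Fin l) (MvPolynomial (Fin k) K) (j + 1)).toRingHom.comp
        (map (sym K k).val.toRingHom) := by
    refine MvPolynomial.ringHom_ext (fun c => ?_) fun j => ?_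
    · change splitSum K k l (pairHom K k l (C c)).1 = aeval _ (map _ (C c))
      rw [pairHom, aevalTower_C, map_C]
      change splitSum K k l (rename Sum.inl c.1) = aeval _ (C c.1)
      rw [splitSum_rename_inl, algHom_C]
      rfl
    · change splitSum K k l (pairHom K k l (X j)).1 = aeval _ (map _ (X j))
      rw [pairHom, aevalTower_X, map_X, aeval_X]
      change splitSum K k l (rename Sum.inr _) = _
      rw [splitSum_rename_inr, map_esymm]
  exact congrArg (fun g => g q) h

/-- The fundamental theorem in the second alphabet, over the coefficient ring of polynomials in the
first, gives a unique expansion of each element. Uniqueness forces its coefficients to be symmetric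
in the first alphabet. -/
theorem pairHom_bijective : Function.Bijective (pairHom K k l) := by
  have hinj : Function.Injective
      (aeval (R := MvPolynomial (Fin k) K)
        fun j : Fin l => esymm (Fin l) (MvPolynomial (Fin k) K) (j + 1)) := by
    intro p q h
    rw [← esymmAlgHom_apply, ← esymmAlgHom_apply] at h
    exact esymmAlgHom_injective (σ := Fin l) (n := l) (MvPolynomial (Fin k) K) (by simp)
      (Subtype.ext h)
  constructor
  · intro p q h
    refine map_injective (sym K k).val.toRingHom Subtype.val_injective (hinj ?_)
    rw [← splitSum_pairHom, ← splitSum_pairHom, h]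
  · intro a
    have hsymm : splitSum K k l a.1 ∈ symmetricSubalgebra (Fin l) (MvPolynomial (Fin k) K) := by
      intro b
      rw [← splitSum_perm_right, a.2 _ ⟨(1, b), rfl⟩]
    obtain ⟨q, hq⟩ := esymmAlgHom_surjective (σ := Fin l) (n := l) (MvPolynomial (Fin k) K)
      (by simp) ⟨_, hsymm⟩
    have hq' : aeval (fun j : Fin l => esymm (Fin l) (MvPolynomial (Fin k) K) (j + 1)) q =
        splitSum K k l a.1 := by
      rw [← esymmAlgHom_apply, hq]
    -- A permutation of the first alphabet fixes `a` and the elementary symmetric polynomials of the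
    -- second alphabet, hence the coefficients of the expansion.
    have hinv : ∀ g : Equiv.Perm (Fin k), map (rename (R := K) g).toRingHom q = q := by
      intro g
      refine hinj ?_
      rw [hq', ← a.2 _ ⟨(g, 1), rfl⟩, splitSum_perm_left, ← hq']
      have h : ((aeval (R := MvPolynomial (Fin k) K)
          fun j : Fin l => esymm (Fin l) (MvPolynomial (Fin k) K) (j + 1)).toRingHom.comp
            (map (rename (R := K) g).toRingHom)) = (map (rename (R := K) g).toRingHom).comp
          (aeval (R := MvPolynomial (Fin k) K)
            fun j : Fin l => esymm (Fin l) (MvPolynomial (Fin k) K) (j + 1)).toRingHom := by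
        refine MvPolynomial.ringHom_ext (fun c => ?_) fun j => ?_
        · simp [MvPolynomial.algebraMap_eq]
        · simp [map_esymm]
      exact congrArg (fun g => g q) h
    have hrange : q ∈ Set.range (map (sym K k).val.toRingHom) := by
      rw [mem_range_map_iff_coeffs_subset]
      intro c hc
      obtain ⟨m, _, rfl⟩ := mem_coeffs_iff.1 hc
      refine ⟨⟨q.coeff m, fun g _ => ?_⟩, rfl⟩
      have := congrArg (coeff m) (hinv g)
      rwa [coeff_map] at this
    obtain ⟨p, rfl⟩ := hrange
    refine ⟨p, Subtype.ext ((splitSum K k l).injective ?_)⟩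
    rw [splitSum_pairHom, hq']

/-- `R_{k,l}` is a polynomial ring over `R_k`. -/
noncomputable def pairEquiv : MvPolynomial (Fin l) (sym K k) ≃ₐ[K] symPair K k l :=
  AlgEquiv.ofBijective (pairHom K k l) (pairHom_bijective K k l)

theorem pairEquiv_C (c : sym K k) : pairEquiv K k l (C c) = symInl K k l c :=
  aevalTower_C _ _ c

theorem pairEquiv_X (j : Fin l) : pairEquiv K k l (X j) = esymmSnd K k l (j + 1) :=
  aevalTower_X _ _ j

/-- The elementary symmetric polynomial `e_r` in the first alphabet. -/
noncomputable def esymmFst (r : ℕ) : symPair K k l :=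
  symInl K k l ⟨esymm (Fin k) K r, fun g _ => rename_esymm _ _ _ g⟩

/-- `R_{k,l}` is a polynomial ring over the ground field. -/
noncomputable def genEquiv : MvPolynomial (Fin l ⊕ Fin k) K ≃ₐ[K] symPair K k l :=
  ((sumAlgEquiv K (Fin l) (Fin k)).trans
    (mapAlgEquiv (Fin l) (symEquiv K (Fintype.card_fin k)))).trans (pairEquiv K k l)

theorem genEquiv_inl (j : Fin l) : genEquiv K k l (X (Sum.inl j)) = esymmSnd K k l (j + 1) := by
  simp [genEquiv, pairEquiv_X]

theorem genEquiv_inr (i : Fin k) : genEquiv K k l (X (Sum.inr i)) = esymmFst K k l (i + 1) := by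
  have h : symEquiv K (Fintype.card_fin k) (X i) =
      ⟨esymm (Fin k) K (i + 1), fun g _ => rename_esymm _ _ _ g⟩ := by
    ext1
    rw [symEquiv_apply, aeval_X]
  simp [genEquiv, pairEquiv_C, esymmFst, h]

/-- The elementary symmetric polynomial `e_r` in both alphabets. -/
noncomputable def esymmTot (r : ℕ) : symTot K k l :=
  ⟨esymm (Fin k ⊕ Fin l) K r, fun g _ => rename_esymm _ _ _ g⟩

theorem symTotEquiv_X' (i : Fin (l + k)) : symTotEquiv K k l (X i) = esymmTot K k l (i + 1) :=
  Subtype.ext (symTotEquiv_X K k l i)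

theorem algebraMap_esymmTot (n : ℕ) : algebraMap (symTot K k l) (symPair K k l) (esymmTot K k l n) =
    ∑ p ∈ Finset.HasAntidiagonal.antidiagonal n, esymmFst K k l p.1 * esymmSnd K k l p.2 := by
  refine Subtype.ext ((esymm_sum K k l n).trans ?_)
  rw [AddSubmonoidClass.coe_finsetSum]
  rfl

theorem esymmFst_zero : esymmFst K k l 0 = 1 :=
  Subtype.ext (by simp [esymmFst, symInl])

theorem esymmSnd_zero : esymmSnd K k l 0 = 1 :=
  Subtype.ext (by simp [esymmSnd])

theorem esymmSnd_eq_zero {r : ℕ} (h : l < r) : esymmSnd K k l r = 0 := by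
  refine Subtype.ext ?_
  change rename Sum.inr (esymm (Fin l) K r) = 0
  rw [esymm, Finset.powersetCard_eq_empty.2 (by simpa using h), Finset.sum_empty, map_zero]

/-- The degree of a monomial in the elementary symmetric polynomials. -/
def monomialDeg {l : ℕ} (m : Fin l →₀ ℕ) : ℤ := ∑ j, m j * (2 * ((j : ℤ) + 1))

theorem monomial_mem (m : Fin l →₀ ℕ) :
    ∏ j : Fin l, esymmSnd K k l (j + 1) ^ m j ∈ pairDeg K k l (monomialDeg m) := by
  have hone : (1 : symPair K k l) ∈ pairDeg K k l 0 := by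
    intro u hu
    have hu' : (1 : MvPolynomial (Fin k ⊕ Fin l) K).coeff u ≠ 0 := hu
    rw [coeff_one] at hu'
    have : u = 0 := by by_contra h; exact hu' (if_neg (Ne.symm h))
    simp [this]
  have hpow : ∀ (a : symPair K k l) (d : ℤ), a ∈ pairDeg K k l d → ∀ n : ℕ,
      a ^ n ∈ pairDeg K k l (n * d) := by
    intro a d ha n
    induction n with
    | zero => simpa using hone
    | succ n ih =>
      have h : ((n + 1 : ℕ) : ℤ) * d = n * d + d := by push_cast; ring
      rw [pow_succ, h]
      exact pairDeg_mul K k l ih ha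
  rw [monomialDeg]
  refine Finset.induction_on (motive := fun s => ∏ j ∈ s, esymmSnd K k l ((j : Fin l) + 1) ^ m j ∈
    pairDeg K k l (∑ j ∈ s, (m j : ℤ) * (2 * ((j : ℤ) + 1)))) Finset.univ ?_ ?_
  · simpa using hone
  · intro j s hj ih
    rw [Finset.prod_insert hj, Finset.sum_insert hj]
    refine pairDeg_mul K k l (hpow _ _ ?_ _) ih
    exact_mod_cast esymmSnd_mem K k l (j + 1)

theorem pairEquiv_monomial (m : Fin l →₀ ℕ) (c : sym K k) :
    pairEquiv K k l (monomial m c) = symInl K k l c * ∏ j : Fin l, esymmSnd K k l (j + 1) ^ m j := by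
  rw [monomial_eq, map_mul, pairEquiv_C, Finsupp.prod_fintype _ _ (by simp), map_prod]
  simp [pairEquiv_X]

/-- The projection of `R_{k,l}` to its part of degree `d`. -/
noncomputable def pairProj (d : ℤ) : symPair K k l →ₗ[K] symPair K k l :=
  invProj (Equiv.Perm.sumCongrHom (Fin k) (Fin l)).range d

theorem pairProj_same (d : ℤ) {p : symPair K k l} (hp : p ∈ pairDeg K k l d) :
    pairProj K k l d p = p := invProj_same _ d hp

theorem pairProj_ne {d e : ℤ} (h : e ≠ d) {p : symPair K k l} (hp : p ∈ pairDeg K k l d) :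
    pairProj K k l e p = 0 := invProj_ne _ h hp

theorem pairProj_symInl_mul {d e : ℤ} {y : symPair K k l} (hy : y ∈ pairDeg K k l e) (c : sym K k) :
    pairProj K k l d (symInl K k l c * y) = symInl K k l (invProj ⊤ (d - e) c) * y := by
  have hc : c ∈ ⨆ i, symDeg K k i := by rw [iSup_invDeg]; trivial
  induction hc using Submodule.iSup_induction' with
  | mem i c hc =>
    have h : symInl K k l c * y ∈ pairDeg K k l (i + e) :=
      pairDeg_mul K k l (symInl_mem K k l i c hc) hy
    by_cases h' : d = i + e
    · subst h'
      rw [pairProj_same K k l _ h, add_sub_cancel_right, invProj_same _ _ hc]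
    · rw [pairProj_ne K k l h' h, invProj_ne _ (fun h'' => h' (by omega)) hc, map_zero, zero_mul]
  | zero => rw [map_zero, zero_mul, map_zero, map_zero, map_zero, zero_mul]
  | add a b _ _ ha hb => rw [map_add, add_mul, map_add, ha, hb, map_add, map_add, add_mul]

/-- The projection to degree `d` fixes `a` and acts on its expansion term by term, so by uniqueness
every coefficient equals its own homogeneous part. -/
theorem coeff_pairEquiv_symm_mem {d : ℤ} {a : symPair K k l} (ha : a ∈ pairDeg K k l d)
    (m : Fin l →₀ ℕ) : ((pairEquiv K k l).symm a).coeff m ∈ symDeg K k (d - monomialDeg m) := by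
  obtain ⟨q, rfl⟩ := (pairEquiv K k l).surjective a
  rw [AlgEquiv.symm_apply_apply]
  have h : q = ∑ m ∈ q.support, monomial m (invProj ⊤ (d - monomialDeg m) (q.coeff m)) := by
    refine (pairEquiv K k l).injective ?_
    conv_lhs => rw [← pairProj_same K k l d ha, q.as_sum]
    rw [map_sum, map_sum, map_sum]
    refine Finset.sum_congr rfl fun m _ => ?_
    rw [pairEquiv_monomial, pairEquiv_monomial, pairProj_symInl_mul K k l (monomial_mem K k l m)]
  rw [h, coeff_sum]
  refine sum_mem fun m' _ => ?_
  rw [coeff_monomial]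
  split_ifs with h'
  · subst h'
    exact invProj_mem _ _ _
  · exact zero_mem _

end PairRing

/-! ### A criterion for quasi-isomorphisms -/

section QuasiIso

theorem shortComplex_quasiIso {K : Type u} [Field K] {S₁ S₂ : ShortComplex (ModuleCat.{u} K)}
    (φ : S₁ ⟶ S₂)
    (inj : ∀ x : S₁.X₂, S₁.g x = 0 → (∃ y, S₂.f y = φ.τ₂ x) → ∃ x', S₁.f x' = x)
    (surj : ∀ y : S₂.X₂, S₂.g y = 0 → ∃ x, S₁.g x = 0 ∧ ∃ y', S₂.f y' = φ.τ₂ x - y) :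
    ShortComplex.QuasiIso φ := by
  let h₁ := S₁.moduleCatLeftHomologyData
  let h₂ := S₂.moduleCatLeftHomologyData
  rw [ShortComplex.quasiIso_iff_isIso_leftHomologyMap' φ h₁ h₂,
    ConcreteCategory.isIso_iff_bijective]
  have hπ : ∀ z, ShortComplex.leftHomologyMap' φ h₁ h₂ (h₁.π z) =
      h₂.π (ShortComplex.cyclesMap' φ h₁ h₂ z) := fun z =>
    congrArg (fun f => f z) (congrArg (fun f => f.hom)
      (ShortComplex.leftHomologyπ_naturality' φ h₁ h₂))
  have hi : ∀ z, h₂.i (ShortComplex.cyclesMap' φ h₁ h₂ z) = φ.τ₂ (h₁.i z) := fun z =>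
    congrArg (fun f => f z) (congrArg (fun f => f.hom) (ShortComplex.cyclesMap'_i φ h₁ h₂))
  have hs₁ : Function.Surjective h₁.π := Submodule.mkQ_surjective _
  have hs₂ : Function.Surjective h₂.π := Submodule.mkQ_surjective _
  have hz₁ : ∀ z, h₁.π z = 0 ↔ ∃ x, S₁.f x = h₁.i z := by
    intro z
    refine (Submodule.Quotient.mk_eq_zero _).trans ⟨?_, ?_⟩
    · rintro ⟨x, hx⟩
      exact ⟨x, congrArg Subtype.val hx⟩
    · rintro ⟨x, hx⟩
      exact ⟨x, Subtype.ext hx⟩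
  have hz₂ : ∀ z, h₂.π z = 0 ↔ ∃ x, S₂.f x = h₂.i z := by
    intro z
    refine (Submodule.Quotient.mk_eq_zero _).trans ⟨?_, ?_⟩
    · rintro ⟨x, hx⟩
      exact ⟨x, congrArg Subtype.val hx⟩
    · rintro ⟨x, hx⟩
      exact ⟨x, Subtype.ext hx⟩
  constructor
  · rw [injective_iff_map_eq_zero]
    intro a ha
    obtain ⟨z, rfl⟩ := hs₁ a
    rw [hπ, hz₂] at ha
    obtain ⟨y, hy⟩ := ha
    rw [hi] at hy
    exact (hz₁ z).2 (inj _ z.2 ⟨y, hy⟩)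
  · intro b
    obtain ⟨w, rfl⟩ := hs₂ b
    obtain ⟨x, hx, y, hy⟩ := surj _ w.2
    obtain ⟨z, rfl⟩ : ∃ z : h₁.K, h₁.i z = x := ⟨⟨x, hx⟩, rfl⟩
    refine ⟨h₁.π z, ?_⟩
    rw [hπ, ← sub_eq_zero, ← map_sub, hz₂]
    refine ⟨y, ?_⟩
    rw [map_sub, hi]
    exact hy

variable {K R : Type u} [Field K] [CommRing R] [Algebra K R] {𝒜 : ℤ → Submodule K R}

theorem quasiIso_of_elements {X Y : CochainComplex (GrBimod K 𝒜) ℤ} (f : X ⟶ Y)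
    (inj : ∀ (n m : ℤ), n + 1 = m → ∀ x : (X.X m).carrier, (X.d m (m + 1)).1 x = 0 →
      (∃ y, (Y.d n m).1 y = (f.f m).1 x) → ∃ x', (X.d n m).1 x' = x)
    (surj : ∀ (n m : ℤ), n + 1 = m → ∀ y : (Y.X m).carrier, (Y.d m (m + 1)).1 y = 0 →
      ∃ x, (X.d m (m + 1)).1 x = 0 ∧ ∃ y', (Y.d n m).1 y' = (f.f m).1 x - y) :
    GrBimod.quasiIso K 𝒜 f := by
  change QuasiIso _
  rw [quasiIso_iff]
  intro m
  have h : m - 1 + 1 = m := by omega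
  rw [quasiIsoAt_iff' _ (m - 1) m (m + 1) (by simp) (by simp)]
  exact shortComplex_quasiIso _ (inj _ _ h) (surj _ _ h)

/-- A quasi-isomorphism becomes an isomorphism in the derived category. -/
noncomputable def derivedIso {X Y : CochainComplex (GrBimod K 𝒜) ℤ} (f : X ⟶ Y)
    (hf : GrBimod.quasiIso K 𝒜 f) : GrBimod.toDerived X ≅ GrBimod.toDerived Y :=
  Localization.isoOfHom (GrBimod.quasiIso K 𝒜).Q _ f hf

end QuasiIso

/-! ### The Koszul complex resolving the partial trace -/

section CardFamilies

variable (K : Type*) [Field K] {M : Type*} [AddCommGroup M] [Module K M] {N : ℕ}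

/-- Extension by zero of a family indexed by the subsets with `r` elements. -/
noncomputable def cardExt (r : ℤ) :
    ({S : Finset (Fin N) // (S.card : ℤ) = r} →₀ M) →ₗ[K] (Finset (Fin N) → M) where
  toFun f S := if h : (S.card : ℤ) = r then f ⟨S, h⟩ else 0
  map_add' f g := by funext S; dsimp only [Pi.add_apply]; split_ifs <;> simp
  map_smul' c f := by funext S; dsimp only [Pi.smul_apply]; split_ifs <;> simp

/-- The restriction of a family to the subsets with `r` elements. -/
noncomputable def cardRes (r : ℤ) :
    (Finset (Fin N) → M) →ₗ[K] ({S : Finset (Fin N) // (S.card : ℤ) = r} →₀ M) :=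
  (Finsupp.linearEquivFunOnFinite K M _).symm.toLinearMap ∘ₗ LinearMap.funLeft K M Subtype.val

variable {K}

theorem cardRes_apply (r : ℤ) (F : Finset (Fin N) → M)
    (S : {S : Finset (Fin N) // (S.card : ℤ) = r}) : cardRes K r F S = F S.1 := rfl

theorem cardExt_of_eq (r : ℤ) (f : {S : Finset (Fin N) // (S.card : ℤ) = r} →₀ M)
    {S : Finset (Fin N)} (h : (S.card : ℤ) = r) : cardExt K r f S = f ⟨S, h⟩ := dif_pos h

theorem cardExt_of_ne (r : ℤ) (f : {S : Finset (Fin N) // (S.card : ℤ) = r} →₀ M)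
    {S : Finset (Fin N)} (h : (S.card : ℤ) ≠ r) : cardExt K r f S = 0 := dif_neg h

theorem cardExt_cardRes (r : ℤ) (F : Finset (Fin N) → M) {S : Finset (Fin N)}
    (h : (S.card : ℤ) = r) : cardExt K r (cardRes K r F) S = F S := dif_pos h

theorem cardRes_cardExt (r : ℤ) (f : {S : Finset (Fin N) // (S.card : ℤ) = r} →₀ M) :
    cardRes K r (cardExt K r f) = f := Finsupp.ext fun S => dif_pos S.2

theorem cardExt_mem (r : ℤ) {p : Finset (Fin N) → Submodule K M}
    {f : {S : Finset (Fin N) // (S.card : ℤ) = r} →₀ M} (hf : ∀ S, f S ∈ p S.1)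
    (S : Finset (Fin N)) : cardExt K r f S ∈ p S := by
  by_cases h : (S.card : ℤ) = r
  · rw [cardExt_of_eq _ _ h]
    exact hf ⟨S, h⟩
  · rw [cardExt_of_ne _ _ h]
    exact zero_mem _

theorem cardExt_map (r : ℤ) (φ : M →ₗ[K] M)
    (f : {S : Finset (Fin N) // (S.card : ℤ) = r} →₀ M) :
    cardExt K r (Finsupp.mapRange.linearMap φ f) = fun S => φ (cardExt K r f S) := by
  funext S
  simp only [cardExt, LinearMap.coe_mk, AddHom.coe_mk]
  split_ifs <;> simp

theorem koszul_congr (δ : Fin N → M →+ M) {F G : Finset (Fin N) → M} {S : Finset (Fin N)}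
    {r : ℤ} (hS : (S.card : ℤ) = r + 1) (h : ∀ T : Finset (Fin N), (T.card : ℤ) = r → F T = G T) :
    koszul δ F S = koszul δ G S := by
  refine Finset.sum_congr rfl fun j hj => ?_
  rw [h]
  have := Finset.card_erase_add_one hj
  omega

theorem cardExt_koszul (δ : Fin N → M →+ M) {r r' : ℤ} (hr : r' = r + 1)
    (f : {S : Finset (Fin N) // (S.card : ℤ) = r} →₀ M) :
    cardExt K r' (cardRes K r' (koszul δ (cardExt K r f))) = koszul δ (cardExt K r f) := by
  funext S
  by_cases h : (S.card : ℤ) = r'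
  · rw [cardExt_cardRes _ _ h]
  · rw [cardExt_of_ne _ _ h]
    refine (Finset.sum_eq_zero fun j hj => ?_).symm
    rw [cardExt_of_ne, map_zero, smul_zero]
    have := Finset.card_erase_add_one hj
    omega

theorem cardRes_koszul (δ : Fin N → M →+ M) {r r' : ℤ} (hr : r' = r + 1)
    (F : Finset (Fin N) → M) :
    cardRes K r' (koszul δ (cardExt K r (cardRes K r F))) = cardRes K r' (koszul δ F) :=
  Finsupp.ext fun S => koszul_congr δ (S.2.trans hr) fun _ hT => cardExt_cardRes _ _ hT

theorem cardRes_koszul_of_ne (δ : Fin N → M →+ M) {r r' : ℤ} (hr : r' ≠ r + 1)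
    (f : {S : Finset (Fin N) // (S.card : ℤ) = r} →₀ M) :
    cardRes K r' (koszul δ (cardExt K r f)) = 0 := by
  refine Finsupp.ext fun S => Finset.sum_eq_zero fun j hj => ?_
  rw [cardExt_of_ne, map_zero, smul_zero]
  have := Finset.card_erase_add_one hj
  have := S.2
  omega

end CardFamilies

/-! ### Koszul complexes of commuting homogeneous endomorphisms -/

section KoszulComplex

variable {K R : Type u} [Field K] [CommRing R] [Algebra K R] {𝒜 : ℤ → Submodule K R}

/-- Commuting homogeneous bimodule endomorphisms. -/
structure KoszulOps (M : GrBimod K 𝒜) (N : ℕ) where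
  op : Fin N → M.carrier →ₗ[K] M.carrier
  wt : Fin N → ℤ
  lact : ∀ j a m, op j (M.lact a m) = M.lact a (op j m)
  ract : ∀ j a m, op j (M.ract a m) = M.ract a (op j m)
  comm : ∀ i j m, op i (op j m) = op j (op i m)
  deg : ∀ j d, ∀ m ∈ M.deg d, op j m ∈ M.deg (d + wt j)

variable {M : GrBimod K 𝒜} {N : ℕ} (D : KoszulOps M N)

/-- The Koszul differential on families indexed by all subsets. -/
noncomputable def KoszulOps.lin : (Finset (Fin N) → M.carrier) →ₗ[K] (Finset (Fin N) → M.carrier) where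
  toFun := koszul fun j => (D.op j).toAddMonoidHom
  map_add' F G := by
    funext S
    simp [koszul, Finset.sum_add_distrib]
  map_smul' c F := by
    funext S
    simp only [koszul, Pi.smul_apply, LinearMap.toAddMonoidHom_coe, map_smul, RingHom.id_apply,
      Finset.smul_sum]
    exact Finset.sum_congr rfl fun j _ => smul_comm _ _ _

variable (c r : ℤ)

/-- The terms of the Koszul complex, shifted by `c` in internal and by `r` in cohomological
degree. -/
noncomputable def KoszulOps.term (n : ℤ) : GrBimod K 𝒜 :=
  GrBimod.copies (fun S : {S : Finset (Fin N) // (S.card : ℤ) = n + r} => c - ∑ j ∈ S.1, D.wt j) M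

theorem KoszulOps.natural (φ : M.carrier →ₗ[K] M.carrier)
    (hφ : ∀ j m, D.op j (φ m) = φ (D.op j m)) (n m : ℤ)
    (f : {S : Finset (Fin N) // (S.card : ℤ) = n} →₀ M.carrier) :
    cardRes K m (D.lin (cardExt K n (Finsupp.mapRange.linearMap φ f))) =
      Finsupp.mapRange.linearMap φ (cardRes K m (D.lin (cardExt K n f))) := by
  ext S
  rw [cardExt_map, Finsupp.mapRange.linearMap_apply, Finsupp.mapRange_apply, cardRes_apply, cardRes_apply]
  simp [KoszulOps.lin, koszul, hφ]

/-- The Koszul differential. -/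
noncomputable def KoszulOps.diff (n m : ℤ) : D.term c r n ⟶ D.term c r m :=
  ⟨cardRes K (m + r) ∘ₗ D.lin ∘ₗ cardExt K (n + r),
    fun a f => D.natural (M.lact a) (fun j m => D.lact j a m) _ _ f,
    fun a f => D.natural (M.ract a) (fun j m => D.ract j a m) _ _ f, by
    intro d f hf S
    change D.lin (cardExt K (n + r) f) S.1 ∈ M.deg (d - (c - ∑ j ∈ S.1, D.wt j))
    refine sum_mem fun j hj => zsmul_mem ?_ _
    have h := D.deg j _ _ (cardExt_mem (n + r) (p := fun S => M.deg (d - (c - ∑ i ∈ S, D.wt i)))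
      hf (S.1.erase j))
    have h' : d - (c - ∑ i ∈ S.1.erase j, D.wt i) + D.wt j = d - (c - ∑ i ∈ S.1, D.wt i) := by
      rw [← Finset.add_sum_erase S.1 D.wt hj]
      ring
    exact h' ▸ h⟩

/-- The Koszul complex of graded bimodules. -/
noncomputable def KoszulOps.complex : CochainComplex (GrBimod K 𝒜) ℤ where
  X := D.term c r
  d := D.diff c r
  shape n m h := by
    refine Subtype.ext (LinearMap.ext fun f => ?_)
    refine cardRes_koszul_of_ne (fun j => (D.op j).toAddMonoidHom) ?_ f
    simp only [ComplexShape.up_Rel] at h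
    omega
  d_comp_d' n m p h h' := by
    simp only [ComplexShape.up_Rel] at h h'
    refine Subtype.ext (LinearMap.ext fun f => ?_)
    have h₁ := cardExt_koszul (K := K) (fun j => (D.op j).toAddMonoidHom)
      (show m + r = n + r + 1 by omega) f
    have h₂ := koszul_koszul (fun j => (D.op j).toAddMonoidHom) D.comm (cardExt K (n + r) f)
    exact (congrArg (fun F => cardRes K (p + r) (D.lin F)) h₁).trans
      ((congrArg (cardRes K (p + r)) h₂).trans (map_zero _))

/-- A cochain as a family indexed by all subsets. -/
noncomputable def KoszulOps.ext (n : ℤ) : ((D.complex c r).X n).carrier →ₗ[K]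
    (Finset (Fin N) → M.carrier) := cardExt K (n + r)

/-- A family indexed by all subsets as a cochain. -/
noncomputable def KoszulOps.res (n : ℤ) : (Finset (Fin N) → M.carrier) →ₗ[K]
    ((D.complex c r).X n).carrier := cardRes K (n + r)

theorem KoszulOps.ext_d {n m : ℤ} (h : n + 1 = m) (x : ((D.complex c r).X n).carrier) :
    D.ext c r m (((D.complex c r).d n m).1 x) = D.lin (D.ext c r n x) :=
  cardExt_koszul (fun j => (D.op j).toAddMonoidHom) (by omega) x

theorem KoszulOps.d_res {n m : ℤ} (h : n + 1 = m) (F : Finset (Fin N) → M.carrier) :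
    ((D.complex c r).d n m).1 (D.res c r n F) = D.res c r m (D.lin F) :=
  cardRes_koszul (fun j => (D.op j).toAddMonoidHom) (by omega) F

theorem KoszulOps.res_ext (n : ℤ) (x : ((D.complex c r).X n).carrier) :
    D.res c r n (D.ext c r n x) = x := cardRes_cardExt _ x

theorem KoszulOps.ext_of_ne (n : ℤ) (x : ((D.complex c r).X n).carrier) {S : Finset (Fin N)}
    (h : (S.card : ℤ) ≠ n + r) : D.ext c r n x S = 0 := cardExt_of_ne _ _ h

theorem KoszulOps.ext_res (n : ℤ) (F : Finset (Fin N) → M.carrier) {S : Finset (Fin N)}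
    (h : (S.card : ℤ) = n + r) : D.ext c r n (D.res c r n F) S = F S := cardExt_cardRes _ _ h

theorem KoszulOps.ext_deg {n d : ℤ} {x : ((D.complex c r).X n).carrier}
    (hx : x ∈ ((D.complex c r).X n).deg d) (S : Finset (Fin N)) :
    D.ext c r n x S ∈ M.deg (d - (c - ∑ j ∈ S, D.wt j)) :=
  cardExt_mem (n + r) (p := fun S => M.deg (d - (c - ∑ i ∈ S, D.wt i))) hx S

theorem KoszulOps.ext_lact {n : ℤ} (a : R) (x : ((D.complex c r).X n).carrier) :
    D.ext c r n (((D.complex c r).X n).lact a x) = fun S => M.lact a (D.ext c r n x S) :=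
  cardExt_map (n + r) (M.lact a) x

theorem KoszulOps.ext_ract {n : ℤ} (a : R) (x : ((D.complex c r).X n).carrier) :
    D.ext c r n (((D.complex c r).X n).ract a x) = fun S => M.ract a (D.ext c r n x S) :=
  cardExt_map (n + r) (M.ract a) x

end KoszulComplex

/-! ### The sequence of `2l + k` generators -/

section Resolution

variable (K : Type u) [Field K] (k l : ℕ)

/-- The elements whose differences generate the complex: the elementary symmetric polynomials in
the second alphabet, followed by those in both alphabets. -/
noncomputable def koszulGen (j : ℕ) : symPair K k l :=
  if j < l then esymmSnd K k l (j + 1)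
  else algebraMap (symTot K k l) (symPair K k l) (esymmTot K k l (j - l + 1))

/-- The degrees of these elements. -/
def koszulWt (l j : ℕ) : ℤ := if j < l then 2 * ((j : ℤ) + 1) else 2 * ((j : ℤ) - l + 1)

theorem esymmTot_mem (r : ℕ) :
    algebraMap (symTot K k l) (symPair K k l) (esymmTot K k l r) ∈ pairDeg K k l (2 * r) :=
  mem_polyDeg_of_isHomogeneous (MvPolynomial.IsHomogeneous.sum _ _ _ fun t ht => by
    have h := MvPolynomial.IsHomogeneous.prod t
      (fun i => (MvPolynomial.X i : MvPolynomial (Fin k ⊕ Fin l) K))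
      (fun _ => 1) fun i _ => MvPolynomial.isHomogeneous_X K i
    rwa [Finset.sum_const, smul_eq_mul, mul_one, (Finset.mem_powersetCard.1 ht).2] at h)

theorem koszulGen_mem (j : ℕ) : koszulGen K k l j ∈ pairDeg K k l (koszulWt l j) := by
  unfold koszulGen koszulWt
  split_ifs with h
  · exact_mod_cast esymmSnd_mem K k l (j + 1)
  · have h' : 2 * ((j : ℤ) - l + 1) = 2 * ((j - l + 1 : ℕ) : ℤ) := by
      push_cast [Nat.cast_sub (not_lt.1 h)]
      ring
    rw [h']
    exact esymmTot_mem K k l _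

end Resolution

/-! ### Difference operators on `A ⊗_K A` -/

section FreeSquare

variable {K A R : Type u} [Field K] [CommRing A] [Algebra K A] [CommRing R] [Algebra K R]
  {𝒜 : ℤ → Submodule K A} (h𝒜 : DirectSum.IsInternal 𝒜)
  (hmul : ∀ {i j : ℤ} {a b : A}, a ∈ 𝒜 i → b ∈ 𝒜 j → a * b ∈ 𝒜 (i + j))
  {ℬ : ℤ → Submodule K R} (φ : R →ₐ[K] A) (hφ : ∀ d, ∀ a ∈ ℬ d, φ a ∈ 𝒜 d)
  {g : ℕ → A} {w : ℕ → ℤ} (hg : ∀ j, g j ∈ 𝒜 (w j))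

/-- The free bimodule `A ⊗_K A`. -/
noncomputable def freeSquare : GrBimod K 𝒜 :=
  GrBimod.tensorSquare (S := K) (fun d => if d = 0 then ⊤ else ⊥) 𝒜
    (eq_top_iff.2 (le_iSup_of_le 0 (by simp))) h𝒜 hmul (by
      intro i j s b hs hb
      by_cases h : i = 0
      · subst h
        rw [zero_add]
        exact Submodule.smul_mem _ _ hb
      · rw [if_neg h, Submodule.mem_bot] at hs
        rw [hs, zero_smul]
        exact zero_mem _)

include h𝒜 hmul hg in
theorem tensorDiff_mul_mem {d : ℤ} (j : ℕ) {x : A ⊗[K] A} (hx : x ∈ tensorDeg K 𝒜 d) :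
    tensorDiff K (g j) * x ∈ tensorDeg K 𝒜 (d + w j) := by
  have h₁ := (freeSquare h𝒜 hmul).lact_mem (hg j) hx
  have h₂ := (freeSquare h𝒜 hmul).ract_mem (hg j) hx
  rw [add_comm, tensorDiff, sub_mul]
  exact sub_mem h₁ h₂

/-- The multiplication by differences of the two actions, on `A ⊗_K A`. -/
noncomputable def diffOps (N : ℕ) :
    KoszulOps (GrBimod.restrict φ hφ (freeSquare h𝒜 hmul)) N where
  op j := Algebra.lmul K (A ⊗[K] A) (tensorDiff K (g j))
  wt j := w j
  lact j a m := mul_left_comm (tensorDiff K (g j)) (φ a ⊗ₜ 1) m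
  ract j a m := mul_left_comm (tensorDiff K (g j)) (1 ⊗ₜ φ a) m
  comm i j m := mul_left_comm (tensorDiff K (g i)) (tensorDiff K (g j)) m
  deg j _ _ hm := tensorDiff_mul_mem h𝒜 hmul hg j hm

end FreeSquare

/-! ### Regularity of the Koszul generators -/

section Triangular

variable {P : Type*} [CommRing P]

theorem RegularFamily.mem_span_image {n : ℕ} {f : ℕ → P}
    (hf : RegularFamily fun i : Fin n => f i) {s : Set ℕ} (hs : ∀ i ∈ s, i < n) {j : ℕ}
    (hj : j < n) (hjs : j ∉ s) {x : P} (hx : f j * x ∈ Ideal.span (f '' s)) :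
    x ∈ Ideal.span (f '' s) := by
  have h : f '' s = (fun i : Fin n => f i) '' (Fin.val ⁻¹' s) := by
    ext y
    constructor
    · rintro ⟨i, hi, rfl⟩
      exact ⟨⟨i, hs i hi⟩, hi, rfl⟩
    · rintro ⟨i, hi, rfl⟩
      exact ⟨i, hi, rfl⟩
  rw [h] at hx ⊢
  exact hf _ ⟨j, hj⟩ hjs x hx

/-- A unitriangular substitution does not change the ideals of initial segments. -/
theorem span_image_lt_eq {f w : ℕ → P} (h : ∀ j, f j - w j ∈ Ideal.span (w '' {i | i < j}))
    (j : ℕ) : Ideal.span (f '' {i | i < j}) = Ideal.span (w '' {i | i < j}) := by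
  induction j with
  | zero => simp
  | succ j ih =>
    have hj : {i | i < j + 1} = insert j {i | i < j} := by
      ext i
      simp only [Set.mem_ofPred_eq, Set.mem_insert_iff]
      omega
    rw [hj, Set.image_insert_eq, Set.image_insert_eq, Ideal.span_insert, Ideal.span_insert, ih]
    have hd := Ideal.mem_sup_right (S := Ideal.span {w j}) (h j)
    have hd' := Ideal.mem_sup_right (S := Ideal.span {f j}) (h j)
    refine le_antisymm (sup_le ?_ le_sup_right) (sup_le ?_ le_sup_right)
    · rw [Ideal.span_singleton_le_iff_mem]
      have := add_mem hd (Ideal.mem_sup_left (Ideal.mem_span_singleton_self (w j)))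
      rwa [sub_add_cancel] at this
    · rw [Ideal.span_singleton_le_iff_mem]
      have := sub_mem (Ideal.mem_sup_left (Ideal.mem_span_singleton_self (f j))) hd'
      rwa [sub_sub_cancel] at this

/-- Modulo the common ideal of the preceding elements, `f j` and `w j` coincide, so regularity
passes from `w` to `f`. -/
theorem span_image_lt_regular {n : ℕ} {f w : ℕ → P}
    (h : ∀ j, f j - w j ∈ Ideal.span (w '' {i | i < j}))
    (hw : RegularFamily fun i : Fin n => w i) {j : ℕ} (hj : j < n) {x : P}
    (hx : f j * x ∈ Ideal.span (f '' {i | i < j})) : x ∈ Ideal.span (f '' {i | i < j}) := by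
  rw [span_image_lt_eq h] at hx ⊢
  refine hw.mem_span_image (fun i hi => lt_trans hi hj) hj (lt_irrefl j) ?_
  have h' := Ideal.mul_mem_right x _ (h j)
  rw [sub_mul] at h'
  have h'' := sub_mem hx h'
  rwa [sub_sub_cancel] at h''

end Triangular

/-! ### Differences of polynomial generators: regularity and kernels -/

section Sequences

variable {K A : Type*} [CommRing K] [CommRing A] [Algebra K A]

theorem tensorDiff_sub (a b : A) : tensorDiff K a - tensorDiff K b = tensorDiff K (a - b) := by
  simp only [tensorDiff, TensorProduct.sub_tmul, TensorProduct.tmul_sub]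
  abel

/-- Replacing the elementary symmetric polynomials of a union of alphabets by those of the first
alphabet. -/
theorem tensorDiff_triangular {l : ℕ} {E u v : ℕ → A} (hu : u 0 = 1) (hv : v 0 = 1)
    (hul : ∀ r, l < r → u r = 0)
    (hE : ∀ n, E n = ∑ p ∈ Finset.HasAntidiagonal.antidiagonal n, v p.1 * u p.2) (j : ℕ) :
    tensorDiff K (if j < l then u (j + 1) else E (j - l + 1)) -
      tensorDiff K (if j < l then u (j + 1) else v (j - l + 1)) ∈
      Ideal.span ((fun j => tensorDiff K (if j < l then u (j + 1) else v (j - l + 1))) ''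
        {i | i < j}) := by
  set I := Ideal.span ((fun j => tensorDiff K (if j < l then u (j + 1) else v (j - l + 1))) ''
        {i | i < j}) with hI
  by_cases hj : j < l
  · rw [if_pos hj, if_pos hj, sub_self]
    exact zero_mem _
  · rw [if_neg hj, if_neg hj, tensorDiff_sub, ← mem_equalizer]
    have hu' : ∀ r, u r ∈ equalizer I := by
      intro r
      rcases Nat.eq_zero_or_pos r with h | h
      · rw [h, hu]
        exact one_mem _
      by_cases hr : l < r
      · rw [hul r hr]
        exact zero_mem _
      · refine Ideal.subset_span ⟨r - 1, ?_, ?_⟩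
        · simp only [Set.mem_ofPred_eq]
          omega
        · dsimp only
          rw [if_pos (by omega), Nat.sub_add_cancel h]
    have hv' : ∀ r < j - l + 1, v r ∈ equalizer I := by
      intro r hr
      rcases Nat.eq_zero_or_pos r with h | h
      · rw [h, hv]
        exact one_mem _
      · refine Ideal.subset_span ⟨l + r - 1, ?_, ?_⟩
        · simp only [Set.mem_ofPred_eq]
          omega
        · dsimp only
          rw [if_neg (by omega), show l + r - 1 - l + 1 = r by omega]
    -- The term `v_n u_0` of `E_n` cancels against `v_n`. All other terms are products of some `u`
    -- and some `v_r` with `r < n`, whose differences occur earlier in the sequence or are zero.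
    rw [hE, ← Finset.add_sum_erase _ _
      (show (j - l + 1, 0) ∈ Finset.HasAntidiagonal.antidiagonal (j - l + 1) from
        Finset.HasAntidiagonal.mem_antidiagonal.2 (add_zero _)), hu, mul_one,
      add_sub_cancel_left]
    refine sum_mem fun p hp => mul_mem (hv' _ ?_) (hu' _)
    obtain ⟨hp₁, hp₂⟩ := Finset.mem_erase.1 hp
    rw [Finset.HasAntidiagonal.mem_antidiagonal] at hp₂
    by_contra h
    exact hp₁ (Prod.ext (by omega) (by dsimp only; omega))

theorem regularFamily_reindex {l k : ℕ} {u v : ℕ → A} (e : MvPolynomial (Fin l ⊕ Fin k) K ≃ₐ[K] A)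
    (hu : ∀ j : Fin l, e (MvPolynomial.X (Sum.inl j)) = u (j + 1))
    (hv : ∀ j : Fin k, e (MvPolynomial.X (Sum.inr j)) = v (j + 1)) :
    RegularFamily fun i : Fin (l + k) =>
      tensorDiff K (if (i : ℕ) < l then u (i + 1) else v (i - l + 1)) := by
  have h := (regularFamily_tensorDiff e).comp_injective finSumFinEquiv.symm.injective
  convert h using 2 with i
  obtain ⟨i, rfl⟩ := finSumFinEquiv.surjective i
  rw [Function.comp_apply, Equiv.symm_apply_apply]
  rcases i with i | i
  · simp [hu]
  · simp [hv]

theorem adjoin_range_equiv {σ : Type*} (e : MvPolynomial σ K ≃ₐ[K] A) :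
    Algebra.adjoin K (Set.range fun i => e (MvPolynomial.X i)) = ⊤ := by
  have h := congrArg (Subalgebra.map e.toAlgHom) (MvPolynomial.adjoin_range_X (R := K) (σ := σ))
  rw [AlgHom.map_adjoin, ← Set.range_comp, Algebra.map_top] at h
  rw [show (fun i => e (MvPolynomial.X i)) = (e.toAlgHom : MvPolynomial σ K → A) ∘ MvPolynomial.X
    from rfl, h]
  exact (AlgHom.range_eq_top _).2 e.surjective

theorem ker_lmul'_reindex {l k : ℕ} {u v : ℕ → A} (e : MvPolynomial (Fin l ⊕ Fin k) K ≃ₐ[K] A)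
    (hu : ∀ j : Fin l, e (MvPolynomial.X (Sum.inl j)) = u (j + 1))
    (hv : ∀ j : Fin k, e (MvPolynomial.X (Sum.inr j)) = v (j + 1)) :
    RingHom.ker (Algebra.TensorProduct.lmul' K (S := A)) =
      Ideal.span ((fun j => tensorDiff K (if j < l then u (j + 1) else v (j - l + 1))) ''
        {i | i < l + k}) := by
  rw [ker_lmul' _ (adjoin_range_equiv e)]
  congr 1
  ext y
  constructor
  · rintro ⟨i | i, rfl⟩
    · exact ⟨i, by simp only [Set.mem_ofPred_eq]; omega, by simp [hu]⟩
    · exact ⟨l + i, by simp only [Set.mem_ofPred_eq]; omega, by simp [hv]⟩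
  · rintro ⟨i, hi, rfl⟩
    simp only [Set.mem_ofPred_eq] at hi
    by_cases h : i < l
    · exact ⟨Sum.inl ⟨i, h⟩, by simp [hu, h]⟩
    · exact ⟨Sum.inr ⟨i - l, by omega⟩, by simp [hv, h]⟩

theorem lmul'_tensorDiff (a : A) : Algebra.TensorProduct.lmul' K (tensorDiff K a) = 0 := by
  simp [tensorDiff]

variable {S : Type*} [CommRing S] [Algebra K S] [Algebra S A] [IsScalarTower K S A]

/-- Differences of polynomial generators of `S` are regular in `S ⊗_K S`, and flatness transports
this to `A ⊗_K A`. -/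
theorem regularFamily_last {p l : ℕ} (e : MvPolynomial (Fin p) K ≃ₐ[K] S) (E : ℕ → S)
    (hE : ∀ j : Fin p, e (MvPolynomial.X j) = E (j + 1)) (hflat : Module.Flat S A) {g : ℕ → A}
    (hg : ∀ j, g (l + j) = algebraMap S A (E (j + 1))) :
    RegularFamily fun i : Fin p => tensorDiff K (g (l + i)) := by
  have h := (regularFamily_tensorDiff e).tensorDiff_flat (φ := IsScalarTower.toAlgHom K S A)
    (RingHom.flat_algebraMap_iff.2 hflat)
  convert h using 3 with i
  rw [hg, hE]
  rfl

theorem last_regular {p l : ℕ} {f : ℕ → A} (hf : RegularFamily fun i : Fin p => f (l + i)) {j : ℕ}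
    (hj : j < p) {x : A} (hx : f (l + j) * x ∈ Ideal.span (f '' {i | l + j < i ∧ i < l + p})) :
    x ∈ Ideal.span (f '' {i | l + j < i ∧ i < l + p}) := by
  have h : f '' {i | l + j < i ∧ i < l + p} = (fun i => f (l + i)) '' {i | j < i ∧ i < p} := by
    ext y
    constructor
    · rintro ⟨i, hi, rfl⟩
      simp only [Set.mem_ofPred_eq] at hi
      refine ⟨i - l, ?_, ?_⟩
      · simp only [Set.mem_ofPred_eq]
        omega
      · dsimp only
        rw [Nat.add_sub_cancel' (by omega)]
    · rintro ⟨i, hi, rfl⟩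
      simp only [Set.mem_ofPred_eq] at hi
      refine ⟨l + i, ?_, rfl⟩
      simp only [Set.mem_ofPred_eq]
      omega
  rw [h] at hx ⊢
  exact RegularFamily.mem_span_image (f := fun i => f (l + i)) hf (fun i hi => hi.2) hj
    (fun h => lt_irrefl _ h.1) hx

theorem ker_tensorProj_last {p l : ℕ} (e : MvPolynomial (Fin p) K ≃ₐ[K] S) (E : ℕ → S)
    (hE : ∀ j : Fin p, e (MvPolynomial.X j) = E (j + 1)) {g : ℕ → A}
    (hg : ∀ j, g (l + j) = algebraMap S A (E (j + 1))) :
    RingHom.ker (tensorProj K S A) =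
      Ideal.span ((fun j => tensorDiff K (g j)) '' {i | l ≤ i ∧ i < l + p}) := by
  rw [ker_tensorProj _ (adjoin_range_equiv e)]
  congr 1
  ext y
  constructor
  · rintro ⟨i, rfl⟩
    exact ⟨l + i, by simp only [Set.mem_ofPred_eq]; omega, by dsimp only; rw [hg, hE]⟩
  · rintro ⟨i, hi, rfl⟩
    simp only [Set.mem_ofPred_eq] at hi
    obtain ⟨j, rfl⟩ := Nat.exists_eq_add_of_le hi.1
    exact ⟨⟨j, by omega⟩, by dsimp only; rw [hg, hE]⟩

end Sequences

/-! ### Comparison of a Koszul complex with the partial trace -/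

section Trace

variable {K : Type u} [Field K] {k l p : ℕ} {X : GrBimod K (symDeg K k)} (D : KoszulOps X (l + p))
  (c : ℤ) (M : GrBimod K (pairDeg K k l)) (π : X.carrier →ₗ[K] M.carrier)

/-- The conditions under which a linear map, applied to the components that involve the last `p`
operators, induces a quasi-isomorphism from a Koszul complex to a partial trace. -/
structure TraceComparison : Prop where
  lact : ∀ a x, π (X.lact a x) = M.lact (symInl K k l a) (π x)
  ract : ∀ a x, π (X.ract a x) = M.ract (symInl K k l a) (π x)
  deg : ∀ (d : ℤ) (T : Finset (Fin l)), ∀ x ∈ X.deg (d - (c - ∑ j ∈ addLasts p T, D.wt j)),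
    π x ∈ M.deg (d - -∑ j ∈ T, 2 * ((j : ℤ) + 1))
  chain : ∀ (F : Finset (Fin (l + p)) → X.carrier) (T : Finset (Fin l)),
    π (D.lin F (addLasts p T)) = traceKoszul K M (fun T => π (F (addLasts p T))) T
  inj : ∀ F : Finset (Fin (l + p)) → X.carrier, D.lin F = 0 →
    (∃ G, traceKoszul K M G = fun T => π (F (addLasts p T))) → ∃ G, D.lin G = F
  surj : ∀ G : Finset (Fin l) → M.carrier, traceKoszul K M G = 0 →
    ∃ F, D.lin F = 0 ∧ ∃ H, ∀ T, traceKoszul K M H T = π (F (addLasts p T)) - G T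

/-- The application of a linear map to the components that involve the last operators. -/
def lastComponents : (Finset (Fin (l + p)) → X.carrier) →ₗ[K] (Finset (Fin l) → M.carrier) where
  toFun F T := π (F (addLasts p T))
  map_add' _ _ := funext fun _ => map_add π _ _
  map_smul' a _ := funext fun _ => map_smul π a _

variable {D c M π}

/-- The components of the comparison map. -/
noncomputable def TraceComparison.hom (h : TraceComparison D c M π) (n : ℤ) :
    (D.complex c p).X n ⟶ traceX K M n :=
  ⟨traceRes K M n ∘ₗ lastComponents M π ∘ₗ D.ext c p n,
    fun a x => Finsupp.ext fun T =>
      (congrArg (fun F => π (F (addLasts p T.1))) (D.ext_lact c p a x)).trans (h.lact a _),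
    fun a x => Finsupp.ext fun T =>
      (congrArg (fun F => π (F (addLasts p T.1))) (D.ext_ract c p a x)).trans (h.ract a _),
    fun d _ hx T => h.deg d T.1 _ (D.ext_deg c p hx (addLasts p T.1))⟩

/-- Adding `p` indices raises the cardinality by `p`, which is the cohomological shift of the
complex. Outside cardinality `n` both sides vanish. -/
theorem lastComponents_ext (n : ℤ) (x : ((D.complex c p).X n).carrier) :
    traceExt K M n (traceRes K M n (lastComponents M π (D.ext c p n x))) =
      lastComponents M π (D.ext c p n x) := by
  funext T
  by_cases hT : (T.card : ℤ) = n
  · exact cardExt_cardRes (K := K) n _ hT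
  · refine (traceExt_of_ne K M n _ hT).trans ?_
    change 0 = π (D.ext c p n x (addLasts p T))
    rw [D.ext_of_ne c p n x, map_zero]
    rw [card_addLasts]
    push_cast
    omega

/-- The comparison map. -/
noncomputable def TraceComparison.map (h : TraceComparison D c M π) :
    D.complex c p ⟶ partialTrace K M where
  f n := h.hom n
  comm' n m hnm := by
    refine Subtype.ext (LinearMap.ext fun x => ?_)
    change traceRes K M m (traceKoszul K M (traceExt K M n (traceRes K M n
      (lastComponents M π (D.ext c p n x))))) =
      traceRes K M m (lastComponents M π (D.ext c p m (((D.complex c p).d n m).1 x)))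
    rw [lastComponents_ext, D.ext_d c p hnm]
    exact congrArg _ (funext fun T => (h.chain _ T).symm)

/-- The conditions `inj` and `surj` concern families on all subsets at once. A cochain is extended
by zero to such a family, and the primitive or cycle obtained is cut back to a single cardinality,
which is legitimate as the differential raises cardinality by one. -/
theorem TraceComparison.quasiIso (h : TraceComparison D c M π) :
    GrBimod.quasiIso K (symDeg K k) h.map := by
  refine quasiIso_of_elements _ ?_ ?_
  · rintro n m rfl x hx ⟨y, hy⟩
    have hF : D.lin (D.ext c p (n + 1) x) = 0 := by
      rw [← D.ext_d c p rfl, hx, map_zero]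
    have hy' : traceRes K M (n + 1) (traceKoszul K M (traceExt K M n y)) =
      traceRes K M (n + 1) (lastComponents M π (D.ext c p (n + 1) x)) := hy
    obtain ⟨G, hG⟩ := h.inj _ hF ⟨_, (traceExt_traceRes K M n y).symm.trans
      ((congrArg (traceExt K M (n + 1)) hy').trans (lastComponents_ext _ _))⟩
    refine ⟨D.res c p n G, ?_⟩
    rw [D.d_res c p rfl, hG, D.res_ext]
  · rintro n m rfl y hy
    have hy' : traceRes K M (n + 1 + 1) (traceKoszul K M (traceExt K M (n + 1) y)) = 0 := hy
    obtain ⟨F, hF, H, hH⟩ := h.surj _ ((traceExt_traceRes K M (n + 1) y).symm.trans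
      ((congrArg (traceExt K M (n + 1 + 1)) hy').trans (map_zero _)))
    refine ⟨D.res c p (n + 1) F, ?_, traceRes K M n H, ?_⟩
    · rw [D.d_res c p rfl, hF, map_zero]
    · refine Finsupp.ext fun T => ?_
      have h₁ : traceKoszul K M (traceExt K M n (traceRes K M n H)) T.1 =
          traceKoszul K M H T.1 :=
        koszul_congr _ T.2 fun U hU => cardExt_cardRes (K := K) n H hU
      have h₂ : D.ext c p (n + 1) (D.res c p (n + 1) F) (addLasts p T.1) = F (addLasts p T.1) := by
        refine D.ext_res c p _ F ?_
        rw [card_addLasts, Nat.cast_add, T.2]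
      exact h₁.trans ((hH T.1).trans (congrArg₂ (· - ·) (congrArg π h₂.symm) (dif_pos T.2)))

end Trace

/-! ### Comparison of a Koszul complex with a sum of shifted copies -/

section Copies

variable {K R : Type u} [Field K] [CommRing R] [Algebra K R] {𝒜 : ℤ → Submodule K R} {l p : ℕ}
  {κ : Type} {X : GrBimod K 𝒜} (D : KoszulOps X (l + p)) (c : ℤ)
  (s : Finset (Fin l) × κ → ℤ) (M : GrBimod K 𝒜) (ψ : X.carrier →ₗ[K] (κ →₀ M.carrier))

/-- The conditions under which a linear map, applied to the components that involve the first `p`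
operators, induces a quasi-isomorphism from a Koszul complex to a sum of shifted copies of a
bimodule. -/
structure CopiesComparison : Prop where
  lact : ∀ a x m, ψ (X.lact a x) m = M.lact a (ψ x m)
  ract : ∀ a x m, ψ (X.ract a x) m = M.ract a (ψ x m)
  deg : ∀ (d : ℤ) (T : Finset (Fin l)), ∀ x ∈ X.deg (d - (c - ∑ j ∈ addFirsts p T, D.wt j)),
    ∀ m, ψ x m ∈ M.deg (d - s (T, m))
  chain : ∀ (F : Finset (Fin (l + p)) → X.carrier) (T : Finset (Fin l)),
    ψ (D.lin F (addFirsts p T)) = 0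
  inj : ∀ F : Finset (Fin (l + p)) → X.carrier, D.lin F = 0 →
    (∀ T, ψ (F (addFirsts p T)) = 0) → ∃ G, D.lin G = F
  surj : ∀ G : Finset (Fin l) → κ →₀ M.carrier,
    ∃ F, D.lin F = 0 ∧ ∀ T, ψ (F (addFirsts p T)) = G T

/-- The application of a linear map to the components that involve the first operators. -/
noncomputable def firstComponents (n : ℤ) : (Finset (Fin (l + p)) → X.carrier) →ₗ[K]
    ({i : Finset (Fin l) × κ // (i.1.card : ℤ) = n} →₀ M.carrier) where
  toFun F := Finsupp.subtypeDomain (fun i : Finset (Fin l) × κ => (i.1.card : ℤ) = n)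
    ((Finsupp.curryLinearEquiv K).symm
      ((Finsupp.linearEquivFunOnFinite K (κ →₀ M.carrier) (Finset (Fin l))).symm
        fun T => ψ (F (addFirsts p T))))
  map_add' F G := Finsupp.ext fun i =>
    DFunLike.congr_fun (map_add ψ (F (addFirsts p i.1.1)) (G (addFirsts p i.1.1))) i.1.2
  map_smul' a F := Finsupp.ext fun i =>
    DFunLike.congr_fun (map_smul ψ a (F (addFirsts p i.1.1))) i.1.2

variable {D c s M ψ}

/-- The components of the comparison map. -/
noncomputable def CopiesComparison.hom (h : CopiesComparison D c s M ψ) (n : ℤ) :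
    (D.complex c p).X n ⟶
      (copiesComplex (fun i : Finset (Fin l) × κ => i.1.card) s M).X n :=
  ⟨firstComponents M ψ n ∘ₗ D.ext c p n,
    fun a x => Finsupp.ext fun i =>
      (congrArg (fun F => ψ (F (addFirsts p i.1.1)) i.1.2) (D.ext_lact c p a x)).trans
        (h.lact a _ _),
    fun a x => Finsupp.ext fun i =>
      (congrArg (fun F => ψ (F (addFirsts p i.1.1)) i.1.2) (D.ext_ract c p a x)).trans
        (h.ract a _ _),
    fun d _ hx i => h.deg d i.1.1 _ (D.ext_deg c p hx (addFirsts p i.1.1)) i.1.2⟩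

/-- The comparison map. -/
noncomputable def CopiesComparison.map (h : CopiesComparison D c s M ψ) :
    D.complex c p ⟶ copiesComplex (fun i : Finset (Fin l) × κ => i.1.card) s M where
  f n := h.hom n
  comm' n m hnm := by
    refine Subtype.ext (LinearMap.ext fun x => Finsupp.ext fun i => ?_)
    change 0 = ψ (D.ext c p m (((D.complex c p).d n m).1 x) (addFirsts p i.1.1)) i.1.2
    rw [D.ext_d c p hnm, h.chain, Finsupp.zero_apply]

theorem CopiesComparison.quasiIso (h : CopiesComparison D c s M ψ) :
    GrBimod.quasiIso K 𝒜 h.map := by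
  refine quasiIso_of_elements _ ?_ ?_
  · rintro n m rfl x hx ⟨y, hy⟩
    have hF : D.lin (D.ext c p (n + 1) x) = 0 := by
      rw [← D.ext_d c p rfl, hx, map_zero]
    have hy' : 0 = firstComponents M ψ (n + 1) (D.ext c p (n + 1) x) := hy
    obtain ⟨G, hG⟩ := h.inj _ hF (by
      intro T
      by_cases hT : (T.card : ℤ) = n + 1
      · exact Finsupp.ext fun m => (DFunLike.congr_fun hy' ⟨(T, m), hT⟩).symm
      · rw [D.ext_of_ne c p _ x, map_zero]
        rw [card_addFirsts]
        push_cast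
        omega)
    refine ⟨D.res c p n G, ?_⟩
    rw [D.d_res c p rfl, hG, D.res_ext]
  · rintro n m rfl y -
    classical
    -- The target has zero differential, so every `y` is a cycle; it has to be hit exactly, and the
    -- correcting boundary is `0`.
    obtain ⟨F, hF, hG⟩ := h.surj fun T => Finsupp.curryLinearEquiv K
      (Finsupp.extendDomain (show {i : Finset (Fin l) × κ // (i.1.card : ℤ) = n + 1} →₀ M.carrier from y)) T
    refine ⟨D.res c p (n + 1) F, ?_, 0, ?_⟩
    · rw [D.d_res c p rfl, hF, map_zero]
    · rw [map_zero]
      symm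
      rw [sub_eq_zero]
      refine Finsupp.ext fun i => ?_
      have h₂ : D.ext c p (n + 1) (D.res c p (n + 1) F) (addFirsts p i.1.1) =
          F (addFirsts p i.1.1) := by
        refine D.ext_res c p _ F ?_
        rw [card_addFirsts, Nat.cast_add, i.2]
      refine (congrArg (fun x => ψ x i.1.2) h₂).trans ((DFunLike.congr_fun (hG i.1.1) i.1.2).trans ?_)
      exact dif_pos i.2

end Copies

/-! ### The two comparison maps -/

section RingMaps

variable {P Q : Type*} [CommRing P] [CommRing Q] (π : P →+* Q) (f : ℕ → P) {l p : ℕ}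

theorem map_koszulRing (G : Finset (Fin l) → P) (T : Finset (Fin l)) :
    π (koszulRing f l G T) =
      koszul (fun j : Fin l => AddMonoidHom.mulLeft (π (f j))) (fun T => π (G T)) T := by
  simp [koszulRing_apply, koszul]

variable {f} {π}

theorem map_koszulRing_addLasts
    (hker : RingHom.ker π = Ideal.span (f '' {i | l ≤ i ∧ i < l + p}))
    (F : Finset (Fin (l + p)) → P) (T : Finset (Fin l)) :
    π (koszulRing f (l + p) F (addLasts p T)) =
      koszul (fun j : Fin l => AddMonoidHom.mulLeft (π (f j))) (fun T => π (F (addLasts p T))) T := by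
  have h := koszulRing_addLasts f l p F T
  rw [← hker, RingHom.mem_ker, map_sub, sub_eq_zero] at h
  exact h.trans (map_koszulRing π f _ T)

theorem trace_inj (hπ : Function.Surjective π)
    (hq : ModQuasiIso (koszulRing f (l + p)) ⊥ (koszulRing f l) (RingHom.ker π) (addLasts p))
    (F : Finset (Fin (l + p)) → P) (hF : koszulRing f (l + p) F = 0)
    (h : ∃ G, koszul (fun j : Fin l => AddMonoidHom.mulLeft (π (f j))) G =
      fun T => π (F (addLasts p T))) : ∃ G, koszulRing f (l + p) G = F := by
  obtain ⟨G, hG⟩ := h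
  choose G' hG' using fun T => hπ (G T)
  obtain ⟨H, hH⟩ := hq.inj F (fun x => by rw [hF]; exact zero_mem _) ⟨G', fun T => by
    rw [RingHom.mem_ker, map_sub, map_koszulRing, sub_eq_zero, funext hG', hG]⟩
  exact ⟨H, funext fun x => (sub_eq_zero.1 (Ideal.mem_bot.1 (hH x))).symm⟩

theorem trace_surj (hπ : Function.Surjective π)
    (hq : ModQuasiIso (koszulRing f (l + p)) ⊥ (koszulRing f l) (RingHom.ker π) (addLasts p))
    (G : Finset (Fin l) → Q) (hG : koszul (fun j : Fin l => AddMonoidHom.mulLeft (π (f j))) G = 0) :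
    ∃ F, koszulRing f (l + p) F = 0 ∧ ∃ H, ∀ T,
      koszul (fun j : Fin l => AddMonoidHom.mulLeft (π (f j))) H T =
        π (F (addLasts p T)) - G T := by
  choose G' hG' using fun T => hπ (G T)
  obtain ⟨F, hF, H, hH⟩ := hq.surj G' fun T => by
    rw [RingHom.mem_ker, map_koszulRing, funext hG', hG, Pi.zero_apply]
  refine ⟨F, funext fun x => Ideal.mem_bot.1 (hF x), fun T => π (H T), fun T => ?_⟩
  have h := hH T
  rw [RingHom.mem_ker, map_sub, map_sub, hG', map_koszulRing, sub_eq_zero] at h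
  exact h.symm

theorem map_koszulRing_eq_zero {n : ℕ} (hf : ∀ j, π (f j) = 0) (F : Finset (Fin n) → P)
    (T : Finset (Fin n)) : π (koszulRing f n F T) = 0 := by
  simp [koszulRing_apply, hf]

variable {g : ℕ → P}

theorem copies_inj
    (hq : ModQuasiIso (koszulRing f (l + p)) ⊥ (koszulRing g l) (RingHom.ker π) (addFirsts p))
    (F : Finset (Fin (l + p)) → P) (hF : koszulRing f (l + p) F = 0)
    (h : ∀ T, π (F (addFirsts p T)) = 0) : ∃ G, koszulRing f (l + p) G = F := by
  obtain ⟨H, hH⟩ := hq.inj F (fun x => by rw [hF]; exact zero_mem _) ⟨0, fun T => by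
    rw [map_zero, Pi.zero_apply, sub_zero]
    exact h T⟩
  exact ⟨H, funext fun x => (sub_eq_zero.1 (Ideal.mem_bot.1 (hH x))).symm⟩

/-- The remaining operators die under `π`, so an arbitrary lift of `G` is a cycle modulo the kernel.
-/
theorem copies_surj (hπ : Function.Surjective π) (hg : ∀ j, π (g j) = 0)
    (hq : ModQuasiIso (koszulRing f (l + p)) ⊥ (koszulRing g l) (RingHom.ker π) (addFirsts p))
    (G : Finset (Fin l) → Q) :
    ∃ F, koszulRing f (l + p) F = 0 ∧ ∀ T, π (F (addFirsts p T)) = G T := by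
  choose G' hG' using fun T => hπ (G T)
  obtain ⟨F, hF, H, hH⟩ := hq.surj G' fun T => map_koszulRing_eq_zero hg _ _
  refine ⟨F, funext fun x => Ideal.mem_bot.1 (hF x), fun T => ?_⟩
  have h := hH T
  rwa [RingHom.mem_ker, map_sub, map_sub, hG', map_koszulRing_eq_zero hg, sub_zero,
    sub_eq_zero] at h

end RingMaps

/-! ### The projections of `A ⊗_K A` to `A ⊗_S A` and to `A` -/

section Legs

variable {K S A : Type u} [Field K] [CommRing S] [CommRing A] [Algebra K S] [Algebra K A]
  [Algebra S A] [IsScalarTower K S A]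

theorem tensorProj_mem {𝒜 : ℤ → Submodule K A} {d : ℤ} {x : A ⊗[K] A}
    (hx : x ∈ tensorDeg K 𝒜 d) : tensorProj K S A x ∈ tensorDeg S 𝒜 d := by
  induction hx using Submodule.span_induction with
  | mem t ht =>
    obtain ⟨i, j, hij, a, ha, b, hb, rfl⟩ := ht
    exact Submodule.subset_span ⟨i, j, hij, a, ha, b, hb, tensorProj_tmul a b⟩
  | zero => rw [map_zero]; exact zero_mem _
  | add x y _ _ hx hy => rw [map_add]; exact add_mem hx hy
  | smul c x _ hx => rw [map_smul]; exact Submodule.smul_mem _ _ hx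

theorem tensorProj_tensorDiff_mul (a : A) (t : A ⊗[S] A) :
    (tensorProj K S A).toRingHom (tensorDiff K a) * t = a ⊗ₜ 1 * t - 1 ⊗ₜ a * t := by
  have h : (tensorProj K S A).toRingHom (tensorDiff K a) = a ⊗ₜ 1 - 1 ⊗ₜ a := by
    change tensorProj K S A (tensorDiff K a) = _
    rw [tensorDiff, map_sub, tensorProj_tmul, tensorProj_tmul]
  rw [h, sub_mul]

theorem lmul'_mem {𝒜 : ℤ → Submodule K A}
    (hmul : ∀ {i j : ℤ} {a b : A}, a ∈ 𝒜 i → b ∈ 𝒜 j → a * b ∈ 𝒜 (i + j)) {d : ℤ} {x : A ⊗[K] A}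
    (hx : x ∈ tensorDeg K 𝒜 d) : Algebra.TensorProduct.lmul' K x ∈ 𝒜 d := by
  induction hx using Submodule.span_induction with
  | mem t ht =>
    obtain ⟨i, j, rfl, a, ha, b, hb, rfl⟩ := ht
    rw [Algebra.TensorProduct.lmul'_apply_tmul]
    exact hmul ha hb
  | zero => rw [map_zero]; exact zero_mem _
  | add x y _ _ hx hy => rw [map_add]; exact add_mem hx hy
  | smul c x _ hx => rw [map_smul]; exact Submodule.smul_mem _ _ hx

theorem lmul'_surjective : Function.Surjective (Algebra.TensorProduct.lmul' K (S := A)) :=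
  fun a => ⟨a ⊗ₜ 1, by simp⟩

theorem modQuasiIso_tensorProj {p l : ℕ} (e : MvPolynomial (Fin p) K ≃ₐ[K] S) (E : ℕ → S)
    (hE : ∀ j : Fin p, e (MvPolynomial.X j) = E (j + 1)) (hflat : Module.Flat S A) {g : ℕ → A}
    (hg : ∀ j, g (l + j) = algebraMap S A (E (j + 1))) :
    ModQuasiIso (koszulRing (fun j => tensorDiff K (g j)) (l + p)) ⊥
      (koszulRing (fun j => tensorDiff K (g j)) l) (RingHom.ker (tensorProj K S A).toRingHom)
      (addLasts p) := by
  have h := modQuasiIso_addLasts (fun j => tensorDiff K (g j)) l p (I := ⊥) (by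
    intro j hj x hx
    rw [bot_sup_eq] at hx ⊢
    exact last_regular (f := fun j => tensorDiff K (g j)) (regularFamily_last e E hE hflat hg) hj hx)
  rwa [bot_sup_eq, ← ker_tensorProj_last e E hE hg] at h

/-- The first `l + k` entries are the `u_j` and `E_1, …, E_k`. After the triangular substitution
they become the polynomial generators `u_j`, `v_j` of `A`, whose differences are regular and
generate the kernel of multiplication. -/
theorem modQuasiIso_lmul' {l k : ℕ} {E u v : ℕ → A} (hu : u 0 = 1) (hv : v 0 = 1)
    (hul : ∀ r, l < r → u r = 0)
    (hE : ∀ n, E n = ∑ p ∈ Finset.HasAntidiagonal.antidiagonal n, v p.1 * u p.2)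
    (e : MvPolynomial (Fin l ⊕ Fin k) K ≃ₐ[K] A)
    (hu' : ∀ j : Fin l, e (MvPolynomial.X (Sum.inl j)) = u (j + 1))
    (hv' : ∀ j : Fin k, e (MvPolynomial.X (Sum.inr j)) = v (j + 1)) {g : ℕ → A}
    (hg : ∀ j, g j = if j < l then u (j + 1) else E (j - l + 1)) :
    ModQuasiIso (koszulRing (fun j => tensorDiff K (g j)) (l + (l + k))) ⊥
      (koszulRing (fun j => tensorDiff K (g (j + (l + k)))) l)
      (RingHom.ker (Algebra.TensorProduct.lmul' K (S := A)).toRingHom) (addFirsts (l + k)) := by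
  obtain rfl : g = fun j => if j < l then u (j + 1) else E (j - l + 1) := funext hg
  have ht := tensorDiff_triangular (K := K) hu hv hul hE
  have h := modQuasiIso_addFirsts
    (fun j => tensorDiff K (if j < l then u (j + 1) else E (j - l + 1))) l (l + k) (I := ⊥) (by
      intro j hj x hx
      rw [bot_sup_eq] at hx ⊢
      exact span_image_lt_regular
        (f := fun j => tensorDiff K (if j < l then u (j + 1) else E (j - l + 1))) ht
        (regularFamily_reindex e hu' hv') hj hx)
  rwa [bot_sup_eq, span_image_lt_eq
    (f := fun j => tensorDiff K (if j < l then u (j + 1) else E (j - l + 1))) ht,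
    ← ker_lmul'_reindex e hu' hv'] at h

end Legs

/-! ### The common Koszul complex for `R_{k,l}` and its two quotients -/

section Comparison

variable (K : Type u) [Field K] (k l : ℕ)

/-- The operators of the Koszul complex that resolves the partial trace. -/
noncomputable def resolution : KoszulOps (GrBimod.restrict (symInl K k l) (symInl_mem K k l)
    (freeSquare (isInternal_pairDeg K k l) (pairDeg_mul K k l))) (l + (l + k)) :=
  diffOps (isInternal_pairDeg K k l) (pairDeg_mul K k l) (symInl K k l) (symInl_mem K k l)
    (koszulGen_mem K k l) (l + (l + k))

/-- The internal shift of the resolution. -/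
def koszulShift : ℤ := ∑ j ∈ Finset.range (l + k), koszulWt l (l + j) - k * l

theorem koszulGen_add (j : ℕ) : koszulGen K k l (l + j) =
    algebraMap (symTot K k l) (symPair K k l) (esymmTot K k l (j + 1)) := by
  rw [koszulGen, if_neg (by omega), Nat.add_sub_cancel_left]

theorem koszulGen_lt (j : Fin l) : koszulGen K k l j = esymmSnd K k l (j + 1) := if_pos j.2

/-- The projection from the free bimodule to the merge-split bimodule. -/
noncomputable def squareProj : (GrBimod.restrict (symInl K k l) (symInl_mem K k l)
    (freeSquare (isInternal_pairDeg K k l) (pairDeg_mul K k l))).carrier →ₗ[K]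
      (mergeSplit K k l).carrier :=
  (tensorProj K (symTot K k l) (symPair K k l)).toLinearMap

/-- The Koszul differential of the partial trace of the merge-split bimodule, as a multiplication
by differences of the two actions. -/
theorem traceKoszul_mergeSplit (G : Finset (Fin l) → (mergeSplit K k l).carrier) :
    traceKoszul K (mergeSplit K k l) G = koszul (fun j : Fin l => AddMonoidHom.mulLeft
      ((tensorProj K (symTot K k l) (symPair K k l)).toRingHom
        (tensorDiff K (koszulGen K k l j)))) G := by
  refine congrArg (fun δ => koszul δ G) (funext fun j => AddMonoidHom.ext fun b => ?_)
  rw [koszulGen_lt]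
  exact (tensorProj_tensorDiff_mul (esymmSnd K k l (j + 1)) b).symm

theorem squareProj_lact (a : symPair K k l) (x : symPair K k l ⊗[K] symPair K k l) :
    tensorProj K (symTot K k l) (symPair K k l) (a ⊗ₜ 1 * x) =
      a ⊗ₜ 1 * tensorProj K (symTot K k l) (symPair K k l) x := by
  rw [map_mul, tensorProj_tmul]

theorem squareProj_ract (a : symPair K k l) (x : symPair K k l ⊗[K] symPair K k l) :
    tensorProj K (symTot K k l) (symPair K k l) (1 ⊗ₜ a * x) =
      1 ⊗ₜ a * tensorProj K (symTot K k l) (symPair K k l) x := by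
  rw [map_mul, tensorProj_tmul]

/-- The shift is the total weight of the last `l + k` operators, which cancels here, together with
the shift `-kl` of the merge-split bimodule. -/
theorem koszulShift_sub_sum_addLasts (T : Finset (Fin l)) :
    koszulShift k l - ∑ j ∈ addLasts (l + k) T, koszulWt l j =
      -∑ j ∈ T, 2 * ((j : ℤ) + 1) - k * l := by
  have h : ∀ j ∈ T, koszulWt l j = 2 * ((j : ℤ) + 1) := fun j _ => if_pos j.2
  rw [sum_addLasts (l + k) (koszulWt l) T, koszulShift, Finset.sum_congr rfl h]
  ring

theorem traceComparison [CharZero K] :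
    TraceComparison (resolution K k l) (koszulShift k l) (mergeSplit K k l)
      (squareProj K k l) := by
  have hker := ker_tensorProj_last (A := symPair K k l) (symTotEquiv K k l) (esymmTot K k l)
    (symTotEquiv_X' K k l) (koszulGen_add K k l)
  have hq := modQuasiIso_tensorProj (A := symPair K k l) (symTotEquiv K k l) (esymmTot K k l)
    (symTotEquiv_X' K k l) (flat_symPair K k l) (koszulGen_add K k l)
  have hs : Function.Surjective
    (tensorProj K (symTot K k l) (symPair K k l)).toRingHom := tensorProj_surjective
  constructor
  · exact fun a x => squareProj_lact K k l (symInl K k l a) x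
  · exact fun a x => squareProj_ract K k l (symInl K k l a) x
  · intro d T x hx
    have hd : d - -∑ j ∈ T, 2 * ((j : ℤ) + 1) - -(k * l : ℤ) =
        d - (koszulShift k l - ∑ j ∈ addLasts (l + k) T, koszulWt l j) := by
      rw [koszulShift_sub_sum_addLasts]
      ring
    change squareProj K k l x ∈ tensorDeg _ _ (d - -∑ j ∈ T, 2 * ((j : ℤ) + 1) - -(k * l : ℤ))
    rw [hd]
    exact tensorProj_mem hx
  · exact fun F T => (map_koszulRing_addLasts hker F T).trans
      (congrFun (traceKoszul_mergeSplit K k l _) T).symm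
  · exact fun F hF ⟨G, hG⟩ => trace_inj hs hq F hF
      ⟨G, (traceKoszul_mergeSplit K k l G).symm.trans hG⟩
  · intro G hG
    obtain ⟨F, hF, H, hH⟩ := trace_surj hs hq G ((traceKoszul_mergeSplit K k l G).symm.trans hG)
    exact ⟨F, hF, H, fun T => (congrFun (traceKoszul_mergeSplit K k l H) T).trans (hH T)⟩

/-- The coefficients of the expansion in the elementary symmetric polynomials of the second
alphabet. -/
noncomputable def pairCoeff : symPair K k l →ₗ[K] ((Fin l →₀ ℕ) →₀ sym K k) where
  toFun a := AddMonoidAlgebra.coeff ((pairEquiv K k l).symm a)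
  map_add' a b := by rw [map_add]; rfl
  map_smul' c a := by rw [map_smul]; rfl

theorem pairCoeff_apply (a : symPair K k l) (m : Fin l →₀ ℕ) :
    pairCoeff K k l a m = ((pairEquiv K k l).symm a).coeff m := rfl

theorem pairCoeff_symInl_mul (c : sym K k) (a : symPair K k l) (m : Fin l →₀ ℕ) :
    pairCoeff K k l (symInl K k l c * a) m = c * pairCoeff K k l a m := by
  rw [pairCoeff_apply, pairCoeff_apply, map_mul, ← pairEquiv_C, AlgEquiv.symm_apply_apply,
    MvPolynomial.coeff_C_mul]

theorem pairCoeff_injective : Function.Injective (pairCoeff K k l) := fun _ _ h =>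
  (pairEquiv K k l).symm.injective (AddMonoidAlgebra.coeff_injective h)

theorem pairCoeff_surjective : Function.Surjective (pairCoeff K k l) := fun f =>
  ⟨pairEquiv K k l (AddMonoidAlgebra.ofCoeff f),
    congrArg AddMonoidAlgebra.coeff ((pairEquiv K k l).symm_apply_apply _)⟩

/-- The multiplication, followed by the expansion in the elementary symmetric polynomials of the
second alphabet. -/
noncomputable def squareCoeff : (GrBimod.restrict (symInl K k l) (symInl_mem K k l)
    (freeSquare (isInternal_pairDeg K k l) (pairDeg_mul K k l))).carrier →ₗ[K]
      ((Fin l →₀ ℕ) →₀ (strand K k).carrier) :=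
  pairCoeff K k l ∘ₗ (Algebra.TensorProduct.lmul' K (S := symPair K k l)).toLinearMap

theorem lmul'_lact (a : symPair K k l) (x : symPair K k l ⊗[K] symPair K k l) :
    Algebra.TensorProduct.lmul' K (a ⊗ₜ 1 * x) = a * Algebra.TensorProduct.lmul' K x := by
  rw [map_mul, Algebra.TensorProduct.lmul'_apply_tmul, mul_one]

theorem lmul'_ract (a : symPair K k l) (x : symPair K k l ⊗[K] symPair K k l) :
    Algebra.TensorProduct.lmul' K (1 ⊗ₜ a * x) = a * Algebra.TensorProduct.lmul' K x := by
  rw [map_mul, Algebra.TensorProduct.lmul'_apply_tmul, one_mul]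

/-- The internal shifts of the copies of the strand. -/
def strandShift (i : Finset (Fin l) × (Fin l →₀ ℕ)) : ℤ :=
  k * l - ∑ j ∈ i.1, 2 * ((k : ℤ) + j + 1) + monomialDeg i.2

/-- The weights of `E_{l+1}, …, E_{l+k}` exceed those of `E_1, …, E_k` by `2l` each. The total
excess `2kl` turns `-kl` into `+kl`. -/
theorem koszulShift_eq : koszulShift k l = k * l + ∑ j ∈ Finset.range (l + k), koszulWt l j := by
  have h₁ : ∀ j, koszulWt l (l + j) = 2 * ((j : ℤ) + 1) := fun j => by
    rw [koszulWt, if_neg (by omega)]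
    push_cast
    ring
  have h₂ : ∀ j ∈ Finset.range l, koszulWt l j = 2 * ((j : ℤ) + 1) := fun j hj =>
    if_pos (Finset.mem_range.1 hj)
  rw [koszulShift, Finset.sum_range_add, Finset.sum_range_add, Finset.sum_congr rfl h₂,
    Finset.sum_congr rfl fun j _ => h₁ j, Finset.sum_congr rfl fun j _ => h₁ j,
    Finset.sum_congr rfl fun j _ => h₁ (l + j)]
  have h₃ : ∑ j ∈ Finset.range k, 2 * (((l + j : ℕ) : ℤ) + 1) =
      ∑ j ∈ Finset.range k, 2 * ((j : ℤ) + 1) + 2 * (k * l) := by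
    have : ∀ j ∈ Finset.range k, 2 * (((l + j : ℕ) : ℤ) + 1) = 2 * ((j : ℤ) + 1) + 2 * l :=
      fun j _ => by push_cast; ring
    rw [Finset.sum_congr rfl this, Finset.sum_add_distrib, Finset.sum_const, Finset.card_range]
    ring
  rw [h₃]
  ring

/-- Behind the first `l + k` operators come `E_{k+1}, …, E_{k+l}`, whose weights are subtracted. -/
theorem koszulShift_sub_sum_addFirsts (T : Finset (Fin l)) :
    koszulShift k l - ∑ j ∈ addFirsts (l + k) T, koszulWt l j =
      k * l - ∑ j ∈ T, 2 * ((k : ℤ) + j + 1) := by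
  have h : ∀ j ∈ T, koszulWt l (j + (l + k)) = 2 * ((k : ℤ) + j + 1) := fun j _ => by
    rw [koszulWt, if_neg (by omega)]
    push_cast
    ring
  rw [sum_addFirsts (l + k) (koszulWt l) T, koszulShift_eq, Finset.sum_congr rfl h]
  ring

/-- After multiplication the two actions of `R_k` agree, and the expansion in monomials of the
second alphabet is linear over `R_k`; hence every summand is an identity strand. -/
theorem copiesComparison :
    CopiesComparison (resolution K k l) (koszulShift k l) (strandShift k l) (strand K k)
      (squareCoeff K k l) := by
  have hq := modQuasiIso_lmul' (esymmSnd_zero K k l) (esymmFst_zero K k l)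
    (fun r => esymmSnd_eq_zero K k l) (algebraMap_esymmTot K k l) (genEquiv K k l)
    (genEquiv_inl K k l) (genEquiv_inr K k l) (g := koszulGen K k l) fun _ => rfl
  have hs : Function.Surjective
    (Algebra.TensorProduct.lmul' K (S := symPair K k l)).toRingHom := lmul'_surjective
  have hf : ∀ j, (Algebra.TensorProduct.lmul' K (S := symPair K k l)).toRingHom
    (tensorDiff K (koszulGen K k l j)) = 0 := fun j => lmul'_tensorDiff _
  constructor
  · exact fun a x m => (congrArg (fun y => pairCoeff K k l y m)
      (lmul'_lact K k l (symInl K k l a) x)).trans (pairCoeff_symInl_mul K k l a _ m)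
  · exact fun a x m => (congrArg (fun y => pairCoeff K k l y m)
      (lmul'_ract K k l (symInl K k l a) x)).trans (pairCoeff_symInl_mul K k l a _ m)
  · intro d T x hx m
    have hd : d - strandShift k l (T, m) =
        d - (koszulShift k l - ∑ j ∈ addFirsts (l + k) T, koszulWt l j) - monomialDeg m := by
      rw [koszulShift_sub_sum_addFirsts, strandShift]
      ring
    rw [hd]
    exact coeff_pairEquiv_symm_mem K k l (lmul'_mem (pairDeg_mul K k l) hx) m
  · exact fun F T => (congrArg (pairCoeff K k l) (map_koszulRing_eq_zero
      (P := symPair K k l ⊗[K] symPair K k l) hf F _)).trans (map_zero _)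
  · exact fun F hF h => copies_inj hq F hF fun T =>
      pairCoeff_injective K k l ((h T).trans (map_zero _).symm)
  · intro G
    choose G' hG' using fun T => pairCoeff_surjective K k l (G T)
    obtain ⟨F, hF, h⟩ := copies_surj hs (fun j => hf (j + (l + k))) hq G'
    exact ⟨F, hF, fun T => (congrArg (pairCoeff K k l) (h T)).trans (hG' T)⟩

/-- The two quasi-isomorphisms share their source and form a roof; its left leg is inverted in the
derived category. -/
theorem partialTrace_mergeSplit_iso [CharZero K] :
    Nonempty (GrBimod.toDerived (partialTrace K (mergeSplit K k l)) ≅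
      GrBimod.toDerived (copiesComplex (fun i : Finset (Fin l) × (Fin l →₀ ℕ) => i.1.card)
        (strandShift k l) (strand K k))) :=
  ⟨(derivedIso _ (traceComparison K k l).quasiIso).symm ≪≫
    derivedIso _ (copiesComparison K k l).quasiIso⟩

end Comparison

/-! ### The graded dimension of the multiplicity -/

section GradedDim

open Polynomial

variable {ι ι' : Type} {a : ι → ℕ} {s : ι → ℤ} {P : Polynomial (LaurentSeries ℚ)}

theorem HasGradedDim.of_bijective {g : ι' → ι} (hg : Function.Bijective g)
    (h : HasGradedDim (a ∘ g) (s ∘ g) P) : HasGradedDim a s P := by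
  intro n d
  have e : {i | a i = n ∧ s i = d} = g '' {i | (a ∘ g) i = n ∧ (s ∘ g) i = d} := by
    ext i
    obtain ⟨j, rfl⟩ := hg.2 i
    constructor
    · exact fun hj => ⟨j, hj, rfl⟩
    · rintro ⟨j', hj, h⟩
      rwa [← hg.1 h]
  rw [e, Set.ncard_image_of_injective _ hg.1]
  exact ⟨(h n d).1.image g, (h n d).2⟩

theorem coeff_mul_single_sub (x : LaurentSeries ℚ) (d v : ℤ) :
    (x * HahnSeries.single v 1).coeff d = x.coeff (d - v) := by
  have h := HahnSeries.coeff_mul_single_add (r := (1 : ℚ)) (x := x) (a := d - v) (b := v)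
  rwa [sub_add_cancel, mul_one] at h

/-- The Boolean records which summand of the binomial is chosen. -/
theorem HasGradedDim.prod_bool (h : HasGradedDim a s P) (v w : ℤ) :
    HasGradedDim (fun i : ι × Bool => a i.1 + cond i.2 1 0)
      (fun i : ι × Bool => s i.1 + cond i.2 w v)
      (P * (C (HahnSeries.single v 1) + X * C (HahnSeries.single w 1))) := by
  intro n d
  have e : {i : ι × Bool | a i.1 + cond i.2 1 0 = n ∧ s i.1 + cond i.2 w v = d} =
      (fun i => (i, false)) '' {i | a i = n ∧ s i = d - v} ∪
        (fun i => (i, true)) '' {i | a i + 1 = n ∧ s i = d - w} := by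
    ext ⟨i, b⟩
    cases b
    · simp [eq_sub_iff_add_eq]
    · simp [eq_sub_iff_add_eq]
  have hdisj : Disjoint ((fun i => (i, false)) '' {i | a i = n ∧ s i = d - v})
      ((fun i => (i, true)) '' {i | a i + 1 = n ∧ s i = d - w}) := by
    rw [Set.disjoint_left]
    rintro _ ⟨i, _, rfl⟩ ⟨j, _, h⟩
    simp at h
  have hfin : {i | a i + 1 = n ∧ s i = d - w}.Finite := by
    cases n with
    | zero => simp
    | succ n => simpa using (h n (d - w)).1
  have hinj : ∀ b : Bool, Function.Injective fun i : ι => (i, b) :=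
    fun b i j hij => congrArg Prod.fst hij
  have hf := (h n (d - v)).1.image fun i => (i, false)
  have ht := hfin.image fun i => (i, true)
  rw [e]
  refine ⟨hf.union ht, ?_⟩
  rw [Set.ncard_union_eq hdisj hf ht, Set.ncard_image_of_injective _ (hinj _),
    Set.ncard_image_of_injective _ (hinj _), Nat.cast_add, ← (h n (d - v)).2, mul_add, coeff_add,
    coeff_mul_C, HahnSeries.coeff_add, coeff_mul_single_sub, ← mul_assoc, coeff_mul_C,
    coeff_mul_single_sub]
  congr 1
  cases n with
  | zero => simp
  | succ n =>
    rw [coeff_mul_X, (h n (d - w)).2]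
    simp

/-- Laurent series have finitely many negative exponents. This bound starts the inductions on the
internal degree for the geometric series. -/
theorem HasGradedDim.bddBelow (h : HasGradedDim a s P) (n : ℕ) (i : ι) (hi : a i = n) :
    (P.coeff n).order ≤ s i := by
  by_contra hlt
  have h₁ := (h n (s i)).2
  rw [HahnSeries.coeff_eq_zero_of_lt_order (not_le.1 hlt)] at h₁
  have h₂ := (Set.ncard_eq_zero (h n (s i)).1).1 (Nat.cast_eq_zero.1 h₁.symm)
  have h₃ : i ∈ {j | a j = n ∧ s j = s i} := ⟨hi, rfl⟩
  rw [h₂] at h₃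
  exact h₃

/-- A function vanishing far to the left is determined by its product with `1 - q^r`, by recursion
upwards from the bound. -/
theorem eq_of_sub_shift {y z : ℤ → ℚ} {r B : ℤ} (hr : 0 < r) (hy : ∀ d < B, y d = 0)
    (hz : ∀ d < B, z d = 0) (h : ∀ d, y d - y (d - r) = z d - z (d - r)) : y = z := by
  have key : ∀ (m : ℕ) (d : ℤ), d < B + m → y d = z d := by
    intro m
    induction m with
    | zero =>
      intro d hd
      rw [Nat.cast_zero, add_zero] at hd
      rw [hy d hd, hz d hd]
    | succ m ih =>
      intro d hd
      have h₁ := ih (d - r) (by push_cast at hd; omega)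
      have h₂ := h d
      linarith
  funext d
  exact key (d - B + 1).toNat d (by omega)

/-- The natural number is the exponent in the geometric series. Separating exponent `0` from
positive exponents gives the counts a recursion with step `r`, which the coefficients of the product
also satisfy. -/
theorem HasGradedDim.prod_nat (h : HasGradedDim a s P) {r : ℤ} (hr : 0 < r) :
    HasGradedDim (fun i : ι × ℕ => a i.1) (fun i : ι × ℕ => s i.1 + r * i.2)
      (P * C ((1 - HahnSeries.single r 1)⁻¹)) := by
  intro n
  have e : ∀ d, {i : ι × ℕ | a i.1 = n ∧ s i.1 + r * i.2 = d} =
      (fun i => (i, 0)) '' {i | a i = n ∧ s i = d} ∪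
        (fun i => (i.1, i.2 + 1)) '' {i : ι × ℕ | a i.1 = n ∧ s i.1 + r * i.2 = d - r} := by
    intro d
    ext ⟨i, c⟩
    cases c with
    | zero => simp
    | succ c =>
      have : s i + r * (c + 1) = d ↔ s i + r * c = d - r := by constructor <;> intro h <;> linarith
      simp [this]
  have hdisj : ∀ d, Disjoint ((fun i => (i, 0)) '' {i | a i = n ∧ s i = d})
      ((fun i => (i.1, i.2 + 1)) '' {i : ι × ℕ | a i.1 = n ∧ s i.1 + r * i.2 = d - r}) := by
    intro d
    rw [Set.disjoint_left]
    rintro _ ⟨i, _, rfl⟩ ⟨j, _, h⟩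
    simp at h
  have hempty : ∀ d < (P.coeff n).order,
      {i : ι × ℕ | a i.1 = n ∧ s i.1 + r * i.2 = d} = ∅ := by
    intro d hd
    refine Set.eq_empty_iff_forall_notMem.2 ?_
    rintro ⟨i, c⟩ ⟨h₁, h₂⟩
    have h₃ := h.bddBelow n i h₁
    have h₄ : 0 ≤ r * (c : ℤ) := by positivity
    simp only at h₂
    omega
  have hfin : ∀ d, {i : ι × ℕ | a i.1 = n ∧ s i.1 + r * i.2 = d}.Finite := by
    have key : ∀ (m : ℕ) (d : ℤ), d < (P.coeff n).order + m →
        {i : ι × ℕ | a i.1 = n ∧ s i.1 + r * i.2 = d}.Finite := by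
      intro m
      induction m with
      | zero =>
        intro d hd
        rw [hempty d (by simpa using hd)]
        exact Set.finite_empty
      | succ m ih =>
        intro d hd
        rw [e d]
        exact ((h n d).1.image _).union ((ih (d - r) (by push_cast at hd; omega)).image _)
    exact fun d => key (d - (P.coeff n).order + 1).toNat d (by omega)
  have hcard : ∀ d, ({i : ι × ℕ | a i.1 = n ∧ s i.1 + r * i.2 = d}.ncard : ℚ) =
      (P.coeff n).coeff d +
        ({i : ι × ℕ | a i.1 = n ∧ s i.1 + r * i.2 = d - r}.ncard : ℚ) := by
    intro d
    rw [e d, Set.ncard_union_eq (hdisj d) ((h n d).1.image _) ((hfin (d - r)).image _),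
      Set.ncard_image_of_injective _ fun i j hij => congrArg Prod.fst hij,
      Set.ncard_image_of_injective _ fun i j hij => ?_, Nat.cast_add, (h n d).2]
    simp only [Prod.mk.injEq, Nat.add_right_cancel_iff] at hij
    exact Prod.ext hij.1 hij.2
  -- The constant coefficient is `1` because `r ≠ 0`, so the inverse is a genuine one.
  have hne : (1 - HahnSeries.single r 1 : LaurentSeries ℚ) ≠ 0 := by
    intro h0
    have := congrArg (fun x : LaurentSeries ℚ => x.coeff 0) h0
    simp [hr.ne] at this
  have hmul : P.coeff n * (1 - HahnSeries.single r 1)⁻¹ * (1 - HahnSeries.single r 1) =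
      P.coeff n := inv_mul_cancel_right₀ hne _
  set y := P.coeff n * (1 - HahnSeries.single r 1)⁻¹ with hy
  have hy' : ∀ d, y.coeff d - y.coeff (d - r) = (P.coeff n).coeff d := by
    intro d
    rw [← hmul, mul_sub, mul_one, HahnSeries.coeff_sub, coeff_mul_single_sub]
  have hyz := eq_of_sub_shift (y := y.coeff)
    (z := fun d => ({i : ι × ℕ | a i.1 = n ∧ s i.1 + r * i.2 = d}.ncard : ℚ))
    (B := min y.order (P.coeff n).order) hr
    (fun d hd => HahnSeries.coeff_eq_zero_of_lt_order (lt_of_lt_of_le hd (min_le_left _ _)))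
    (fun d hd => by
      rw [hempty d (lt_of_lt_of_le hd (min_le_right _ _)), Set.ncard_empty, Nat.cast_zero])
    (fun d => by
      rw [hy', hcard d, add_sub_cancel_right])
  refine fun d => ⟨hfin d, ?_⟩
  rw [coeff_mul_C]
  exact congrFun hyz d

/-- Adding one element to the second alphabet. -/
noncomputable def strandIndex (l : ℕ)
    (i : ((Finset (Fin l) × (Fin l →₀ ℕ)) × Bool) × ℕ) : Finset (Fin (l + 1)) × (Fin (l + 1) →₀ ℕ) :=
  (cond i.1.2 (addLast i.1.1.1) (i.1.1.1.map Fin.castSuccEmb),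
    Finsupp.equivFunOnFinite.symm (Fin.snoc (α := fun _ => ℕ) i.1.1.2 i.2))

theorem last_mem_cond {l : ℕ} (T : Finset (Fin l)) (b : Bool) :
    Fin.last l ∈ cond b (addLast T) (T.map Fin.castSuccEmb) ↔ b = true := by
  cases b
  · simp
  · simp [addLast]

theorem strandIndex_bijective (l : ℕ) : Function.Bijective (strandIndex l) := by
  constructor
  · rintro ⟨⟨⟨T, m⟩, b⟩, c⟩ ⟨⟨⟨T', m'⟩, b'⟩, c'⟩ h
    obtain ⟨h₁, h₂⟩ := Prod.mk.injEq .. ▸ h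
    have h₃ := Finsupp.equivFunOnFinite.symm.injective h₂
    dsimp only at h₁ h₃
    have hc : c = c' := by simpa using congrFun h₃ (Fin.last l)
    have hm : m = m' := Finsupp.ext fun j => by simpa using congrFun h₃ j.castSucc
    have hb : b = b' := by
      rw [Bool.eq_iff_iff, ← last_mem_cond T, h₁, last_mem_cond]
    subst hb hc hm
    have hT : T = T' := by
      cases b
      · exact Finset.map_injective _ h₁
      · have := congrArg (fun U => U.erase (Fin.last l)) h₁
        simpa only [cond_true, addLast, Finset.erase_insert (last_notMem _), Finset.map_inj]
          using this
    rw [hT]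
  · rintro ⟨T, m⟩
    have hm : Finsupp.equivFunOnFinite.symm (Fin.snoc (α := fun _ => ℕ)
        (Finsupp.equivFunOnFinite.symm (Fin.init (α := fun _ => ℕ) m)) (m (Fin.last l))) = m := by
      refine Finsupp.ext fun j => ?_
      exact congrFun (Fin.snoc_init_self (α := fun _ => ℕ) m) j
    obtain ⟨U, rfl | rfl⟩ := exists_last T
    · exact ⟨(((U, Finsupp.equivFunOnFinite.symm (Fin.init (α := fun _ => ℕ) m)), false),
        m (Fin.last l)), Prod.ext rfl hm⟩
    · exact ⟨(((U, Finsupp.equivFunOnFinite.symm (Fin.init (α := fun _ => ℕ) m)), true),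
        m (Fin.last l)), Prod.ext rfl hm⟩

theorem card_strandIndex (l : ℕ) (i : ((Finset (Fin l) × (Fin l →₀ ℕ)) × Bool) × ℕ) :
    (strandIndex l i).1.card = i.1.1.1.card + cond i.1.2 1 0 := by
  obtain ⟨⟨⟨T, m⟩, b⟩, c⟩ := i
  cases b
  · exact Finset.card_map _
  · exact card_addLasts 1 T

/-- Passing from `l` to `l + 1` adds `k` to `kl`. If the last index is chosen, `2(k + l + 1)` is
subtracted, leaving `-k - 2(l + 1)`; the new exponent contributes multiples of `2(l + 1)`. -/
theorem strandShift_strandIndex (k l : ℕ) (i : ((Finset (Fin l) × (Fin l →₀ ℕ)) × Bool) × ℕ) :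
    strandShift k (l + 1) (strandIndex l i) = strandShift k l i.1.1 +
      cond i.1.2 (-(k : ℤ) - 2 * (l + 1 : ℕ)) k + 2 * (l + 1 : ℕ) * i.2 := by
  obtain ⟨⟨⟨T, m⟩, b⟩, c⟩ := i
  have hm : monomialDeg (strandIndex l (((T, m), b), c)).2 =
      monomialDeg m + c * (2 * ((l : ℤ) + 1)) := by
    simp [monomialDeg, strandIndex, Fin.sum_univ_castSucc]
  rw [strandShift, strandShift, hm]
  cases b
  · have h : ∑ j ∈ (strandIndex l (((T, m), false), c)).1, 2 * ((k : ℤ) + j + 1) =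
        ∑ j ∈ T, 2 * ((k : ℤ) + j + 1) := by
      simp [strandIndex]
    rw [h]
    push_cast
    simp only [cond_false]
    ring
  · have h : ∑ j ∈ (strandIndex l (((T, m), true), c)).1, 2 * ((k : ℤ) + j + 1) =
        ∑ j ∈ T, 2 * ((k : ℤ) + j + 1) + 2 * ((k : ℤ) + l + 1) := by
      simp only [strandIndex, cond_true, addLast]
      rw [Finset.sum_insert (last_notMem _), Finset.sum_map, add_comm]
      simp
    rw [h]
    push_cast
    simp only [cond_true]
    ring

/-- Induction on `l`: the new binomial decides whether the last index belongs to the subset, and the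
new geometric series counts the exponent of the last elementary symmetric polynomial. -/
theorem hasGradedDim_strandShift (k l : ℕ) :
    HasGradedDim (fun i : Finset (Fin l) × (Fin l →₀ ℕ) => i.1.card) (strandShift k l)
      (multSeries k l) := by
  induction l with
  | zero =>
    intro n d
    have e : {i : Finset (Fin 0) × (Fin 0 →₀ ℕ) | i.1.card = n ∧ strandShift k 0 i = d} =
        if n = 0 ∧ d = 0 then {default} else ∅ := by
      ext i
      obtain rfl := Subsingleton.elim i default
      split_ifs with h
      · simp [h.1, h.2, strandShift, monomialDeg, Finset.eq_empty_of_isEmpty]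
      · have : ¬ (0 = n ∧ 0 = d) := fun h' => h ⟨h'.1.symm, h'.2.symm⟩
        simpa [strandShift, monomialDeg, Finset.eq_empty_of_isEmpty] using this
    refine ⟨Set.toFinite _, ?_⟩
    rw [e]
    simp only [multSeries, Finset.Icc_eq_empty_of_lt zero_lt_one, Finset.prod_empty, coeff_one]
    split_ifs with h₁ h₂ h₂
    · simp [h₂.2]
    · have : d ≠ 0 := fun h => h₂ ⟨h₁, h⟩
      simp [HahnSeries.coeff_one, this]
    · exact absurd h₂.1 h₁
    · simp
  | succ l ih =>
    refine HasGradedDim.of_bijective (strandIndex_bijective l) ?_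
    have h := (ih.prod_bool k (-(k : ℤ) - 2 * (l + 1 : ℕ))).prod_nat
      (r := 2 * (l + 1 : ℕ)) (by positivity)
    have hP : multSeries k (l + 1) = multSeries k l *
        (C (HahnSeries.single (k : ℤ) 1) +
          X * C (HahnSeries.single (-(k : ℤ) - 2 * (l + 1 : ℕ)) 1)) *
        C ((1 - HahnSeries.single (2 * (l + 1 : ℕ) : ℤ) 1)⁻¹) := by
      rw [multSeries, Finset.prod_Icc_succ_top (by omega), ← mul_assoc]
      rfl
    rw [hP]
    convert h using 1
    · exact funext fun i => card_strandIndex l i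
    · exact funext fun i => strandShift_strandIndex k l i

end GradedDim

end PartialTrace

open PartialTrace in
theorem lemma4p7 (K : Type u) [Field K] [CharZero K] (k l : ℕ) :
    ∃ (ι : Type) (a : ι → ℕ) (s : ι → ℤ), HasGradedDim a s (multSeries k l) ∧
      Nonempty (GrBimod.toDerived (partialTrace K (mergeSplit K k l)) ≅
        GrBimod.toDerived (copiesComplex a s (strand K k))) := by
  exact ⟨_, _, _, hasGradedDim_strandShift k l, partialTrace_mergeSplit_iso K k l⟩
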